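/- Let $d\in\{2,3\}$, let $\Omega\subset\mathbb R^d$ be a bounded polyhedral domain (equal to the interior of its closure), $\nu>0$, and let $\gamma,\delta,\kappa>0$. Then there is a constant $C>0$, depending only on $d,\Omega,\nu,\gamma,\delta,\kappa$, such that the following holds. **Mesh.** Let $\mathcal T_h$ be a conforming Delaunay triangulation of $\overline\Omega$ by $d$-simplices $\triangle$ with diameters $h_\triangle$, $h=\max_\triangle h_\triangle$, such that every $\triangle$ contains a ball of radius $\gamma h_\triangle$ and $h_\triangle\ge\delta h$. For an interior vertex $\mathbf p_i$ (a vertex in $\Omega$) let the box $B_i$ be its closed Voronoi cell with respect to the set of all vertices, with outer unit normal $\mathbf n_i$; assume $B_i\subset\Omega$. Let $\mathcal B_h$ be the set of these boxes, $\mathcal F_h$ the set of faces $F_{ij}=B_i\cap B_j$ of positive $(d-1)$-dimensional measure between two different boxes of $\mathcal B_h$, $G_i$ the set of boxes $B_j$ with $F_{ij}\in\mathcal F_h$, $d_{ij}=|\mathbf p_i-\mathbf p_j|$, $\mathbf n_{ij}=(\mathbf p_j-\mathbf p_i)/d_{ij}$, and $w_{ij}$ the distance of $\mathbf p_j$ from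 the hyperplane of $F_{ij}$ divided by $d_{ij}$. Assume that for every box $B_i$ there is an element $\triangle$ meeting $B_i$ with $\kappa^{-1}h_\triangle^d\le|B_i|\le\kappa h_\triangle^d$, and for every $B_i$ and $B_j\in G_i$ there is an element $\triangle$ meeting $B_i$ with $\kappa^{-1}h_\triangle\le d_{ij}\le\kappa h_\triangle$ and $\kappa^{-1}h_\triangle^{d-1}\le|F_{ij}|\le\kappa h_\triangle^{d-1}$. Let $h_{F_{ij}}$ be the least $h_\triangle$ among the elements meeting $F_{ij}$. **Spaces.** $\mathcal V_h$ is the space of continuous functions on $\overline\Omega$ that are affine on every $\triangle$, and $\Pi_hv=\sum_{B_i\in\mathcal B_h}v(\mathbf p_i)\chi_{B_i}$ for $v\in\mathcal V_h$ (componentwise for vector functions). For $w$ constant on every box, $w_i$ is its value on $B_i$ and $[\![w]\!]_{ij}=w_i-w_j$; we write $\Pi_hq_i=(\Pi_hq)_i$. **Forms.** Let $$a_B(\mathbf v,\mathbf w)=-\sum_i\int_{\partial B_i}\nu\,\partial_{\mathbf n_i}\mathbf v\cdot\mathbf w,\qquad b_B(\mathbf w,q)=\sum_i\int_{\partial B_i}q\,\mathbf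 n_i\cdot\mathbf w,\qquad c_B(\mathbf v,w)=\sum_i\int_{\partial B_i}\mathbf n_i\cdot\mathbf v\,w,$$ with values on $\partial B_i$ in the sense of traces, and let $D_i=\sum_{B_j\in G_i}\nu|F_{ij}|/d_{ij}$. Let $s_B=s_B^1-s_B^2$ with $$s_B^1(q,w)=\sum_{F_{ij}\in\mathcal F_h}\int_{F_{ij}}\Big(w_{ij}D_i^{-1}\!\int_{B_i}\!\nabla q+(1-w_{ij})D_j^{-1}\!\int_{B_j}\!\nabla q\Big)\cdot\mathbf n_{ij}\,[\![w]\!]_{ij},$$ $$s_B^2(q,w)=\sum_{F_{ij}\in\mathcal F_h}\int_{F_{ij}}\big(w_{ij}|B_i|D_i^{-1}+(1-w_{ij})|B_j|D_j^{-1}\big)\,\partial_{\mathbf n_{ij}}q\,[\![w]\!]_{ij},$$ and $\mathcal C_B((\mathbf u,p),(\mathbf w,w))=a_B(\mathbf u,\mathbf w)+b_B(\mathbf w,p)+c_B(\mathbf u,w)+s_B(p,w)$. For $\mathbf v$, $q$ in the discrete spaces let $$\tilde b_B(\mathbf w,q)=\sum_i\sum_{B_j\in G_i}|F_{ij}|\,[w_{ij}\Pi_hq_i+(1-w_{ij})\Pi_hq_j]\,\mathbf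 n_{ij}\cdot\mathbf w_i,$$ $$\tilde c_B(\mathbf v,w)=\sum_i\sum_{B_j\in G_i}|F_{ij}|\,[w_{ij}\Pi_h\mathbf v_i+(1-w_{ij})\Pi_h\mathbf v_j]\cdot\mathbf n_{ij}\,w_i,$$ $g_i(q)=\sum_{B_k\in G_i}|F_{ik}|\,(w_{ik}\Pi_hq_i+(1-w_{ik})\Pi_hq_k)\,\mathbf n_{ik}$, and $$\tilde s_B(q,w)=\sum_i\sum_{B_j\in G_i}|F_{ij}|\Big\{\big(w_{ij}D_i^{-1}g_i(q)+(1-w_{ij})D_j^{-1}g_j(q)\big)\cdot\mathbf n_{ij}-\big(w_{ij}|B_i|D_i^{-1}+(1-w_{ij})|B_j|D_j^{-1}\big)\tfrac{\Pi_hq_j-\Pi_hq_i}{d_{ij}}\Big\}w_i,$$ and $\widetilde{\mathcal C}_B((\mathbf v,q),(\mathbf w,w))=a_B(\mathbf v,\mathbf w)+\tilde b_B(\mathbf w,q)+\tilde c_B(\mathbf v,w)+\tilde s_B(q,w)$. **Norms.** Let $$|||(\mathbf v,q)|||_{box}^2=|\mathbf v|_{H^1(\Omega)}^2+\|\Pi_hq\|_{L^2(\Omega)}^2+\sum_{F_{ij}\in\mathcal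 F_h}h_{F_{ij}}^3d_{ij}\int_{F_{ij}}|\partial_{\mathbf n_{ij}}q|^2,$$ and let $|\nabla p|_{h,1}=\big(\sum_{\triangle}\int_\triangle|D^2p|^2\big)^{1/2}\in[0,\infty]$ be the broken $H^1$ seminorm of $\nabla p$. **Claim.** Let $\mathbf f\in[L^2(\Omega)]^d$ and let $\mathbf g$ be the trace on $\partial\Omega$ of a function in $[H^1(\Omega)]^d$. Let $(\mathbf u,p)\in[H^1(\Omega)]^d\times(L^2(\Omega)\cap H^2_{loc}(\Omega))$ be a weak solution of the Stokes problem $-\nu\Delta\mathbf u+\nabla p=\mathbf f$, $\nabla\cdot\mathbf u=0$ in $\Omega$, $\mathbf u=\mathbf g$ on $\partial\Omega$. Let $\mathbf g_h$ be any continuous piecewise affine boundary datum and let $(\mathbf u_B,p_B)\in[\mathcal V_h]^d\times\mathcal V_h$ be a solution of the Rhie-Chow stabilized box method: $\mathbf u_B=\mathbf g_h$ on $\partial\Omega$, $a_B(\mathbf u_B,\Pi_h\mathbf v_h)+\tilde b_B(\Pi_h\mathbf v_h,p_B)=(\mathbf f,\Pi_h\mathbf v_h)_\Omega$ and $\tilde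 c_B(\mathbf u_B,\Pi_hq_h)+\tilde s_B(p_B,\Pi_hq_h)=0$ for all $\mathbf v_h\in[\mathcal V_h]^d$, $q_h\in\mathcal V_h$. Then, for all $\mathbf v_h\in[\mathcal V_h]^d$ and $q_h\in\mathcal V_h$, $$\big|\mathcal C_B((\mathbf u,p),(\Pi_h\mathbf v_h,\Pi_hq_h))-\widetilde{\mathcal C}_B((\mathbf u_B,p_B),(\Pi_h\mathbf v_h,\Pi_hq_h))\big|\le C\Big(h^2\|\mathbf f\|_{L^2(\Omega)}+h\,|p_B|_{H^1(\Omega)}+h^{3/2}|\nabla p|_{h,1}\Big)\,|||(\mathbf v_h,q_h)|||_{box}.$$ -/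

import Mathlib

open MeasureTheory Set Filter Topology
open scoped ENNReal ContDiff

noncomputable section

namespace BoxMethod

/-- The Euclidean space `ℝ^d`. -/
abbrev E (d : ℕ) := EuclideanSpace ℝ (Fin d)

variable {d : ℕ}

/-! ### Sobolev spaces -/

/-- `G` is the weak gradient of `w` on the open set `Ω`. -/
def IsWeakGrad (Ω : Set (E d)) (w : E d → ℝ) (G : E d → E d) : Prop :=
  LocallyIntegrableOn w Ω ∧ LocallyIntegrableOn G Ω ∧
    ∀ φ : E d → ℝ, ContDiff ℝ ∞ φ → HasCompactSupport φ → tsupport φ ⊆ Ω → ∀ k : Fin d,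
      ∫ x in Ω, w x * fderiv ℝ φ x (EuclideanSpace.single k 1) = - ∫ x in Ω, G x k * φ x

open Classical in
/-- The weak gradient of `w` on `Ω` (unique almost everywhere), and `0` if there is none. -/
def weakGrad (Ω : Set (E d)) (w : E d → ℝ) : E d → E d :=
  if h : ∃ G, IsWeakGrad Ω w G then h.choose else 0

/-- `w ∈ L²(Ω)`, for scalar and vector functions. -/
def MemL2 {F : Type*} [NormedAddCommGroup F] (Ω : Set (E d)) (w : E d → F) : Prop :=
  MemLp w 2 (volume.restrict Ω)

/-- `w ∈ L²_loc(Ω)`. -/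
def MemL2loc {F : Type*} [NormedAddCommGroup F] (Ω : Set (E d)) (w : E d → F) : Prop :=
  ∀ K : Set (E d), IsCompact K → K ⊆ Ω → MemL2 K w

/-- `w ∈ H¹(Ω)`. -/
def MemH1 (Ω : Set (E d)) (w : E d → ℝ) : Prop :=
  MemL2 Ω w ∧ (∃ G, IsWeakGrad Ω w G) ∧ MemL2 Ω (weakGrad Ω w)

/-- `w ∈ H¹_loc(Ω)`. -/
def MemH1loc (Ω : Set (E d)) (w : E d → ℝ) : Prop :=
  MemL2loc Ω w ∧ (∃ G, IsWeakGrad Ω w G) ∧ MemL2loc Ω (weakGrad Ω w)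

/-- `w ∈ H²_loc(Ω)`. -/
def MemH2loc (Ω : Set (E d)) (w : E d → ℝ) : Prop :=
  MemH1loc Ω w ∧ ∀ k : Fin d, MemH1loc Ω (fun x => weakGrad Ω w x k)

/-- `w ∈ H¹_0(Ω)`, the closure of `C_c^∞(Ω)` in `H¹(Ω)`. -/
def MemH10 (Ω : Set (E d)) (w : E d → ℝ) : Prop :=
  MemH1 Ω w ∧ ∃ φ : ℕ → E d → ℝ,
    (∀ n, ContDiff ℝ ∞ (φ n) ∧ HasCompactSupport (φ n) ∧ tsupport (φ n) ⊆ Ω) ∧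
    Tendsto (fun n => eLpNorm (fun x => φ n x - w x) 2 (volume.restrict Ω)) atTop (𝓝 0) ∧
    Tendsto (fun n => eLpNorm (fun x => gradient (φ n) x - weakGrad Ω w x) 2
      (volume.restrict Ω)) atTop (𝓝 0)

/-- `‖w‖_{L²(Ω)}`, for scalar and vector functions. -/
def l2Norm {F : Type*} [NormedAddCommGroup F] (Ω : Set (E d)) (w : E d → F) : ℝ :=
  Real.sqrt (∫ x in Ω, ‖w x‖ ^ 2)

/-- `|q|_{H¹(Ω)}` for a scalar function. -/
def h1Semi (Ω : Set (E d)) (q : E d → ℝ) : ℝ := l2Norm Ω (weakGrad Ω q)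

/-- The `k`-th component of a vector field. -/
def comp (u : E d → E d) (k : Fin d) : E d → ℝ := fun x => u x k

/-- `|v|_{H¹(Ω)}` for a vector field. -/
def h1SemiV (Ω : Set (E d)) (v : E d → E d) : ℝ :=
  Real.sqrt (∑ k, h1Semi Ω (comp v k) ^ 2)

/-- The surface measure (the `(d-1)`-dimensional Hausdorff measure, normalized so that it is
area on surfaces and length on curves). -/
def surf (d : ℕ) : Measure (E d) := Measure.euclideanHausdorffMeasure (d - 1)

/-- `g` is the trace on the hypersurface `F` of the function `w`, defined near `F`: the mean
values of `w` over small balls centred on `F` converge to `g` in `L²(F)`.  For functions of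
class `H¹` near `F` this is the usual trace; for a function that is continuous on each of two
sides of `F` it is the arithmetic mean of the two one-sided traces. -/
def IsFaceTrace (F : Set (E d)) (w g : E d → ℝ) : Prop :=
  MemLp g 2 ((surf d).restrict F) ∧
    Tendsto (fun r : ℝ => eLpNorm (fun x => (⨍ y in Metric.ball x r, w y) - g x) 2
      ((surf d).restrict F)) (𝓝[>] 0) (𝓝 0)

open Classical in
/-- The trace of `w` on `F` (unique almost everywhere on `F`), and `0` if there is none. -/
def faceTrace (F : Set (E d)) (w : E d → ℝ) : E d → ℝ :=
  if h : ∃ g, IsFaceTrace F w g then h.choose else 0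

/-! ### The Stokes problem -/

/-- A polyhedral bounded domain is a bounded domain that is the interior of its closure and
whose closure carries a triangulation (see `Triangulation`); this is the first part. -/
structure IsRegularDomain (Ω : Set (E d)) : Prop where
  isOpen : IsOpen Ω
  isConnected : IsConnected Ω
  isBounded : Bornology.IsBounded Ω
  interior_closure : interior (closure Ω) = Ω

/-- `a(u,v) = ∫_Ω ν ∇u : ∇v`. -/
def aForm (ν : ℝ) (Ω : Set (E d)) (u v : E d → E d) : ℝ :=
  ∫ x in Ω, ν * ∑ k, inner ℝ (weakGrad Ω (comp u k) x) (weakGrad Ω (comp v k) x)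

/-- `b(v,p) = - ∫_Ω (div v) p`. -/
def bForm (Ω : Set (E d)) (v : E d → E d) (p : E d → ℝ) : ℝ :=
  - ∫ x in Ω, (∑ k, weakGrad Ω (comp v k) x k) * p x

/-- `(f,w)_Ω`. -/
def l2Inner (Ω : Set (E d)) (f w : E d → E d) : ℝ := ∫ x in Ω, inner ℝ (f x) (w x)

/-- `(u,p) ∈ [H¹(Ω)]^d × L²(Ω)` is a weak solution of the Stokes problem with viscosity `ν`,
force `f` and Dirichlet datum the trace on `∂Ω` of `g ∈ [H¹(Ω)]^d`. -/
structure IsStokesSolution (ν : ℝ) (Ω : Set (E d)) (f g u : E d → E d) (p : E d → ℝ) : Prop where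
  memH1 : ∀ k, MemH1 Ω (comp u k)
  memL2 : MemL2 Ω p
  boundary : ∀ k, MemH10 Ω (fun x => u x k - g x k)
  momentum : ∀ v : E d → E d, (∀ k, MemH10 Ω (comp v k)) →
    aForm ν Ω u v + bForm Ω v p = l2Inner Ω f v
  incompressible : ∀ q : E d → ℝ, MemL2 Ω q → bForm Ω u q = 0

/-! ### Meshes -/

/-- A conforming triangulation of the closure of `Ω`: a finite simplicial complex in which every
simplex is a face of a `d`-dimensional one. -/
structure Triangulation (Ω : Set (E d)) where
  complex : Geometry.SimplicialComplex ℝ (E d)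
  finite : complex.faces.Finite
  pure : ∀ s ∈ complex.faces, ∃ t ∈ complex.faces, s ⊆ t ∧ t.card = d + 1
  space_eq : complex.space = closure Ω

namespace Triangulation

variable {Ω : Set (E d)} (T : Triangulation Ω)

open Classical in
/-- The elements: the vertex sets of the `d`-simplices. -/
def elems : Finset (Finset (E d)) := T.finite.toFinset.filter (fun s => s.card = d + 1)

open Classical in
/-- The set of all vertices. -/
def verts : Finset (E d) := T.finite.toFinset.biUnion id

open Classical in
/-- The set of interior vertices. -/
def intVerts : Finset (E d) := T.verts.filter (fun i => i ∈ Ω)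

/-- The closed simplex with vertex set `s`. -/
def cellOf (s : Finset (E d)) : Set (E d) := convexHull ℝ (s : Set (E d))

/-- `h_△`. -/
def hElem (s : Finset (E d)) : ℝ := Metric.diam (cellOf s)

/-- `h = max h_△`. -/
def h : ℝ := sSup (hElem '' (T.elems : Set (Finset (E d))))

/-- The (closed) Voronoi cell of the vertex `i`.  For an interior vertex of a Delaunay
triangulation this is the box `B_i`, the polytope whose vertices are the circumcentres of the
elements that contain `i`. -/
def box (i : E d) : Set (E d) := {x | ∀ j ∈ T.verts, dist x i ≤ dist x j}

/-- `F_ij = B_i ∩ B_j`. -/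
def face (i j : E d) : Set (E d) := T.box i ∩ T.box j

open Classical in
/-- The vertices `j ≠ i`.  The boundary of `B_i` is the union of the sets `F_ij` over these. -/
def others (i : E d) : Finset (E d) := T.verts.erase i

open Classical in
/-- `G_i`: the interior vertices `j ≠ i` whose box has a face in common with `B_i`. -/
def nbrs (i : E d) : Finset (E d) :=
  T.intVerts.filter (fun j => j ≠ i ∧ surf d (T.face i j) ≠ 0)

/-- `n_ij`, the unit normal of `F_ij` directed outwards of `B_i`. -/
def normal (i j : E d) : E d := (dist i j)⁻¹ • (j - i)

/-- `|F_ij|`. -/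
def faceArea (i j : E d) : ℝ := (surf d).real (T.face i j)

/-- `|B_i|`. -/
def boxVol (i : E d) : ℝ := volume.real (T.box i)

/-- `w_ij`: the distance of the centre `j` of `B_j` from (the hyperplane of) `F_ij`, divided by
`d_ij`. -/
def weight (i j : E d) : ℝ :=
  Metric.infDist j (affineSpan ℝ (T.face i j) : Set (E d)) / dist i j

/-- The local mesh size at `F_ij`: the least diameter of an element that meets `F_ij`. -/
def hFace (i j : E d) : ℝ :=
  sInf (hElem '' {s | s ∈ T.elems ∧ (cellOf s ∩ T.face i j).Nonempty})

/-- The sum over the set of faces `F_ij` between two boxes of a quantity that is symmetric in `i`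
and `j`: each face occurs twice in the double sum. -/
def sumFaces (φ : E d → E d → ℝ) : ℝ := (1 / 2) * ∑ i ∈ T.intVerts, ∑ j ∈ T.nbrs i, φ i j

/-- The Delaunay property: no vertex lies inside the circumsphere of an element. -/
def IsDelaunay : Prop :=
  ∀ s ∈ T.elems, ∃ (c : E d) (r : ℝ), (∀ x ∈ s, dist x c = r) ∧ ∀ y ∈ T.verts, r ≤ dist y c

/-- The mesh assumptions, with constants `γ`, `δ`, `κ`: the triangulation is Delaunay, shape
regular and quasi-uniform, the boxes lie in `Ω`, and `d_ij`, `|F_ij|`, `|B_i|` are comparable to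
`h_△`, `h_△^(d-1)`, `h_△^d` for some element `△` that meets `B_i`. -/
structure IsRegular (γ δ κ : ℝ) : Prop where
  delaunay : T.IsDelaunay
  shape : ∀ s ∈ T.elems, ∃ c, Metric.closedBall c (γ * hElem s) ⊆ cellOf s
  quasiUniform : ∀ s ∈ T.elems, δ * T.h ≤ hElem s
  box_subset : ∀ i ∈ T.intVerts, T.box i ⊆ Ω
  box_size : ∀ i ∈ T.intVerts, ∃ s ∈ T.elems, (cellOf s ∩ T.box i).Nonempty ∧
    κ⁻¹ * hElem s ^ d ≤ T.boxVol i ∧ T.boxVol i ≤ κ * hElem s ^ d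
  face_size : ∀ i ∈ T.intVerts, ∀ j ∈ T.nbrs i, ∃ s ∈ T.elems,
    (cellOf s ∩ T.box i).Nonempty ∧
    κ⁻¹ * hElem s ≤ dist i j ∧ dist i j ≤ κ * hElem s ∧
    κ⁻¹ * hElem s ^ (d - 1) ≤ T.faceArea i j ∧ T.faceArea i j ≤ κ * hElem s ^ (d - 1)

/-! ### Discrete spaces, lumping and norms -/

/-- `v ∈ V_h`: continuous on the closure of `Ω` and affine on every element. -/
def MemVh (v : E d → ℝ) : Prop :=
  ContinuousOn v (closure Ω) ∧ ∀ s ∈ T.elems, ∃ A : E d →ᵃ[ℝ] ℝ, EqOn v A (cellOf s)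

/-- `v ∈ [V_h]^d`. -/
def MemVhV (v : E d → E d) : Prop := ∀ k, T.MemVh (comp v k)

open Classical in
/-- The lumping map `Π_h`.  The value on `B_i` of a function `w` which is constant on every box,
such as `Π_h v`, is `w i`. -/
def lump {F : Type*} [AddCommMonoid F] (v : E d → F) : E d → F :=
  fun x => ∑ i ∈ T.intVerts, (T.box i).indicator (fun _ => v i) x

/-- `∂q/∂n_ij` on the face `F_ij`: the trace of the normal component of the weak gradient. -/
def normalDeriv (q : E d → ℝ) (i j : E d) : E d → ℝ :=
  faceTrace (T.face i j) (fun x => inner ℝ (weakGrad Ω q x) (normal i j))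

/-- `|q|_{△,*}`. -/
def starSemi (q : E d → ℝ) : ℝ :=
  Real.sqrt (T.sumFaces fun i j =>
    T.hFace i j ^ 3 * dist i j * ∫ x in T.face i j, |T.normalDeriv q i j x| ^ 2 ∂(surf d))

/-- The mesh dependent norm of `(v,q)`. -/
def boxNorm (v : E d → E d) (q : E d → ℝ) : ℝ :=
  Real.sqrt (h1SemiV Ω v ^ 2 + l2Norm Ω (T.lump q) ^ 2 + T.starSemi q ^ 2)

/-- The broken `H¹` seminorm of `∇q` on the elements, possibly infinite. -/
def brokenSemiGrad (q : E d → ℝ) : ℝ≥0∞ :=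
  (∑ s ∈ T.elems, ∑ k : Fin d, ∫⁻ x in cellOf s,
    ‖weakGrad Ω (fun y => weakGrad Ω q y k) x‖ₑ ^ 2) ^ (1 / 2 : ℝ)

/-! ### The bilinear forms of the auxiliary box method

An argument `w` from `W_h` is a function that is constant on boxes, with value `w i` on `B_i`. -/

/-- `a_B(v,w) = - ∑_i ∫_{∂B_i} ν ∂v/∂n_i · w`. -/
def aB (ν : ℝ) (v w : E d → E d) : ℝ :=
  - ∑ i ∈ T.intVerts, ∑ j ∈ T.others i,
    ∫ x in T.face i j, ν * ∑ k, T.normalDeriv (comp v k) i j x * w i k ∂(surf d)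

/-- `b_B(w,q) = ∑_i ∫_{∂B_i} q n_i · w`. -/
def bB (w : E d → E d) (q : E d → ℝ) : ℝ :=
  ∑ i ∈ T.intVerts, ∑ j ∈ T.others i,
    ∫ x in T.face i j, faceTrace (T.face i j) q x * inner ℝ (normal i j) (w i) ∂(surf d)

/-- `c_B(v,w) = ∑_i ∫_{∂B_i} n_i · v w`. -/
def cB (v : E d → E d) (w : E d → ℝ) : ℝ :=
  ∑ i ∈ T.intVerts, ∑ j ∈ T.others i,
    ∫ x in T.face i j,
      (∑ k, normal i j k * faceTrace (T.face i j) (comp v k) x) * w i ∂(surf d)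

/-- The diagonal coefficient `D_i` of the matrix of `ã_B`. -/
def diag (ν : ℝ) (i : E d) : ℝ := ∑ j ∈ T.nbrs i, ν * (T.faceArea i j / dist i j)

/-- The jump `w|_{B_i} - w|_{B_j}`. -/
def jump (w : E d → ℝ) (i j : E d) : ℝ := w i - w j

/-- The first part of the auxiliary Rhie-Chow form. -/
def sB1 (ν : ℝ) (q w : E d → ℝ) : ℝ :=
  T.sumFaces fun i j => ∫ _x in T.face i j,
    inner ℝ ((T.weight i j * (T.diag ν i)⁻¹) • (∫ y in T.box i, weakGrad Ω q y)
      + ((1 - T.weight i j) * (T.diag ν j)⁻¹) • (∫ y in T.box j, weakGrad Ω q y)) (normal i j)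
      * jump w i j ∂(surf d)

/-- The second part of the auxiliary Rhie-Chow form. -/
def sB2 (ν : ℝ) (q w : E d → ℝ) : ℝ :=
  T.sumFaces fun i j => ∫ x in T.face i j,
    (T.weight i j * T.boxVol i * (T.diag ν i)⁻¹
      + (1 - T.weight i j) * T.boxVol j * (T.diag ν j)⁻¹)
      * T.normalDeriv q i j x * jump w i j ∂(surf d)

/-- The auxiliary Rhie-Chow stabilization `s_B`. -/
def sB (ν : ℝ) (q w : E d → ℝ) : ℝ := T.sB1 ν q w - T.sB2 ν q w

/-- The compact form `C_B((u,p),(v,q))` of the auxiliary box method. -/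
def CB (ν : ℝ) (u : E d → E d) (p : E d → ℝ) (v : E d → E d) (q : E d → ℝ) : ℝ :=
  T.aB ν u v + T.bB v p + T.cB u q + T.sB ν p q

/-! ### The discrete forms and the Rhie-Chow stabilized box method -/

/-- `b̃_B`. -/
def bBt (w : E d → E d) (q : E d → ℝ) : ℝ :=
  ∑ i ∈ T.intVerts, ∑ j ∈ T.nbrs i, T.faceArea i j *
    (T.weight i j * T.lump q i + (1 - T.weight i j) * T.lump q j) * inner ℝ (normal i j) (w i)

/-- `c̃_B`. -/
def cBt (v : E d → E d) (w : E d → ℝ) : ℝ :=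
  ∑ i ∈ T.intVerts, ∑ j ∈ T.nbrs i, T.faceArea i j *
    inner ℝ (T.weight i j • T.lump v i + (1 - T.weight i j) • T.lump v j) (normal i j) * w i

/-- `|B_i| ∇_{h,i} q`, the Gauss-Green gradient of `q` on `B_i` times `|B_i|`. -/
def gaussGreen (q : E d → ℝ) (i : E d) : E d :=
  ∑ j ∈ T.nbrs i, (T.faceArea i j *
    (T.weight i j * T.lump q i + (1 - T.weight i j) * T.lump q j)) • normal i j

/-- The Rhie-Chow stabilization `s̃_B`. -/
def sBt (ν : ℝ) (q w : E d → ℝ) : ℝ :=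
  (∑ i ∈ T.intVerts, ∑ j ∈ T.nbrs i, T.faceArea i j *
    inner ℝ ((T.weight i j * (T.diag ν i)⁻¹) • T.gaussGreen q i
      + ((1 - T.weight i j) * (T.diag ν j)⁻¹) • T.gaussGreen q j) (normal i j) * w i)
  - ∑ i ∈ T.intVerts, ∑ j ∈ T.nbrs i, T.faceArea i j *
    (T.weight i j * T.boxVol i * (T.diag ν i)⁻¹
      + (1 - T.weight i j) * T.boxVol j * (T.diag ν j)⁻¹)
      * ((T.lump q j - T.lump q i) / dist i j) * w i

/-- The compact form `C̃_B((u,p),(v,q))` of the box method. -/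
def CBt (ν : ℝ) (u : E d → E d) (p : E d → ℝ) (v : E d → E d) (q : E d → ℝ) : ℝ :=
  T.aB ν u v + T.bBt v p + T.cBt u q + T.sBt ν p q

/-- `(u_B,p_B) ∈ [V_h]^d × V_h` is a solution of the Rhie-Chow stabilized box method with
boundary values `g_h`. -/
structure IsBoxSolution (ν : ℝ) (f gh uB : E d → E d) (pB : E d → ℝ) : Prop where
  memVhV : T.MemVhV uB
  memVh : T.MemVh pB
  boundary : EqOn uB gh (frontier Ω)
  momentum : ∀ v : E d → E d, T.MemVhV v →
    T.aB ν uB (T.lump v) + T.bBt (T.lump v) pB = l2Inner Ω f (T.lump v)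
  mass : ∀ q : E d → ℝ, T.MemVh q →
    T.cBt uB (T.lump q) + T.sBt ν pB (T.lump q) = 0

end Triangulation

end BoxMethod

end

open BoxMethod

noncomputable section

namespace BoxMethod

variable {d : ℕ}

/-! ### Orthogonal coordinates along a unit vector -/

/-- Orthogonal coordinates with origin `p` and axis `n`. -/
def slabMap (p n : E d) (q : ℝ × (Submodule.span ℝ {n})ᗮ) : E d := p + (q.1 • n + (q.2 : E d))

lemma continuous_slabMap (p n : E d) : Continuous (slabMap p n) := by
  unfold slabMap; fun_prop

lemma inner_slabMap_sub (p : E d) {n : E d} (hn : ‖n‖ = 1) (q : ℝ × (Submodule.span ℝ {n})ᗮ) :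
    inner ℝ (slabMap p n q - p) n = q.1 := by
  have h : inner ℝ (q.2 : E d) n = 0 :=
    Submodule.inner_left_of_mem_orthogonal (Submodule.mem_span_singleton_self n) q.2.2
  simp [slabMap, inner_add_left, inner_smul_left, h, hn]

lemma norm_slabMap_sub_sq (p : E d) {n : E d} (hn : ‖n‖ = 1)
    (q : ℝ × (Submodule.span ℝ {n})ᗮ) : ‖slabMap p n q - p‖ ^ 2 = q.1 ^ 2 + ‖q.2‖ ^ 2 := by
  have h : inner ℝ (q.1 • n) (q.2 : E d) = 0 := by
    rw [inner_smul_left, Submodule.inner_right_of_mem_orthogonal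
      (Submodule.mem_span_singleton_self n) q.2.2, mul_zero]
  have := norm_add_sq_eq_norm_sq_add_norm_sq_of_inner_eq_zero _ _ h
  rw [show slabMap p n q - p = q.1 • n + (q.2 : E d) by simp [slabMap], pow_two, this]
  simp [norm_smul, hn, pow_two]

lemma measurePreserving_slabMap (p : E d) {n : E d} (hn : ‖n‖ = 1) :
    MeasurePreserving (slabMap p n) (volume.prod volume) volume := by
  have h1 := (LinearIsometryEquiv.toSpanUnitSingleton (𝕜 := ℝ) n hn).measurePreserving.prod
    (MeasurePreserving.id (volume : Measure (Submodule.span ℝ {n})ᗮ))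
  have h2 := ((Submodule.span ℝ {n}).measurePreserving_measurableEquivProd p).symm
  rw [InnerProductSpace.euclideanHausdorffMeasure_eq_volume] at h2
  have h3 := h2.comp h1
  convert! h3 using 1
  funext q
  simp [slabMap, add_comm]

lemma finrank_orthogonal_span_unit {n : E d} (hn : ‖n‖ = 1) :
    Module.finrank ℝ (Submodule.span ℝ {n})ᗮ = d - 1 := by
  have h := (Submodule.span ℝ {n}).finrank_add_finrank_orthogonal
  rw [finrank_span_singleton (by rintro rfl; simp at hn), finrank_euclideanSpace_fin] at h
  omega

lemma isometry_slabMap (p n : E d) (c : ℝ) :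
    Isometry fun z : (Submodule.span ℝ {n})ᗮ => slabMap p n (c, z) := by
  refine Isometry.of_dist_eq fun z w => ?_
  simp [slabMap, dist_eq_norm]

lemma range_slabMap (p : E d) {n : E d} (hn : ‖n‖ = 1) (c : ℝ) :
    range (fun z : (Submodule.span ℝ {n})ᗮ => slabMap p n (c, z))
      = {x | inner ℝ (x - p) n = c} := by
  ext x
  constructor
  · rintro ⟨z, rfl⟩
    exact inner_slabMap_sub p hn (c, z)
  · intro hx
    refine ⟨⟨x - p - c • n, ?_⟩, by simp [slabMap]⟩
    rw [Submodule.mem_orthogonal_singleton_iff_inner_left, inner_sub_left, inner_smul_left]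
    simp [show inner ℝ (x - p) n = c from hx, hn]

lemma map_slabMap_surf (p : E d) {n : E d} (hn : ‖n‖ = 1) (c : ℝ) :
    (volume : Measure (Submodule.span ℝ {n})ᗮ).map (fun z => slabMap p n (c, z))
      = (surf d).restrict {x | inner ℝ (x - p) n = c} := by
  rw [← InnerProductSpace.euclideanHausdorffMeasure_eq_volume, finrank_orthogonal_span_unit hn,
    (isometry_slabMap p n c).map_euclideanHausdorffMeasure, range_slabMap p hn, surf]

lemma measurableEmbedding_slabMap (p n : E d) (c : ℝ) :
    MeasurableEmbedding fun z : (Submodule.span ℝ {n})ᗮ => slabMap p n (c, z) :=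
  (isometry_slabMap p n c).isClosedEmbedding.measurableEmbedding

lemma setIntegral_surf_eq (p : E d) {n : E d} (hn : ‖n‖ = 1) (c : ℝ) {F : Set (E d)}
    (hF : MeasurableSet F) (hFH : F ⊆ {x | inner ℝ (x - p) n = c}) (φ : E d → ℝ) :
    ∫ x in F, φ x ∂(surf d)
      = ∫ z : (Submodule.span ℝ {n})ᗮ, F.indicator φ (slabMap p n (c, z)) := by
  rw [← (measurableEmbedding_slabMap p n c).integral_map, map_slabMap_surf p hn c,
    integral_indicator hF, Measure.restrict_restrict hF, inter_eq_left.2 hFH]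

/-- The surface measure of a part of a hyperplane in orthogonal coordinates. -/
lemma surf_apply_eq (p : E d) {n : E d} (hn : ‖n‖ = 1) (c : ℝ) {F : Set (E d)}
    (hFH : F ⊆ {x | inner ℝ (x - p) n = c}) :
    surf d F = (volume : Measure (Submodule.span ℝ {n})ᗮ) {z | slabMap p n (c, z) ∈ F} := by
  have h := (measurableEmbedding_slabMap p n c).map_apply volume F
  rw [map_slabMap_surf p hn c] at h
  rw [Measure.restrict_apply', inter_eq_left.2 hFH] at h
  · exact h
  exact (isClosed_eq (by fun_prop) continuous_const).measurableSet

lemma surf_lt_top_of_isBounded (p : E d) {n : E d} (hn : ‖n‖ = 1) (c : ℝ) {F : Set (E d)}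
    (hFH : F ⊆ {x | inner ℝ (x - p) n = c}) (hb : Bornology.IsBounded F) : surf d F < ⊤ := by
  rw [surf_apply_eq p hn c hFH]
  obtain ⟨R, hR⟩ := hb.subset_closedBall p
  refine (measure_mono (t := Metric.closedBall 0 R) fun z hz => ?_).trans_lt
    measure_closedBall_lt_top
  have h1 : ‖slabMap p n (c, z) - p‖ ≤ R := by simpa [dist_eq_norm] using hR hz
  have h2 := norm_slabMap_sub_sq p hn (c, z)
  have h3 : 0 ≤ R := (norm_nonneg _).trans h1
  rw [mem_closedBall_zero_iff]
  refine abs_le_of_sq_le_sq' ?_ h3 |>.2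
  have : ‖slabMap p n (c, z) - p‖ ^ 2 ≤ R ^ 2 := by gcongr
  simp only at h2
  nlinarith [sq_nonneg c]

lemma volume_hyperplane {n : E d} (hn : n ≠ 0) (p : E d) (c : ℝ) :
    volume {x : E d | inner ℝ (x - p) n = c} = 0 := by
  have h1 : ‖(‖n‖⁻¹ • n)‖ = 1 := by
    rw [norm_smul, norm_inv, norm_norm, inv_mul_cancel₀ (norm_ne_zero_iff.2 hn)]
  have h := measurePreserving_slabMap p h1
  have hm : MeasurableSet {x : E d | inner ℝ (x - p) n = c} :=
    (isClosed_eq (by fun_prop) continuous_const).measurableSet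
  rw [← h.measure_preimage hm.nullMeasurableSet]
  have : slabMap p (‖n‖⁻¹ • n) ⁻¹' {x : E d | inner ℝ (x - p) n = c}
      = {c / ‖n‖} ×ˢ univ := by
    ext q
    have h2 := inner_slabMap_sub p h1 q
    rw [inner_smul_right] at h2
    have h3 : ‖n‖ ≠ 0 := norm_ne_zero_iff.2 hn
    simp only [mem_preimage, mem_ofPred_eq, mem_prod, mem_singleton_iff, mem_univ, and_true]
    rw [← h2]
    constructor
    · intro h; rw [h]; field_simp
    · intro h; field_simp at h; linarith
  rw [this, Measure.prod_prod]
  simp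

lemma volume_affine_hyperplane_sub {V : Type*} [NormedAddCommGroup V] [InnerProductSpace ℝ V]
    [FiniteDimensional ℝ V] [MeasurableSpace V] [BorelSpace V] (f : V →ₗ[ℝ] ℝ) (hf : f ≠ 0)
    (c : ℝ) : volume {z : V | f z = c} = 0 := by
  obtain ⟨w, hw⟩ : ∃ w, f w ≠ 0 := by
    by_contra! h
    exact hf (LinearMap.ext h)
  have hc : f ((c / f w) • w) = c := by simp [hw]
  let A : AffineSubspace ℝ V := AffineSubspace.mk' ((c / f w) • w) (LinearMap.ker f)
  have hA : (A : Set V) = {z : V | f z = c} := by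
    ext z
    simp [A, AffineSubspace.mem_mk', hw, sub_eq_zero]
  rw [← hA]
  refine Measure.addHaar_affineSubspace _ _ fun h => ?_
  have : (0 : V) ∈ (A : Set V) ∧ w ∈ (A : Set V) := by rw [h]; simp
  rw [hA] at this
  simp only [mem_ofPred_eq, map_zero] at this
  exact hw (this.2.trans this.1.symm)

/-! ### The Gauss formula on a polytope -/

lemma deriv_smoothTransition_eq_zero {t : ℝ} (ht : t ∉ Icc (0 : ℝ) 1) :
    deriv Real.smoothTransition t = 0 := by
  rw [mem_Icc, not_and_or, not_le, not_le] at ht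
  rcases ht with ht | ht
  · have : Real.smoothTransition =ᶠ[𝓝 t] fun _ => 0 := by
      filter_upwards [Iio_mem_nhds ht] with s hs
      exact Real.smoothTransition.zero_of_nonpos (le_of_lt hs)
    rw [this.deriv_eq, deriv_const]
  · have : Real.smoothTransition =ᶠ[𝓝 t] fun _ => 1 := by
      filter_upwards [Ioi_mem_nhds ht] with s hs
      exact Real.smoothTransition.one_of_one_le (le_of_lt hs)
    rw [this.deriv_eq, deriv_const]

lemma differentiable_smoothTransition : Differentiable ℝ Real.smoothTransition :=
  (Real.smoothTransition.contDiff (n := 1)).differentiable (by simp)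

lemma continuous_deriv_smoothTransition : Continuous (deriv Real.smoothTransition) :=
  (Real.smoothTransition.contDiff (n := 1)).continuous_deriv le_rfl

lemma hasCompactSupport_deriv_smoothTransition :
    HasCompactSupport (deriv Real.smoothTransition) :=
  HasCompactSupport.intro isCompact_Icc fun _ hx => deriv_smoothTransition_eq_zero hx

lemma integral_deriv_smoothTransition : ∫ t, deriv Real.smoothTransition t = 1 := by
  have h := integral_of_hasDerivAt_of_tendsto (f := Real.smoothTransition)
    (f' := deriv Real.smoothTransition) (m := 0) (n := 1)
    (fun x => (differentiable_smoothTransition x).hasDerivAt)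
    (continuous_deriv_smoothTransition.integrable_of_hasCompactSupport
      hasCompactSupport_deriv_smoothTransition) ?_ ?_
  · simpa using h
  · refine tendsto_const_nhds.congr' ?_
    filter_upwards [eventually_le_atBot 0] with s hs
    exact (Real.smoothTransition.zero_of_nonpos hs).symm
  · refine tendsto_const_nhds.congr' ?_
    filter_upwards [eventually_ge_atTop 1] with s hs
    exact (Real.smoothTransition.one_of_one_le hs).symm

lemma tendsto_smoothTransition_div {l : ℝ → ℝ} {a : ℝ} (hl : Tendsto l (𝓝[>] 0) (𝓝 a))
    (ha : a ≠ 0) : Tendsto (fun ε => Real.smoothTransition (l ε / ε)) (𝓝[>] 0)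
      (𝓝 (if 0 < a then 1 else 0)) := by
  refine tendsto_const_nhds.congr' ?_
  split_ifs with h
  · have h1 : Tendsto (fun ε => l ε / ε) (𝓝[>] 0) atTop := by
      simpa [div_eq_mul_inv] using hl.pos_mul_atTop h tendsto_inv_nhdsGT_zero
    filter_upwards [h1.eventually_ge_atTop 1] with ε hε
    exact (Real.smoothTransition.one_of_one_le hε).symm
  · have h1 : a < 0 := lt_of_le_of_ne (not_lt.1 h) ha
    filter_upwards [hl.eventually_lt_const h1, self_mem_nhdsWithin] with ε hε hε'
    exact (Real.smoothTransition.zero_of_nonpos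
      (div_nonpos_of_nonpos_of_nonneg hε.le (le_of_lt hε'))).symm

section Gauss

set_option linter.unusedSectionVars false

variable {ι : Type*} [DecidableEq ι] (S : Finset ι) (p : E d) (n : ι → E d) (c : ι → ℝ)

/-- The intersection of the half spaces `⟪x - p, n m⟫ ≤ c m`. -/
def polytope : Set (E d) := {x | ∀ m ∈ S, inner ℝ (x - p) (n m) ≤ c m}

/-- The face of a polytope with normal `n j`. -/
def polyFace (j : ι) : Set (E d) := polytope S p n c ∩ {x | inner ℝ (x - p) (n j) = c j}

lemma isClosed_polytope : IsClosed (polytope S p n c) := by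
  have : polytope S p n c = ⋂ m ∈ S, {x | inner ℝ (x - p) (n m) ≤ c m} := by
    ext x; simp [polytope]
  rw [this]
  exact isClosed_biInter fun m _ => isClosed_le (by fun_prop) continuous_const

lemma isClosed_polyFace (j : ι) : IsClosed (polyFace S p n c j) :=
  (isClosed_polytope S p n c).inter (isClosed_eq (by fun_prop) continuous_const)

/-- A smooth approximation of the characteristic function of a polytope. -/
def polyCut (ε : ℝ) (x : E d) : ℝ :=
  ∏ m ∈ S, Real.smoothTransition ((c m - inner ℝ (x - p) (n m)) / ε)

lemma continuous_polyCut (ε : ℝ) : Continuous (polyCut S p n c ε) := by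
  unfold polyCut
  refine continuous_finsetProd _ fun m _ => Real.smoothTransition.continuous.comp ?_
  fun_prop

lemma abs_polyCut_le (ε : ℝ) (x : E d) : |polyCut S p n c ε x| ≤ 1 := by
  unfold polyCut
  rw [Finset.abs_prod]
  exact Finset.prod_le_one (fun _ _ => abs_nonneg _) fun m _ => by
    rw [abs_of_nonneg (Real.smoothTransition.nonneg _)]
    exact Real.smoothTransition.le_one _

lemma hasFDerivAt_polyCut (ε : ℝ) (x v : E d) :
    ∃ f' : E d →L[ℝ] ℝ, HasFDerivAt (polyCut S p n c ε) f' x ∧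
      f' v = - ∑ j ∈ S, inner ℝ (n j) v * (polyCut (S.erase j) p n c ε x *
        (deriv Real.smoothTransition ((c j - inner ℝ (x - p) (n j)) / ε) / ε)) := by
  have h1 : ∀ m ∈ S, HasFDerivAt
      (fun x => Real.smoothTransition ((c m - inner ℝ (x - p) (n m)) / ε))
      (deriv Real.smoothTransition ((c m - inner ℝ (x - p) (n m)) / ε) •
        (-ε⁻¹ • innerSL ℝ (n m))) x := by
    intro m _
    have h2 : HasFDerivAt (fun x => (c m - inner ℝ (x - p) (n m)) / ε)
        (-ε⁻¹ • innerSL ℝ (n m)) x := by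
      have h3 : HasFDerivAt (fun x => inner ℝ (n m) (x - p)) (innerSL ℝ (n m)) x :=
        ((innerSL ℝ (n m)).hasFDerivAt (x := x - p)).comp x
          ((hasFDerivAt_id x).sub_const p) |>.congr_fderiv (by ext; simp)
      have h4 := (h3.const_sub (c m)).mul_const ε⁻¹
      refine (h4.congr_fderiv ?_).congr_of_eventuallyEq ?_
      · ext w; simp
      · filter_upwards with y
        rw [real_inner_comm]; rfl
    exact (differentiable_smoothTransition _).hasDerivAt.comp_hasFDerivAt x h2
  refine ⟨_, HasFDerivAt.finsetProd h1, ?_⟩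
  simp only [sum_apply, smul_apply, smul_eq_mul,
    innerSL_apply_apply, ← Finset.sum_neg_distrib]
  refine Finset.sum_congr rfl fun j _ => ?_
  unfold polyCut
  ring

lemma tendsto_polyCut {x : ℝ → E d} {y : E d} (hx : Tendsto x (𝓝[>] 0) (𝓝 y))
    (hy : ∀ m ∈ S, inner ℝ (y - p) (n m) ≠ c m) :
    Tendsto (fun ε => polyCut S p n c ε (x ε)) (𝓝[>] 0)
      (𝓝 ((polytope S p n c).indicator 1 y)) := by
  have h1 : Tendsto (fun ε => polyCut S p n c ε (x ε)) (𝓝[>] 0)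
      (𝓝 (∏ m ∈ S, if 0 < c m - inner ℝ (y - p) (n m) then 1 else 0)) := by
    refine tendsto_finsetProd _ fun m hm => tendsto_smoothTransition_div ?_ ?_
    · exact tendsto_const_nhds.sub ((hx.sub tendsto_const_nhds).inner tendsto_const_nhds)
    · intro h
      exact hy m hm (by linarith)
  convert! h1 using 2
  by_cases hyp : y ∈ polytope S p n c
  · rw [indicator_of_mem hyp, Finset.prod_eq_one]
    · rfl
    · intro m hm
      rw [if_pos]
      exact sub_pos.2 (lt_of_le_of_ne (hyp m hm) (hy m hm))
  · rw [indicator_of_notMem hyp]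
    obtain ⟨m, hm, h⟩ : ∃ m ∈ S, c m < inner ℝ (y - p) (n m) := by
      simpa [polytope] using hyp
    rw [Finset.prod_eq_zero hm]
    rw [if_neg (by linarith)]

variable {S p n c}

lemma volume_slab_slice (hn : ∀ j ∈ S, ‖n j‖ = 1) (hc : ∀ j ∈ S, 0 < c j)
    (hinj : ∀ j ∈ S, ∀ m ∈ S, n j = n m → c j = c m → j = m) {j m : ι} (hj : j ∈ S)
    (hm : m ∈ S) (hjm : j ≠ m) :
    volume {z : (Submodule.span ℝ {n j})ᗮ |
      inner ℝ (slabMap p (n j) (c j, z) - p) (n m) = c m} = 0 := by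
  let f : (Submodule.span ℝ {n j})ᗮ →ₗ[ℝ] ℝ :=
    (innerSL ℝ (n m)).toLinearMap ∘ₗ (Submodule.span ℝ {n j})ᗮ.subtype
  have hset : {z : (Submodule.span ℝ {n j})ᗮ |
      inner ℝ (slabMap p (n j) (c j, z) - p) (n m) = c m}
      = {z | f z = c m - c j * inner ℝ (n j) (n m)} := by
    ext z
    simp only [slabMap, add_sub_cancel_left, inner_add_left, inner_smul_left, mem_ofPred_eq, f,
      LinearMap.comp_apply, Submodule.subtype_apply, ContinuousLinearMap.coe_coe,
      innerSL_apply_apply, real_inner_comm (n m) (z : E d)]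
    simp only [conj_trivial]
    constructor <;> intro h <;> linarith
  by_cases hf : f = 0
  · convert! measure_empty (μ := volume)
    rw [hset, Set.eq_empty_iff_forall_notMem]
    intro z hz
    simp only [mem_ofPred_eq, hf, LinearMap.zero_apply] at hz
    have h1 : n m ∈ (Submodule.span ℝ {n j})ᗮᗮ := by
      rw [Submodule.mem_orthogonal]
      intro w hw
      have := LinearMap.congr_fun hf ⟨w, hw⟩
      simpa [f, real_inner_comm] using this
    rw [Submodule.orthogonal_orthogonal, Submodule.mem_span_singleton] at h1
    obtain ⟨a, ha⟩ := h1
    have h2 : inner ℝ (n j) (n m) = a := by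
      rw [← ha, inner_smul_right, real_inner_self_eq_norm_sq, hn j hj]; simp
    have h3 : |a| = 1 := by
      have := congrArg norm ha
      rwa [norm_smul, hn j hj, hn m hm, mul_one, Real.norm_eq_abs] at this
    rw [h2] at hz
    have h4 : 0 < a := by
      by_contra h
      have := hc j hj
      have := hc m hm
      nlinarith
    rw [abs_of_pos h4] at h3
    subst h3
    exact hjm (hinj j hj m hm (by simpa using ha) (by linarith))
  · rw [hset]
    exact volume_affine_hyperplane_sub f hf _

lemma tendsto_integral_polyFace (hn : ∀ j ∈ S, ‖n j‖ = 1) (hc : ∀ j ∈ S, 0 < c j)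
    (hinj : ∀ j ∈ S, ∀ m ∈ S, n j = n m → c j = c m → j = m) {φ : E d → ℝ}
    (hφ : Continuous φ) (hs : HasCompactSupport φ) {j : ι} (hj : j ∈ S) :
    Tendsto (fun ε => ∫ x, φ x * (polyCut (S.erase j) p n c ε x *
        (deriv Real.smoothTransition ((c j - inner ℝ (x - p) (n j)) / ε) / ε))) (𝓝[>] 0)
      (𝓝 (∫ x in polyFace S p n c j, φ x ∂(surf d))) := by
  have hnj := hn j hj
  let V := (Submodule.span ℝ {n j})ᗮ
  have hchange : ∀ ε : ℝ, 0 < ε → ∫ x, φ x * (polyCut (S.erase j) p n c ε x *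
        (deriv Real.smoothTransition ((c j - inner ℝ (x - p) (n j)) / ε) / ε))
      = ∫ q : ℝ × V, φ (slabMap p (n j) (c j - ε * q.1, q.2)) *
        (polyCut (S.erase j) p n c ε (slabMap p (n j) (c j - ε * q.1, q.2)) *
          deriv Real.smoothTransition q.1) ∂(volume.prod volume) := by
    intro ε hε
    have hcont : Continuous fun x => φ x * (polyCut (S.erase j) p n c ε x *
        (deriv Real.smoothTransition ((c j - inner ℝ (x - p) (n j)) / ε) / ε)) := by
      refine hφ.mul ((continuous_polyCut _ _ _ _ _).mul (Continuous.div_const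
        (continuous_deriv_smoothTransition.comp ?_) _))
      fun_prop
    have hint := hcont.integrable_of_hasCompactSupport (μ := volume) hs.mul_right
    have hmp := measurePreserving_slabMap p hnj
    have hint2 := hmp.integrable_comp_of_integrable hint
    rw [Function.comp_def] at hint2
    rw [← hmp.map_eq, integral_map hmp.measurable.aemeasurable
      (by rw [hmp.map_eq]; exact hint.aestronglyMeasurable), integral_prod_symm _ hint2]
    have key : ∀ z : V, (∫ s : ℝ, φ (slabMap p (n j) (s, z)) *
        (polyCut (S.erase j) p n c ε (slabMap p (n j) (s, z)) *
        (deriv Real.smoothTransition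
          ((c j - inner ℝ (slabMap p (n j) (s, z) - p) (n j)) / ε) / ε)))
        = ∫ t : ℝ, φ (slabMap p (n j) (c j - ε * t, z)) *
        (polyCut (S.erase j) p n c ε (slabMap p (n j) (c j - ε * t, z)) *
          deriv Real.smoothTransition t) := by
      intro z
      simp only [inner_slabMap_sub p hnj]
      rw [← integral_sub_left_eq_self _ _ (c j)]
      have := Measure.integral_comp_mul_left (fun s => φ (slabMap p (n j) (c j - s, z)) *
        (polyCut (S.erase j) p n c ε (slabMap p (n j) (c j - s, z)) *
        (deriv Real.smoothTransition ((c j - (c j - s)) / ε) / ε))) ε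
      rw [abs_of_pos (inv_pos.2 hε), smul_eq_mul, eq_inv_mul_iff_mul_eq₀ hε.ne'] at this
      rw [← this, ← integral_const_mul]
      congr 1 with t
      rw [sub_sub_cancel, mul_div_cancel_left₀ _ hε.ne']
      field_simp
    rw [integral_congr_ae (Eventually.of_forall key), integral_prod_symm]
    have hcont2 : Continuous fun q : ℝ × V => φ (slabMap p (n j) (c j - ε * q.1, q.2)) *
        (polyCut (S.erase j) p n c ε (slabMap p (n j) (c j - ε * q.1, q.2)) *
          deriv Real.smoothTransition q.1) := by
      have h1 : Continuous fun q : ℝ × V => slabMap p (n j) (c j - ε * q.1, q.2) :=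
        (continuous_slabMap p (n j)).comp (by fun_prop)
      exact (hφ.comp h1).mul (((continuous_polyCut _ _ _ _ _).comp h1).mul
        (continuous_deriv_smoothTransition.comp continuous_fst))
    refine hcont2.integrable_of_hasCompactSupport ?_
    obtain ⟨R, hR⟩ := hs.isBounded.subset_closedBall p
    refine HasCompactSupport.intro ((isCompact_Icc (a := (0 : ℝ)) (b := 1)).prod
      (isCompact_closedBall (0 : V) R)) fun q hq => ?_
    by_cases hq1 : q.1 ∈ Icc (0 : ℝ) 1
    · have hq2 : q.2 ∉ Metric.closedBall (0 : V) R := fun h => hq ⟨hq1, h⟩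
      have : φ (slabMap p (n j) (c j - ε * q.1, q.2)) = 0 := by
        by_contra h
        have h1 := hR (subset_closure h)
        rw [mem_closedBall_iff_norm] at h1
        have h2 := norm_slabMap_sub_sq p hnj (c j - ε * q.1, q.2)
        simp only at h2
        rw [mem_closedBall_zero_iff, not_le] at hq2
        have h3 : 0 ≤ R := (norm_nonneg _).trans h1
        nlinarith [norm_nonneg (slabMap p (n j) (c j - ε * q.1, q.2) - p),
          sq_nonneg (c j - ε * q.1)]
      rw [this, zero_mul]
    · rw [deriv_smoothTransition_eq_zero hq1, mul_zero, mul_zero]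
  have hlim : ∫ q : ℝ × V, deriv Real.smoothTransition q.1 *
      (polyFace S p n c j).indicator φ (slabMap p (n j) (c j, q.2)) ∂(volume.prod volume)
      = ∫ x in polyFace S p n c j, φ x ∂(surf d) := by
    rw [integral_prod_mul (deriv Real.smoothTransition) (fun z : V =>
        (polyFace S p n c j).indicator φ (slabMap p (n j) (c j, z))),
      integral_deriv_smoothTransition, one_mul, setIntegral_surf_eq p hnj (c j) (isClosed_polyFace S p n c j).measurableSet
        inter_subset_right]
  rw [← hlim]
  obtain ⟨M, hM⟩ := hφ.bounded_above_of_compact_support hs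
  obtain ⟨R, hR⟩ := hs.isBounded.subset_closedBall p
  have hae : ∀ᵐ q : ℝ × V ∂(volume.prod volume), ∀ m ∈ S.erase j,
      inner ℝ (slabMap p (n j) (c j, q.2) - p) (n m) ≠ c m := by
    refine (eventually_countable_ball (S.erase j).countable_toSet).2 fun m hm => ?_
    have hm' := Finset.mem_erase.1 hm
    have h0 := volume_slab_slice (p := p) hn hc hinj hj hm'.2 hm'.1.symm
    rw [ae_iff]
    have : {q : ℝ × V | ¬inner ℝ (slabMap p (n j) (c j, q.2) - p) (n m) ≠ c m}
        = univ ×ˢ {z : V | inner ℝ (slabMap p (n j) (c j, z) - p) (n m) = c m} := by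
      ext q; simp
    rw [this, Measure.prod_prod, h0, mul_zero]
  refine Tendsto.congr' (f₁ := fun ε => ∫ q : ℝ × V,
    φ (slabMap p (n j) (c j - ε * q.1, q.2)) *
        (polyCut (S.erase j) p n c ε (slabMap p (n j) (c j - ε * q.1, q.2)) *
          deriv Real.smoothTransition q.1) ∂(volume.prod volume)) ?_ ?_
  · filter_upwards [self_mem_nhdsWithin] with ε hε
    exact (hchange ε hε).symm
  refine tendsto_integral_filter_of_dominated_convergence
    (fun q => |deriv Real.smoothTransition q.1| *
      (Metric.closedBall (0 : V) R).indicator (fun _ => M) q.2) ?_ ?_ ?_ ?_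
  · refine Eventually.of_forall fun ε => Continuous.aestronglyMeasurable ?_
    have h1 : Continuous fun q : ℝ × V => slabMap p (n j) (c j - ε * q.1, q.2) :=
        (continuous_slabMap p (n j)).comp (by fun_prop)
    exact (hφ.comp h1).mul (((continuous_polyCut _ _ _ _ _).comp h1).mul
        (continuous_deriv_smoothTransition.comp continuous_fst))
  · refine Eventually.of_forall fun ε => Eventually.of_forall fun q => ?_
    by_cases hq2 : q.2 ∈ Metric.closedBall (0 : V) R
    · rw [indicator_of_mem hq2, norm_mul, norm_mul, Real.norm_eq_abs (deriv _ _)]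
      have h1 := hM (slabMap p (n j) (c j - ε * q.1, q.2))
      have h2 := abs_polyCut_le (S.erase j) p n c ε (slabMap p (n j) (c j - ε * q.1, q.2))
      rw [← Real.norm_eq_abs] at h2
      calc _ ≤ M * (1 * |deriv Real.smoothTransition q.1|) := by
            gcongr
            exact (norm_nonneg _).trans h1
        _ = _ := by ring
    · rw [indicator_of_notMem hq2]
      have : φ (slabMap p (n j) (c j - ε * q.1, q.2)) = 0 := by
        by_contra h
        have h1 := hR (subset_closure h)
        rw [mem_closedBall_iff_norm] at h1
        have h2 := norm_slabMap_sub_sq p hnj (c j - ε * q.1, q.2)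
        simp only at h2
        rw [mem_closedBall_zero_iff, not_le] at hq2
        have h3 : 0 ≤ R := (norm_nonneg _).trans h1
        nlinarith [norm_nonneg (slabMap p (n j) (c j - ε * q.1, q.2) - p),
          sq_nonneg (c j - ε * q.1)]
      simp [this]
  · refine Integrable.mul_prod (f := fun t : ℝ => |deriv Real.smoothTransition t|)
      (g := (Metric.closedBall (0 : V) R).indicator (fun _ => M)) ?_ ?_
    · exact (continuous_deriv_smoothTransition.integrable_of_hasCompactSupport
        hasCompactSupport_deriv_smoothTransition).abs
    · exact (integrable_indicator_iff Metric.isClosed_closedBall.measurableSet).2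
        (integrableOn_const measure_closedBall_lt_top.ne)
  · filter_upwards [hae] with q hq
    have hx : Tendsto (fun ε : ℝ => slabMap p (n j) (c j - ε * q.1, q.2)) (𝓝[>] 0)
        (𝓝 (slabMap p (n j) (c j, q.2))) := by
      have : Continuous fun ε : ℝ => slabMap p (n j) (c j - ε * q.1, q.2) :=
        (continuous_slabMap p (n j)).comp (by fun_prop)
      have h := this.tendsto 0
      simp only [zero_mul, sub_zero] at h
      exact h.mono_left nhdsWithin_le_nhds
    have h1 := tendsto_polyCut (S.erase j) p n c hx hq
    have h2 := ((hφ.tendsto _).comp hx).mul (h1.mul_const (deriv Real.smoothTransition q.1))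
    convert! h2 using 2
    have hin : inner ℝ (slabMap p (n j) (c j, q.2) - p) (n j) = c j :=
      inner_slabMap_sub p hnj _
    by_cases hmem : slabMap p (n j) (c j, q.2) ∈ polytope (S.erase j) p n c
    · rw [indicator_of_mem hmem, indicator_of_mem]
      · simp; ring
      · refine ⟨fun m hm => ?_, hin⟩
        by_cases h : m = j
        · subst h; exact hin.le
        · exact hmem m (Finset.mem_erase.2 ⟨h, hm⟩)
    · rw [indicator_of_notMem hmem, indicator_of_notMem]
      · simp
      · exact fun h => hmem fun m hm => h.1 m (Finset.mem_of_mem_erase hm)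

/-- The Gauss formula on a polytope. -/
theorem integral_polytope_fderiv (hn : ∀ j ∈ S, ‖n j‖ = 1) (hc : ∀ j ∈ S, 0 < c j)
    (hinj : ∀ j ∈ S, ∀ m ∈ S, n j = n m → c j = c m → j = m) {φ : E d → ℝ}
    (hφ : ContDiff ℝ 1 φ) (hs : HasCompactSupport φ) (v : E d) :
    ∫ x in polytope S p n c, fderiv ℝ φ x v
      = ∑ j ∈ S, inner ℝ (n j) v * ∫ x in polyFace S p n c j, φ x ∂(surf d) := by
  have hφc := hφ.continuous
  have hφ' : Continuous fun x => fderiv ℝ φ x v :=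
    (hφ.continuous_fderiv (by simp)).clm_apply continuous_const
  have hs' : HasCompactSupport fun x => fderiv ℝ φ x v :=
    (hs.fderiv (𝕜 := ℝ)).comp_left (g := fun L : E d →L[ℝ] ℝ => L v) rfl
  have hA : Tendsto (fun ε => ∫ x, polyCut S p n c ε x * fderiv ℝ φ x v) (𝓝[>] 0)
      (𝓝 (∫ x in polytope S p n c, fderiv ℝ φ x v)) := by
    rw [← integral_indicator (isClosed_polytope S p n c).measurableSet]
    refine tendsto_integral_filter_of_dominated_convergence (fun x => ‖fderiv ℝ φ x v‖)
      ?_ ?_ (hφ'.integrable_of_hasCompactSupport hs').norm ?_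
    · exact Eventually.of_forall fun ε =>
        ((continuous_polyCut S p n c ε).mul hφ').aestronglyMeasurable
    · refine Eventually.of_forall fun ε => Eventually.of_forall fun x => ?_
      rw [norm_mul]
      exact mul_le_of_le_one_left (norm_nonneg _) (abs_polyCut_le S p n c ε x)
    · have hae : ∀ᵐ x : E d, ∀ m ∈ S, inner ℝ (x - p) (n m) ≠ c m := by
        refine (eventually_countable_ball S.countable_toSet).2 fun m hm => ?_
        have hne : n m ≠ 0 := by
          intro h; have := hn m hm; simp [h] at this
        simpa [ae_iff] using volume_hyperplane hne p (c m)
      filter_upwards [hae] with x hx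
      have h := (tendsto_polyCut S p n c (x := fun _ => x) tendsto_const_nhds hx).mul_const
        (fderiv ℝ φ x v)
      convert! h using 2
      by_cases hx' : x ∈ polytope S p n c <;> simp [hx']
  have hB : Tendsto (fun ε => ∑ j ∈ S, inner ℝ (n j) v *
      ∫ x, φ x * (polyCut (S.erase j) p n c ε x *
        (deriv Real.smoothTransition ((c j - inner ℝ (x - p) (n j)) / ε) / ε))) (𝓝[>] 0)
      (𝓝 (∑ j ∈ S, inner ℝ (n j) v * ∫ x in polyFace S p n c j, φ x ∂(surf d))) :=
    tendsto_finsetSum _ fun j hj =>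
      (tendsto_integral_polyFace hn hc hinj hφc hs hj).const_mul _
  refine tendsto_nhds_unique hA (hB.congr fun ε => ?_)
  have hterm : ∀ j, Continuous fun x => polyCut (S.erase j) p n c ε x *
        (deriv Real.smoothTransition ((c j - inner ℝ (x - p) (n j)) / ε) / ε) := by
    intro j
    refine (continuous_polyCut _ _ _ _ _).mul (Continuous.div_const
        (continuous_deriv_smoothTransition.comp ?_) _)
    fun_prop
  choose f' hf' hf'v using fun x => hasFDerivAt_polyCut S p n c ε x v
  have hfd : ∀ x, fderiv ℝ (polyCut S p n c ε) x v =
      - ∑ j ∈ S, inner ℝ (n j) v * (polyCut (S.erase j) p n c ε x *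
        (deriv Real.smoothTransition ((c j - inner ℝ (x - p) (n j)) / ε) / ε)) := by
    intro x; rw [(hf' x).fderiv, hf'v]
  have hfc : Continuous fun x => fderiv ℝ (polyCut S p n c ε) x v := by
    simp only [hfd]
    exact (continuous_finsetSum _ fun j _ => continuous_const.mul (hterm j)).neg
  have hcut := continuous_polyCut S p n c ε
  have := integral_mul_fderiv_eq_neg_fderiv_mul_of_integrable (μ := volume)
    (f := polyCut S p n c ε) (g := φ) (v := v)
    ((hfc.mul hφc).integrable_of_hasCompactSupport hs.mul_left)
    ((hcut.mul hφ').integrable_of_hasCompactSupport hs'.mul_left)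
    ((hcut.mul hφc).integrable_of_hasCompactSupport hs.mul_left)
    (fun x _ => (hf' x).differentiableAt)
    (fun x _ => (hφ.differentiable (by simp)) x)
  rw [this, ← integral_neg]
  simp only [hfd, neg_mul, neg_neg, Finset.sum_mul]
  rw [integral_finsetSum]
  · refine Finset.sum_congr rfl fun j _ => ?_
    rw [← integral_const_mul]
    congr 1 with x
    ring
  · intro j _
    exact ((continuous_const.mul (hterm j)).mul hφc).integrable_of_hasCompactSupport hs.mul_left

end Gauss

/-! ### The Gauss formula and the trace inequality on Voronoi cells -/

namespace Triangulation

lemma dist_le_dist_iff (x i j : E d) (hij : i ≠ j) :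
    dist x i ≤ dist x j ↔ inner ℝ (x - i) (normal i j) ≤ dist i j / 2 := by
  have hd : 0 < dist i j := dist_pos.2 hij
  have h1 : ‖x - j‖ ^ 2 = ‖x - i‖ ^ 2 - 2 * inner ℝ (x - i) (j - i) + dist i j ^ 2 := by
    rw [dist_comm, dist_eq_norm, ← norm_sub_sq_real]; simp
  rw [normal, inner_smul_right, inv_mul_le_iff₀ hd, dist_eq_norm x, dist_eq_norm x,
    ← sq_le_sq₀ (norm_nonneg _) (norm_nonneg _), h1]
  constructor <;> intro h <;> nlinarith

lemma dist_eq_dist_iff (x i j : E d) (hij : i ≠ j) :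
    dist x i = dist x j ↔ inner ℝ (x - i) (normal i j) = dist i j / 2 := by
  have hd : 0 < dist i j := dist_pos.2 hij
  have h1 : ‖x - j‖ ^ 2 = ‖x - i‖ ^ 2 - 2 * inner ℝ (x - i) (j - i) + dist i j ^ 2 := by
    rw [dist_comm, dist_eq_norm, ← norm_sub_sq_real]; simp
  rw [normal, inner_smul_right, inv_mul_eq_iff_eq_mul₀ hd.ne', dist_eq_norm x, dist_eq_norm x,
    ← sq_eq_sq₀ (norm_nonneg _) (norm_nonneg _), h1]
  constructor <;> intro h <;> nlinarith

lemma norm_normal {i j : E d} (hij : i ≠ j) : ‖normal i j‖ = 1 := by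
  have hd : 0 < dist i j := dist_pos.2 hij
  rw [normal, norm_smul, norm_inv, ← dist_eq_norm j i, dist_comm j i, Real.norm_eq_abs,
    abs_of_pos hd, inv_mul_cancel₀ hd.ne']

variable {Ω : Set (E d)} (T : Triangulation Ω)

lemma mem_others {i j : E d} : j ∈ T.others i ↔ i ≠ j ∧ j ∈ T.verts := by
  classical
  simp [others, ne_comm]

lemma box_eq_polytope (i : E d) :
    T.box i = polytope (T.others i) i (normal i) (fun j => dist i j / 2) := by
  ext x
  simp only [box, polytope, mem_ofPred_eq, mem_others]
  constructor
  · intro h j hj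
    exact (dist_le_dist_iff x i j hj.1).1 (h j hj.2)
  · intro h j hj
    by_cases hij : i = j
    · rw [hij]
    · exact (dist_le_dist_iff x i j hij).2 (h j ⟨hij, hj⟩)

lemma face_eq_polyFace {i j : E d} (hi : i ∈ T.verts) (hj : j ∈ T.others i) :
    T.face i j = polyFace (T.others i) i (normal i) (fun j => dist i j / 2) j := by
  classical
  obtain ⟨hij, hjv⟩ := T.mem_others.1 hj
  ext x
  rw [polyFace, ← T.box_eq_polytope, face]
  constructor
  · intro h
    exact ⟨h.1, (dist_eq_dist_iff x i j hij).1 (le_antisymm (h.1 j hjv) (h.2 i hi))⟩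
  · intro h
    refine ⟨h.1, fun k hk => ?_⟩
    rw [← (dist_eq_dist_iff x i j hij).2 h.2]
    exact h.1 k hk

lemma isClosed_box (i : E d) : IsClosed (T.box i) := by
  classical
  rw [box_eq_polytope]; exact isClosed_polytope _ _ _ _

lemma isClosed_face (i j : E d) : IsClosed (T.face i j) :=
  (T.isClosed_box i).inter (T.isClosed_box j)

lemma convex_box (i : E d) : Convex ℝ (T.box i) := by
  rw [box_eq_polytope]
  intro x hx y hy a b ha hb hab m hm
  have h1 := hx m hm
  have h2 := hy m hm
  have h3 : a • x + b • y - i = a • (x - i) + b • (y - i) := by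
    rw [smul_sub, smul_sub, sub_add_sub_comm, ← add_smul, hab, one_smul]
  rw [h3, inner_add_left, inner_smul_left, inner_smul_left]
  simp only [conj_trivial]
  calc _ ≤ a * (dist i m / 2) + b * (dist i m / 2) := by gcongr
    _ = _ := by rw [← add_mul, hab, one_mul]

lemma face_subset_hyperplane {i j : E d} (hi : i ∈ T.verts) (hj : j ∈ T.others i) :
    T.face i j ⊆ {x | inner ℝ (x - i) (normal i j) = dist i j / 2} := by
  classical
  rw [T.face_eq_polyFace hi hj]; exact inter_subset_right

lemma surf_face_lt_top {i j : E d} (hi : i ∈ T.verts) (hj : j ∈ T.others i)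
    (hb : Bornology.IsBounded (T.box i)) : surf d (T.face i j) < ⊤ :=
  surf_lt_top_of_isBounded i (norm_normal (T.mem_others.1 hj).1) _ (T.face_subset_hyperplane hi hj)
    (hb.subset inter_subset_left)

lemma isCompact_box {i : E d} (hb : Bornology.IsBounded (T.box i)) : IsCompact (T.box i) :=
  Metric.isCompact_of_isClosed_isBounded (T.isClosed_box i) hb

lemma isCompact_face {i : E d} (j : E d) (hb : Bornology.IsBounded (T.box i)) :
    IsCompact (T.face i j) :=
  (T.isCompact_box hb).inter_right (T.isClosed_box j)

lemma integrableOn_face {i j : E d} (hi : i ∈ T.verts) (hj : j ∈ T.others i)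
    (hb : Bornology.IsBounded (T.box i)) {φ : E d → ℝ} (hφ : Continuous φ) :
    IntegrableOn φ (T.face i j) (surf d) := by
  obtain ⟨C, hC⟩ := (T.isCompact_face j hb).exists_bound_of_continuousOn hφ.continuousOn
  exact IntegrableOn.of_bound (T.surf_face_lt_top hi hj hb)
    (hφ.aestronglyMeasurable.restrict) C
    ((ae_restrict_iff' (T.isClosed_face i j).measurableSet).2 (Eventually.of_forall hC))

lemma integrableOn_box {i : E d} (hb : Bornology.IsBounded (T.box i)) {φ : E d → ℝ}
    (hφ : Continuous φ) : IntegrableOn φ (T.box i) :=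
  hφ.continuousOn.integrableOn_compact (T.isCompact_box hb)

/-- The Gauss formula on a bounded Voronoi cell. -/
theorem integral_box_fderiv {i : E d} (hi : i ∈ T.verts) (hb : Bornology.IsBounded (T.box i))
    {φ : E d → ℝ} (hφ : ContDiff ℝ 1 φ) (v : E d) :
    ∫ x in T.box i, fderiv ℝ φ x v
      = ∑ j ∈ T.others i, inner ℝ (normal i j) v * ∫ x in T.face i j, φ x ∂(surf d) := by
  classical
  have hK := T.isCompact_box hb
  obtain ⟨χ, hχ, hχc, -, hχ1⟩ : ∃ χ : E d → ℝ, ContDiff ℝ 1 χ ∧ HasCompactSupport χ ∧ True ∧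
      ∀ᶠ x in 𝓝ˢ (T.box i), χ x = 1 := by
    obtain ⟨R, hR, hR'⟩ := hb.subset_ball_lt 0 0
    let β : ContDiffBump (0 : E d) := ⟨R, R + 1, hR, by linarith⟩
    refine ⟨β, β.contDiff, β.hasCompactSupport, trivial, ?_⟩
    have : Metric.ball (0 : E d) R ∈ 𝓝ˢ (T.box i) :=
      Metric.isOpen_ball.mem_nhdsSet.2 hR'
    filter_upwards [this] with x hx
    exact β.one_of_mem_closedBall (Metric.ball_subset_closedBall hx)
  have h := integral_polytope_fderiv (S := T.others i) (p := i) (n := normal i)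
    (c := fun j => dist i j / 2) (φ := fun x => χ x * φ x)
    (fun j hj => norm_normal (T.mem_others.1 hj).1)
    (fun j hj => half_pos (dist_pos.2 (T.mem_others.1 hj).1)) ?_ (hχ.mul hφ) hχc.mul_right v
  · rw [← T.box_eq_polytope] at h
    have h1 : ∫ x in T.box i, fderiv ℝ φ x v = ∫ x in T.box i, fderiv ℝ (fun x => χ x * φ x) x v := by
      refine setIntegral_congr_fun (T.isClosed_box i).measurableSet fun x hx => ?_
      have h2 : (fun x => χ x * φ x) =ᶠ[𝓝 x] φ := by
        filter_upwards [(eventually_nhdsSet_iff_forall.1 hχ1) x hx] with y hy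
        rw [hy, one_mul]
      simp only [h2.fderiv_eq]
    rw [h1, h]
    refine Finset.sum_congr rfl fun j hj => ?_
    rw [← T.face_eq_polyFace hi hj]
    congr 1
    refine setIntegral_congr_fun (T.isClosed_face i j).measurableSet fun x hx => ?_
    rw [hχ1.self_of_nhdsSet x hx.1, one_mul]
  · intro j hj m hm h1 h2
    have h3 : dist i j = dist i m := by linarith
    have h4 : dist i m ≠ 0 := (dist_pos.2 (T.mem_others.1 hm).1).ne'
    simp only [normal, h3] at h1
    have := smul_right_injective _ (inv_ne_zero h4) h1
    simpa using this

lemma sum_integral_face_eq {i : E d} (hi : i ∈ T.verts) (hb : Bornology.IsBounded (T.box i))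
    {φ : E d → ℝ} (hφ : ContDiff ℝ 1 φ) :
    ∑ j ∈ T.others i, dist i j / 2 * ∫ x in T.face i j, φ x ∂(surf d)
      = ∫ x in T.box i, (d * φ x + fderiv ℝ φ x (x - i)) := by
  have hcoord : ∀ k : Fin d, ContDiff ℝ 1 fun x : E d => (x - i) k := fun k => by fun_prop
  have hfd : ∀ (k : Fin d) (x : E d), fderiv ℝ (fun x : E d => φ x * (x - i) k) x
      (EuclideanSpace.single k 1) = φ x + fderiv ℝ φ x (EuclideanSpace.single k 1) * (x - i) k := by
    intro k x
    let π : E d →L[ℝ] ℝ := EuclideanSpace.proj (𝕜 := ℝ) k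
    have h1 : HasFDerivAt (fun x => π (x - i)) π x := by
      have h0 : HasFDerivAt (fun x => π x - π i) π x := π.hasFDerivAt.sub_const (π i)
      simpa only [map_sub] using h0
    have h2 := ((hφ.differentiable (by simp)) x).hasFDerivAt.mul h1
    refine (congrArg (fun L : E d →L[ℝ] ℝ => L (EuclideanSpace.single k 1)) h2.fderiv).trans ?_
    simp [π, mul_comm]
  have hG := fun k : Fin d => T.integral_box_fderiv hi hb (hφ.mul (hcoord k))
    (EuclideanSpace.single k 1)
  simp only [hfd] at hG
  have hc := hφ.continuous
  have hc' : ∀ v, Continuous fun x => fderiv ℝ φ x v := fun v =>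
    (hφ.continuous_fderiv (by simp)).clm_apply continuous_const
  have h1 : ∫ x in T.box i, (d * φ x + fderiv ℝ φ x (x - i))
      = ∑ k : Fin d, ∫ x in T.box i,
        (φ x + fderiv ℝ φ x (EuclideanSpace.single k 1) * (x - i) k) := by
    rw [← integral_finsetSum]
    · congr 1 with x
      rw [Finset.sum_add_distrib, Finset.sum_const, Finset.card_univ, Fintype.card_fin,
        nsmul_eq_mul]
      congr 1
      have h2 : x - i = ∑ k, (x - i) k • EuclideanSpace.single k (1 : ℝ) := by
        have := (EuclideanSpace.basisFun (Fin d) ℝ).sum_repr (x - i)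
        simpa using this.symm
      conv_lhs => rw [h2, map_sum]
      refine Finset.sum_congr rfl fun k _ => ?_
      rw [map_smul, smul_eq_mul, mul_comm]
    · intro k _
      refine T.integrableOn_box hb (hc.add ((hc' _).mul (by fun_prop)))
  rw [h1, Finset.sum_congr rfl fun k _ => hG k, Finset.sum_comm]
  refine Finset.sum_congr rfl fun j hj => ?_
  simp only [← integral_const_mul]
  rw [← integral_finsetSum]
  · refine setIntegral_congr_fun (T.isClosed_face i j).measurableSet fun x hx => ?_
    have h2 := T.face_subset_hyperplane hi hj hx
    rw [mem_ofPred_eq, PiLp.inner_apply] at h2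
    rw [← h2, Finset.sum_mul]
    refine Finset.sum_congr rfl fun k _ => ?_
    simp [EuclideanSpace.inner_single_right]
    ring
  · intro k _
    exact T.integrableOn_face hi hj hb (continuous_const.mul (hc.mul (by fun_prop)))

/-- The scaled trace inequality on a Voronoi cell. -/
lemma sum_integral_face_sq_le {i : E d} (hi : i ∈ T.verts) {h : ℝ}
    (hb : T.box i ⊆ Metric.closedBall i h) {φ : E d → ℝ} (hφ : ContDiff ℝ 1 φ) :
    ∑ j ∈ T.others i, dist i j / 2 * ∫ x in T.face i j, φ x ^ 2 ∂(surf d)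
      ≤ (d + 1) * (∫ x in T.box i, φ x ^ 2) + h ^ 2 * ∫ x in T.box i, ‖fderiv ℝ φ x‖ ^ 2 := by
  have hbd : Bornology.IsBounded (T.box i) := Metric.isBounded_closedBall.subset hb
  rw [T.sum_integral_face_eq hi hbd (hφ.pow 2)]
  have hc := hφ.continuous
  have hc' := hφ.continuous_fderiv (by simp)
  have hc2 : Continuous fun x => fderiv ℝ (fun x => φ x ^ 2) x (x - i) :=
    ((hφ.pow 2).continuous_fderiv (by simp)).clm_apply (by fun_prop)
  rw [← integral_const_mul, ← integral_const_mul, ← integral_add]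
  · refine setIntegral_mono_on (T.integrableOn_box hbd ((continuous_const.mul (hc.pow 2)).add hc2))
      (T.integrableOn_box hbd ((continuous_const.mul (hc.pow 2)).add
        (continuous_const.mul (hc'.norm.pow 2)))) (T.isClosed_box i).measurableSet fun x hx => ?_
    have h1 := ((hφ.differentiable (by simp)) x).hasFDerivAt.pow 2
    have h3 : fderiv ℝ (fun x => φ x ^ 2) x (x - i) = 2 * φ x * fderiv ℝ φ x (x - i) := by
      rw [HasFDerivAt.fderiv h1]; simp
    rw [h3]
    have h4 : |fderiv ℝ φ x (x - i)| ≤ ‖fderiv ℝ φ x‖ * h := by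
      refine ((fderiv ℝ φ x).le_opNorm (x - i)).trans ?_
      gcongr
      simpa [dist_eq_norm] using hb hx
    have h5 : (fderiv ℝ φ x (x - i)) ^ 2 ≤ (‖fderiv ℝ φ x‖ * h) ^ 2 := by
      rw [← sq_abs]; gcongr
    nlinarith [sq_nonneg (φ x - fderiv ℝ φ x (x - i))]
  · exact T.integrableOn_box hbd (continuous_const.mul (hc.pow 2))
  · exact T.integrableOn_box hbd (continuous_const.mul (hc'.norm.pow 2))

end Triangulation

/-! ### Jensen's inequality and the Poincaré inequality on convex sets -/

lemma eLpNorm_two_sq {α F : Type*} [MeasurableSpace α] [NormedAddCommGroup F] (f : α → F)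
    (μ : Measure α) : eLpNorm f 2 μ ^ 2 = ∫⁻ x, ‖f x‖ₑ ^ 2 ∂μ := by
  have := eLpNorm_nnreal_pow_eq_lintegral (f := f) (μ := μ) (p := 2) two_ne_zero
  simpa using this

lemma enorm_integral_sq_le {α F : Type*} [MeasurableSpace α] [NormedAddCommGroup F]
    [NormedSpace ℝ F] (π : Measure α) [IsProbabilityMeasure π] (f : α → F) :
    ‖∫ x, f x ∂π‖ₑ ^ 2 ≤ ∫⁻ x, ‖f x‖ₑ ^ 2 ∂π := by
  by_cases hf : AEStronglyMeasurable f π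
  · rw [← eLpNorm_two_sq]
    gcongr
    refine (enorm_integral_le_lintegral_enorm f).trans ?_
    rw [← eLpNorm_one_eq_lintegral_enorm]
    exact eLpNorm_le_eLpNorm_of_exponent_le (by norm_num) hf
  · rw [integral_non_aestronglyMeasurable hf]; simp

lemma lintegral_comp_segment_le {B : Set (E d)} (hB : Convex ℝ B) (hBm : MeasurableSet B)
    {g : E d → ℝ≥0∞} (hg : Measurable g) {x : E d} (hx : x ∈ B) {t : ℝ} (ht : t ∈ Icc (1 / 2) 1) :
    ∫⁻ y in B, g (x + t • (y - x)) ≤ 2 ^ d * ∫⁻ y in B, g y := by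
  have ht0 : 0 < t := by linarith [ht.1]
  calc ∫⁻ y in B, g (x + t • (y - x))
      ≤ ∫⁻ y, B.indicator g (t • y + (x - t • x)) := by
        rw [← lintegral_indicator hBm]
        refine lintegral_mono fun y => ?_
        by_cases hy : y ∈ B
        · have hmem : t • y + (x - t • x) ∈ B := by
            have := hB hy hx ht0.le (sub_nonneg.2 ht.2) (by ring)
            rwa [sub_smul, one_smul] at this
          rw [indicator_of_mem hy, indicator_of_mem hmem]
          apply le_of_eq; congr 1; rw [smul_sub]; abel
        · rw [indicator_of_notMem hy]; exact zero_le
    _ = ENNReal.ofReal |(t ^ d)⁻¹| * ∫⁻ y in B, g y := by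
        have h1 : ∫⁻ y, B.indicator g (t • y + (x - t • x))
            = ∫⁻ z, B.indicator g (z + (x - t • x)) ∂(Measure.map (t • ·) (volume : Measure (E d))) := by
          rw [lintegral_map (f := fun z => B.indicator g (z + (x - t • x)))
            ((hg.indicator hBm).comp (measurable_add_const _))
            (measurable_const_smul t)]
        rw [h1, Measure.map_addHaar_smul _ ht0.ne', lintegral_smul_measure,
          lintegral_add_right_eq_self (fun z => B.indicator g z), lintegral_indicator hBm]
        simp
    _ ≤ 2 ^ d * ∫⁻ y in B, g y := by
        gcongr
        rw [abs_of_pos (by positivity)]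
        refine ENNReal.ofReal_le_of_le_toReal ?_
        rw [ENNReal.toReal_pow, ← inv_pow]
        gcongr
        simp only [ENNReal.toReal_ofNat]
        rw [inv_le_comm₀ ht0 two_pos]
        linarith [ht.1]

lemma enorm_sub_sq_le_lintegral {φ : E d → ℝ} (hφ : ContDiff ℝ 1 φ) {D : ℝ} {x y : E d}
    (hD : ‖y - x‖ ≤ D) :
    ‖φ y - φ x‖ₑ ^ 2 ≤ ENNReal.ofReal D ^ 2 *
      ∫⁻ t in Icc (0 : ℝ) 1, ‖fderiv ℝ φ (x + t • (y - x))‖ₑ ^ 2 := by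
  have hc' := hφ.continuous_fderiv (by simp)
  have hcont : Continuous fun t : ℝ => fderiv ℝ φ (x + t • (y - x)) (y - x) :=
    (hc'.comp (by fun_prop)).clm_apply continuous_const
  have hftc : φ y - φ x = ∫ t in Icc (0 : ℝ) 1, fderiv ℝ φ (x + t • (y - x)) (y - x) := by
    rw [integral_Icc_eq_integral_Ioc, ← intervalIntegral.integral_of_le zero_le_one]
    rw [intervalIntegral.integral_eq_sub_of_hasDerivAt (f := fun t : ℝ => φ (x + t • (y - x)))]
    · simp
    · intro t _
      have h1 : HasDerivAt (fun t : ℝ => x + t • (y - x)) (y - x) t := by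
        simpa using ((hasDerivAt_id t).smul_const (y - x)).const_add x
      exact ((hφ.differentiable (by simp)) _).hasFDerivAt.comp_hasDerivAt t h1
    · exact hcont.intervalIntegrable _ _
  have : IsProbabilityMeasure (volume.restrict (Icc (0 : ℝ) 1)) := ⟨by simp⟩
  rw [hftc]
  refine (enorm_integral_sq_le _ _).trans ?_
  rw [← lintegral_const_mul']
  · refine lintegral_mono fun t => ?_
    rw [← mul_pow]
    gcongr
    refine ((fderiv ℝ φ (x + t • (y - x))).le_opENorm (y - x)).trans ?_
    rw [mul_comm]
    gcongr
    rw [← ofReal_norm]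
    exact ENNReal.ofReal_le_ofReal hD
  · simp

lemma lintegral_lintegral_enorm_sub_sq_le {B : Set (E d)} (hB : Convex ℝ B)
    (hBm : MeasurableSet B) (hBf : volume B ≠ ⊤) {D : ℝ} (hD : ∀ x ∈ B, ∀ y ∈ B, ‖y - x‖ ≤ D)
    {φ : E d → ℝ} (hφ : ContDiff ℝ 1 φ) :
    ∫⁻ x in B, ∫⁻ y in B, ‖φ y - φ x‖ₑ ^ 2
      ≤ ENNReal.ofReal D ^ 2 * (volume B * (2 ^ d * ∫⁻ x in B, ‖fderiv ℝ φ x‖ₑ ^ 2)) := by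
  have hc' := hφ.continuous_fderiv (by simp)
  let g : E d → ℝ≥0∞ := fun x => ‖fderiv ℝ φ x‖ₑ ^ 2
  have hgc : Continuous g := by
    have : Continuous fun x => ‖fderiv ℝ φ x‖ₑ := continuous_enorm.comp hc'
    exact (ENNReal.continuous_pow 2).comp this
  have : IsFiniteMeasure (volume.restrict B) := ⟨by simpa using hBf.lt_top⟩
  have hslice : ∀ t ∈ Icc (0 : ℝ) 1, ∫⁻ x in B, ∫⁻ y in B, g (x + t • (y - x))
      ≤ volume B * (2 ^ d * ∫⁻ x in B, g x) := by
    have hhalf : ∀ t ∈ Icc (1 / 2 : ℝ) 1, ∫⁻ x in B, ∫⁻ y in B, g (x + t • (y - x))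
        ≤ volume B * (2 ^ d * ∫⁻ x in B, g x) := by
      intro t ht
      calc _ ≤ ∫⁻ x in B, (2 ^ d * ∫⁻ x in B, g x) :=
            setLIntegral_mono' hBm fun x hx =>
              lintegral_comp_segment_le hB hBm hgc.measurable hx ht
        _ = _ := by rw [lintegral_const, Measure.restrict_apply_univ, mul_comm]
    intro t ht
    rcases le_total (1 / 2) t with h | h
    · exact hhalf t ⟨h, ht.2⟩
    · rw [lintegral_lintegral_swap]
      · refine le_trans (le_of_eq ?_) (hhalf (1 - t) ⟨by linarith, by linarith [ht.1]⟩)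
        congr 1 with x
        congr 1 with y
        congr 1
        module
      · exact Measurable.aemeasurable (hgc.comp (by fun_prop)).measurable
  calc ∫⁻ x in B, ∫⁻ y in B, ‖φ y - φ x‖ₑ ^ 2
      ≤ ∫⁻ x in B, ∫⁻ y in B, ENNReal.ofReal D ^ 2 *
          ∫⁻ t in Icc (0 : ℝ) 1, g (x + t • (y - x)) := by
        refine setLIntegral_mono' hBm fun x hx => setLIntegral_mono' hBm fun y hy => ?_
        exact enorm_sub_sq_le_lintegral hφ (hD x hx y hy)
    _ = ENNReal.ofReal D ^ 2 * ∫⁻ x in B, ∫⁻ y in B,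
          ∫⁻ t in Icc (0 : ℝ) 1, g (x + t • (y - x)) := by
        have : ENNReal.ofReal D ^ 2 ≠ ⊤ := by simp
        simp only [lintegral_const_mul' _ _ this]
    _ = ENNReal.ofReal D ^ 2 * ∫⁻ t in Icc (0 : ℝ) 1, ∫⁻ x in B, ∫⁻ y in B,
          g (x + t • (y - x)) := by
        congr 1
        have h1 : ∀ x : E d, ∫⁻ y in B, ∫⁻ t in Icc (0 : ℝ) 1, g (x + t • (y - x))
            = ∫⁻ t in Icc (0 : ℝ) 1, ∫⁻ y in B, g (x + t • (y - x)) := by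
          intro x
          rw [lintegral_lintegral_swap]
          exact Measurable.aemeasurable (hgc.comp (by fun_prop)).measurable
        simp only [h1]
        rw [lintegral_lintegral_swap]
        refine Measurable.aemeasurable ?_
        refine Measurable.lintegral_prod_right' (f := fun q : (E d × ℝ) × E d =>
          g (q.1.1 + q.1.2 • (q.2 - q.1.1))) ?_
        exact (hgc.comp (by fun_prop)).measurable
    _ ≤ ENNReal.ofReal D ^ 2 * ∫⁻ t in Icc (0 : ℝ) 1,
          (volume B * (2 ^ d * ∫⁻ x in B, g x)) := by
        gcongr 1
        exact setLIntegral_mono' measurableSet_Icc hslice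
    _ = _ := by simp [g]

/-- The Poincaré inequality on a bounded convex set. -/
lemma lintegral_sub_average_sq_le {B : Set (E d)} (hB : Convex ℝ B)
    (hBm : MeasurableSet B) (hBf : volume B ≠ ⊤) (hB0 : volume B ≠ 0) {D : ℝ}
    (hD : ∀ x ∈ B, ∀ y ∈ B, ‖y - x‖ ≤ D) {φ : E d → ℝ} (hφ : ContDiff ℝ 1 φ)
    (hi : IntegrableOn φ B) :
    ∫⁻ x in B, ‖φ x - ⨍ y in B, φ y‖ₑ ^ 2
      ≤ ENNReal.ofReal D ^ 2 * (2 ^ d * ∫⁻ x in B, ‖fderiv ℝ φ x‖ₑ ^ 2) := by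
  let π : Measure (E d) := (volume.restrict B univ)⁻¹ • volume.restrict B
  have : IsFiniteMeasure (volume.restrict B) := ⟨by simpa using hBf.lt_top⟩
  have : NeZero (volume.restrict B) := ⟨by simpa using hB0⟩
  have hπ : IsProbabilityMeasure π := inferInstance
  have hav : ∀ x, φ x - ⨍ y in B, φ y = ∫ y, (φ x - φ y) ∂π := by
    intro x
    have hint : Integrable φ π := hi.to_average
    rw [integral_sub (integrable_const _) hint]
    rw [integral_const, probReal_univ, one_smul]
    rfl
  calc ∫⁻ x in B, ‖φ x - ⨍ y in B, φ y‖ₑ ^ 2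
      ≤ ∫⁻ x in B, (volume B)⁻¹ * ∫⁻ y in B, ‖φ y - φ x‖ₑ ^ 2 := by
        refine lintegral_mono fun x => ?_
        rw [hav]
        refine (enorm_integral_sq_le π _).trans (le_of_eq ?_)
        simp only [π, lintegral_smul_measure, Measure.restrict_apply_univ, smul_eq_mul,
          enorm_sub_rev (φ x)]
    _ = (volume B)⁻¹ * ∫⁻ x in B, ∫⁻ y in B, ‖φ y - φ x‖ₑ ^ 2 :=
        lintegral_const_mul' _ _ (ENNReal.inv_ne_top.2 hB0)
    _ ≤ (volume B)⁻¹ * (ENNReal.ofReal D ^ 2 *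
          (volume B * (2 ^ d * ∫⁻ x in B, ‖fderiv ℝ φ x‖ₑ ^ 2))) := by
        gcongr
        exact lintegral_lintegral_enorm_sub_sq_le hB hBm hBf hD hφ
    _ = _ := by
        rw [mul_left_comm, ← mul_assoc (volume B)⁻¹, ENNReal.inv_mul_cancel hB0 hBf, one_mul]

/-! ### Mollification in `L²(ℝ^d)` -/

section Mollify

variable {F : Type*} [NormedAddCommGroup F] [NormedSpace ℝ F] [CompleteSpace F]

set_option linter.unusedSectionVars false

/-- Bump functions with supports shrinking to the origin. -/
def bump (d : ℕ) (n : ℕ) : ContDiffBump (0 : E d) where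
  rIn := 1 / (n + 1) / 2
  rOut := 1 / (n + 1)
  rIn_pos := by positivity
  rIn_lt_rOut := half_lt_self (by positivity)

/-- The mollifiers. -/
def kern (d : ℕ) (n : ℕ) : E d → ℝ := (bump d n).normed volume

lemma contDiff_kern (n : ℕ) : ContDiff ℝ ∞ (kern d n) := (bump d n).contDiff_normed (n := ⊤)

lemma hasCompactSupport_kern (n : ℕ) : HasCompactSupport (kern d n) :=
  (bump d n).hasCompactSupport_normed

lemma kern_nonneg (n : ℕ) (x : E d) : 0 ≤ kern d n x := (bump d n).nonneg_normed x

/-- Mollification. -/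
def moll (n : ℕ) (f : E d → F) : E d → F :=
  convolution (kern d n) f (ContinuousLinearMap.lsmul ℝ ℝ) volume

lemma moll_apply (n : ℕ) (f : E d → F) (x : E d) :
    moll n f x = ∫ t, kern d n t • f (x - t) := rfl

lemma moll_apply_swap (n : ℕ) (f : E d → F) (x : E d) :
    moll n f x = ∫ t, kern d n (x - t) • f t := convolution_lsmul_swap

lemma integrable_kern_smul (n : ℕ) {f : E d → F} (hf : LocallyIntegrable f) (x : E d) :
    Integrable fun t => kern d n t • f (x - t) :=
  (hasCompactSupport_kern n).convolutionExists_left (ContinuousLinearMap.lsmul ℝ ℝ)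
    (contDiff_kern n).continuous hf x

lemma moll_sub (n : ℕ) {f g : E d → F} (hf : LocallyIntegrable f) (hg : LocallyIntegrable g) :
    moll n (f - g) = moll n f - moll n g := by
  funext x
  simp only [moll_apply, Pi.sub_apply, smul_sub]
  exact integral_sub (integrable_kern_smul n hf x) (integrable_kern_smul n hg x)

lemma contDiff_moll (n : ℕ) {f : E d → F} (hf : LocallyIntegrable f) :
    ContDiff ℝ ∞ (moll n f) :=
  (hasCompactSupport_kern n).contDiff_convolution_left _ (contDiff_kern n) hf

lemma hasCompactSupport_moll (n : ℕ) {f : E d → F} (hf : HasCompactSupport f) :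
    HasCompactSupport (moll n f) :=
  (hasCompactSupport_kern n).convolution _ hf

lemma moll_congr (n : ℕ) {f g : E d → F} (h : f =ᵐ[volume] g) : moll n f = moll n g :=
  convolution_congr _ EventuallyEq.rfl h

lemma eLpNorm_moll_le (n : ℕ) {f : E d → F} (hf : AEStronglyMeasurable f) :
    eLpNorm (moll n f) 2 volume ≤ eLpNorm f 2 volume := by
  wlog hfm : StronglyMeasurable f generalizing f
  · rw [moll_congr n hf.ae_eq_mk, eLpNorm_congr_ae hf.ae_eq_mk]
    exact this hf.stronglyMeasurable_mk.aestronglyMeasurable hf.stronglyMeasurable_mk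
  let k : E d → NNReal := fun x => (kern d n x).toNNReal
  have hk : Measurable k := (contDiff_kern n).continuous.measurable.real_toNNReal
  let π : Measure (E d) := volume.withDensity fun x => (k x : ℝ≥0∞)
  have hπ : IsProbabilityMeasure π := by
    refine ⟨?_⟩
    rw [withDensity_apply _ MeasurableSet.univ, Measure.restrict_univ]
    have h1 := ofReal_integral_eq_lintegral_ofReal (μ := volume) (f := kern d n)
      (bump d n).integrable_normed (Eventually.of_forall (kern_nonneg n))
    rw [show ∫ x, kern d n x = 1 from (bump d n).integral_normed, ENNReal.ofReal_one] at h1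
    exact h1.symm
  have hconv : ∀ x, moll n f x = ∫ t, f (x - t) ∂π := by
    intro x
    rw [integral_withDensity_eq_integral_smul hk, moll_apply]
    congr 1 with t
    rw [NNReal.smul_def, Real.coe_toNNReal _ (kern_nonneg n t)]
  rw [← (ENNReal.pow_right_strictMono two_ne_zero).le_iff_le, eLpNorm_two_sq, eLpNorm_two_sq]
  have hm : Measurable fun q : E d × E d => ‖f (q.1 - q.2)‖ₑ ^ 2 :=
    (hfm.enorm.comp (measurable_fst.sub measurable_snd)).pow_const 2
  calc ∫⁻ x, ‖moll n f x‖ₑ ^ 2 ≤ ∫⁻ x, ∫⁻ t, ‖f (x - t)‖ₑ ^ 2 ∂π := by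
        refine lintegral_mono fun x => ?_
        rw [hconv]
        exact enorm_integral_sq_le π _
    _ = ∫⁻ t, (∫⁻ x, ‖f (x - t)‖ₑ ^ 2) ∂π :=
        lintegral_lintegral_swap (f := fun x t => ‖f (x - t)‖ₑ ^ 2) hm.aemeasurable
    _ = ∫⁻ t, (∫⁻ x, ‖f x‖ₑ ^ 2) ∂π := by
        refine lintegral_congr fun t => ?_
        exact lintegral_sub_right_eq_self (fun x => ‖f x‖ₑ ^ 2) t
    _ = ∫⁻ x, ‖f x‖ₑ ^ 2 := by simp

lemma tendsto_bump_rOut : Tendsto (fun n => (bump d n).rOut) atTop (𝓝 0) :=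
  tendsto_one_div_add_atTop_nhds_zero_nat

lemma tendsto_eLpNorm_of_uniform {α : Type*} [MeasurableSpace α] {μ : Measure α} {ι : Type*}
    {l : Filter ι} {K : Set α} (hKm : MeasurableSet K) (hK : μ K ≠ ⊤) {f : ι → α → F}
    (hf : ∀ ε > 0, ∀ᶠ i in l, ∀ x ∈ K, ‖f i x‖ ≤ ε) :
    Tendsto (fun i => eLpNorm (f i) 2 (μ.restrict K)) l (𝓝 0) := by
  rw [ENNReal.tendsto_nhds_zero]
  intro ε hε
  obtain ⟨η, hη, hηε⟩ : ∃ η : ℝ, 0 < η ∧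
      μ K ^ (2 : ℝ≥0∞).toReal⁻¹ * ENNReal.ofReal η ≤ ε := by
    have hc : μ K ^ (2 : ℝ≥0∞).toReal⁻¹ ≠ ⊤ := ENNReal.rpow_ne_top_of_nonneg (by norm_num) hK
    have h1 : Tendsto (fun η : ℝ => μ K ^ (2 : ℝ≥0∞).toReal⁻¹ * ENNReal.ofReal η)
        (𝓝[>] 0) (𝓝 0) := by
      have h2 : Tendsto (fun η : ℝ => ENNReal.ofReal η) (𝓝[>] 0) (𝓝 0) := by
        have h3 := (ENNReal.continuous_ofReal.tendsto 0).mono_left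
          (nhdsWithin_le_nhds (s := Ioi (0 : ℝ)))
        rwa [ENNReal.ofReal_zero] at h3
      simpa using ENNReal.Tendsto.const_mul h2 (Or.inr hc)
    obtain ⟨η, h2, h3⟩ := ((h1.eventually_le_const hε).and self_mem_nhdsWithin).exists
    exact ⟨η, h3, h2⟩
  filter_upwards [hf η hη] with i hi
  refine (eLpNorm_le_of_ae_bound
    ((ae_restrict_iff' hKm).2 (Eventually.of_forall hi))).trans ?_
  rwa [Measure.restrict_apply_univ]

lemma tendsto_eLpNorm_moll_of_continuous {f : E d → F} (hf : Continuous f)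
    (hs : HasCompactSupport f) :
    Tendsto (fun n => eLpNorm (moll n f - f) 2 volume) atTop (𝓝 0) := by
  let K := Metric.cthickening 1 (tsupport f)
  have hKc : IsCompact K := hs.isCompact.cthickening
  have hKm : MeasurableSet K := hKc.isClosed.measurableSet
  have hr1 : ∀ n, (bump d n).rOut ≤ 1 := fun n => by
    change 1 / ((n : ℝ) + 1) ≤ 1
    rw [div_le_one (by positivity)]
    linarith [Nat.cast_nonneg (α := ℝ) n]
  have hsupp : ∀ n, Function.support (moll n f - f) ⊆ K := by
    intro n x hx
    by_contra hxK
    have hfar : ∀ y ∈ Metric.ball x (bump d n).rOut, f y = 0 := by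
      intro y hy
      by_contra hy0
      refine hxK (Metric.mem_cthickening_of_dist_le x y 1 _ (subset_closure hy0) ?_)
      rw [dist_comm]
      exact (le_of_lt hy).trans (hr1 n)
    have h0 : f x = 0 := hfar x (Metric.mem_ball_self (bump d n).rOut_pos)
    have h1 : moll n f x = f x :=
      (bump d n).normed_convolution_eq_right fun y hy => by rw [hfar y hy, h0]
    exact hx (by simp [h1])
  have key := tendsto_eLpNorm_of_uniform (μ := (volume : Measure (E d))) hKm
    hKc.measure_lt_top.ne (f := fun n => moll n f - f) (l := atTop) ?_
  · refine key.congr fun n => eLpNorm_restrict_eq_of_support_subset (hsupp n)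
  · intro ε hε
    have hu := hs.uniformContinuous_of_continuous hf
    obtain ⟨δ, hδ, h⟩ := Metric.uniformContinuous_iff.1 hu ε hε
    filter_upwards [tendsto_bump_rOut.eventually_lt_const hδ] with n hn x _
    rw [Pi.sub_apply, ← dist_eq_norm]
    refine (bump d n).dist_normed_convolution_le hf.aestronglyMeasurable fun y hy => ?_
    exact (h (lt_trans hy hn)).le

/-- Mollifications converge in `L²`. -/
lemma tendsto_eLpNorm_moll {f : E d → F} (hf : MemLp f 2 volume) :
    Tendsto (fun n => eLpNorm (moll n f - f) 2 volume) atTop (𝓝 0) := by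
  rw [ENNReal.tendsto_nhds_zero]
  intro ε hε
  obtain ⟨c, hcs, hc, hcc, hcm⟩ := hf.exists_hasCompactSupport_eLpNorm_sub_le (by norm_num)
    (ε := ε / 3) (by simpa using hε.ne')
  have hfl := hf.locallyIntegrable (by norm_num)
  have hcl := hcc.locallyIntegrable (μ := volume)
  filter_upwards [(tendsto_eLpNorm_moll_of_continuous hcc hcs).eventually_le_const
    (show 0 < ε / 3 by simpa using hε.ne')] with n hn
  have h1 : moll n f - f = moll n (f - c) + ((moll n c - c) + (c - f)) := by
    rw [moll_sub n hfl hcl]; abel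
  have hsub := hf.1.sub hcm.1
  have hm1 : AEStronglyMeasurable (moll n (f - c)) volume :=
    (contDiff_moll n (hfl.sub hcl)).continuous.aestronglyMeasurable
  have hm2 : AEStronglyMeasurable (moll n c - c) volume :=
    ((contDiff_moll n hcl).continuous.sub hcc).aestronglyMeasurable
  rw [h1]
  calc _ ≤ eLpNorm (moll n (f - c)) 2 volume + (eLpNorm (moll n c - c) 2 volume
        + eLpNorm (c - f) 2 volume) := by
        refine (eLpNorm_add_le hm1 (hm2.add (hcm.1.sub hf.1)) (by norm_num)).trans ?_
        gcongr
        exact eLpNorm_add_le hm2 (hcm.1.sub hf.1) (by norm_num)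
    _ ≤ ε / 3 + (ε / 3 + ε / 3) := by
        gcongr
        · exact (eLpNorm_moll_le n hsub).trans hc
        · rw [eLpNorm_sub_comm]; exact hc
    _ = ε := by rw [← add_assoc]; exact ENNReal.add_thirds ε

lemma memLp_moll (n : ℕ) {f : E d → F} (hf : MemLp f 2 volume) : MemLp (moll n f) 2 volume :=
  ⟨(contDiff_moll n (hf.locallyIntegrable (by norm_num))).continuous.aestronglyMeasurable,
    (eLpNorm_moll_le n hf.1).trans_lt hf.2⟩

end Mollify

/-! ### Weak derivatives on `ℝ^d` -/

/-- `g` is the weak derivative of `w` on `ℝ^d` in direction `v`. -/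
def IsWeakDeriv (v : E d) (w g : E d → ℝ) : Prop :=
  ∀ φ : E d → ℝ, ContDiff ℝ ∞ φ → HasCompactSupport φ →
    ∫ x, w x * fderiv ℝ φ x v = - ∫ x, g x * φ x

lemma fderiv_moll {w : E d → ℝ} (hw : LocallyIntegrable w) (n : ℕ) (x v : E d) :
    fderiv ℝ (moll n w) x v = ∫ y, w y * fderiv ℝ (kern d n) (x - y) v := by
  have hk1 : ContDiff ℝ 1 (kern d n) := (contDiff_kern n).of_le (by simp)
  have h := (hasCompactSupport_kern n).hasFDerivAt_convolution_left
    (ContinuousLinearMap.lsmul ℝ ℝ) hk1 hw x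
  have h1 : fderiv ℝ (moll n w) x = _ := h.fderiv
  have hex := (HasCompactSupport.fderiv (𝕜 := ℝ) (hasCompactSupport_kern (d := d) n)).convolutionExists_left
    ((ContinuousLinearMap.lsmul ℝ ℝ : ℝ →L[ℝ] ℝ →L[ℝ] ℝ).precompL (E d)) (hk1.continuous_fderiv (by simp)) hw x
  rw [h1, convolution_def, ContinuousLinearMap.integral_apply hex]
  rw [← integral_sub_left_eq_self _ _ x]
  congr 1 with y
  simp [mul_comm]

lemma fderiv_moll_of_isWeakDeriv {v : E d} {w g : E d → ℝ} (hw : LocallyIntegrable w)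
    (h : IsWeakDeriv v w g) (n : ℕ) (x : E d) : fderiv ℝ (moll n w) x v = moll n g x := by
  rw [fderiv_moll hw, moll_apply_swap]
  have hk : ContDiff ℝ ∞ fun y => kern d n (x - y) :=
    (contDiff_kern n).comp (contDiff_const.sub contDiff_id)
  have hd : ∀ y, fderiv ℝ (fun y => kern d n (x - y)) y v = - fderiv ℝ (kern d n) (x - y) v := by
    intro y
    have h1 : HasFDerivAt (fun y => x - y) (-ContinuousLinearMap.id ℝ (E d)) y :=
      (hasFDerivAt_id y).const_sub x
    have h2 := ((contDiff_kern n).differentiable (by simp) (x - y)).hasFDerivAt.comp y h1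
    refine (congrArg (fun L : E d →L[ℝ] ℝ => L v) h2.fderiv).trans ?_
    simp
  have h1 := h _ hk ((hasCompactSupport_kern n).comp_homeomorph (Homeomorph.subLeft x))
  simp only [hd, mul_neg, integral_neg, neg_inj] at h1
  rw [h1]
  congr 1 with y
  simp [mul_comm]

lemma enorm_sq_eq_ofReal (a : ℝ) : ‖a‖ₑ ^ 2 = ENNReal.ofReal (a ^ 2) := by
  rw [Real.enorm_eq_ofReal_abs, ← ENNReal.ofReal_pow (abs_nonneg a), sq_abs]

lemma norm_gradient (φ : E d → ℝ) (x : E d) : ‖gradient φ x‖ = ‖fderiv ℝ φ x‖ := by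
  rw [gradient, LinearIsometryEquiv.norm_map]

lemma enorm_gradient (φ : E d → ℝ) (x : E d) : ‖gradient φ x‖ₑ = ‖fderiv ℝ φ x‖ₑ := by
  rw [← ofReal_norm, norm_gradient, ofReal_norm]

lemma gradient_apply (φ : E d → ℝ) (x : E d) (k : Fin d) :
    gradient φ x k = fderiv ℝ φ x (EuclideanSpace.single k 1) := by
  rw [← inner_gradient_left, EuclideanSpace.inner_single_right]; simp

lemma continuous_gradient {φ : E d → ℝ} (hφ : ContDiff ℝ 1 φ) : Continuous (gradient φ) :=
  (InnerProductSpace.toDual ℝ (E d)).symm.continuous.comp (hφ.continuous_fderiv (by simp))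

lemma gradient_sub {φ ψ : E d → ℝ} (hφ : ContDiff ℝ 1 φ) (hψ : ContDiff ℝ 1 ψ) :
    gradient (φ - ψ) = gradient φ - gradient ψ := by
  funext x
  simp only [gradient, Pi.sub_apply]
  rw [fderiv_sub ((hφ.differentiable (by simp)) x) ((hψ.differentiable (by simp)) x), map_sub]

/-! ### Traces of `H¹(ℝ^d)` functions -/

/-- `w ∈ H¹(ℝ^d)` with weak gradient `G`. -/
structure IsGlobalH1 (w : E d → ℝ) (G : E d → E d) : Prop where
  memLp : MemLp w 2 volume
  memLp_grad : MemLp G 2 volume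
  weakDeriv : ∀ k, IsWeakDeriv (EuclideanSpace.single k 1) w fun x => G x k

lemma moll_apply_coord (n : ℕ) {G : E d → E d} (hG : LocallyIntegrable G) (x : E d) (k : Fin d) :
    moll n G x k = moll n (fun y => G y k) x := by
  rw [moll_apply, moll_apply]
  have := (EuclideanSpace.proj (𝕜 := ℝ) k : E d →L[ℝ] ℝ).integral_comp_comm
    (integrable_kern_smul n hG x)
  simpa using this.symm

lemma IsGlobalH1.gradient_moll {w : E d → ℝ} {G : E d → E d} (h : IsGlobalH1 w G) (n : ℕ) :
    gradient (moll n w) = moll n G := by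
  funext x
  ext k
  rw [gradient_apply, moll_apply_coord n (h.memLp_grad.locallyIntegrable (by norm_num)),
    fderiv_moll_of_isWeakDeriv (h.memLp.locallyIntegrable (by norm_num)) (h.weakDeriv k)]

lemma IsGlobalH1.contDiff_moll {w : E d → ℝ} {G : E d → E d} (h : IsGlobalH1 w G) (n : ℕ) :
    ContDiff ℝ 1 (moll n w) :=
  (BoxMethod.contDiff_moll n (h.memLp.locallyIntegrable (by norm_num))).of_le (by simp)

lemma IsGlobalH1.tendsto_gradient_moll {w : E d → ℝ} {G : E d → E d} (h : IsGlobalH1 w G) :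
    Tendsto (fun n => eLpNorm (gradient (moll n w) - G) 2 volume) atTop (𝓝 0) := by
  simp only [h.gradient_moll]
  exact tendsto_eLpNorm_moll h.memLp_grad

lemma exists_limit_eLpNorm {α F : Type*} [MeasurableSpace α] {μ : Measure α}
    [NormedAddCommGroup F] [CompleteSpace F] {f : ℕ → α → F} (hf : ∀ n, MemLp (f n) 2 μ)
    {b : ℕ → ℝ≥0∞} (hb : Tendsto b atTop (𝓝 0))
    (hfb : ∀ n m, eLpNorm (f n - f m) 2 μ ≤ b n + b m) :
    ∃ g, MemLp g 2 μ ∧ Tendsto (fun n => eLpNorm (f n - g) 2 μ) atTop (𝓝 0) := by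
  have hc : CauchySeq fun n => (hf n).toLp (f n) := by
    rw [EMetric.cauchySeq_iff]
    intro ε hε
    obtain ⟨N, hN⟩ := eventually_atTop.1 (hb.eventually_lt_const (ENNReal.half_pos hε.ne'))
    refine ⟨N, fun m hm n hn => ?_⟩
    rw [Lp.edist_toLp_toLp]
    refine (hfb m n).trans_lt ?_
    rw [← ENNReal.add_halves ε]
    exact ENNReal.add_lt_add (hN m hm) (hN n hn)
  obtain ⟨g, hg⟩ := cauchySeq_tendsto_of_complete hc
  refine ⟨g, Lp.memLp g, ?_⟩
  rw [Lp.tendsto_Lp_iff_tendsto_eLpNorm'] at hg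
  refine hg.congr fun n => eLpNorm_congr_ae ?_
  filter_upwards [(hf n).coeFn_toLp] with x hx
  simp [hx]

/-- The mean value over the ball with radius `r`. -/
def ballAvg (r : ℝ) (w : E d → ℝ) (x : E d) : ℝ := ⨍ y in Metric.ball x r, w y

/-- The uniform probability measure on a ball centred at the origin. -/
def ballMeasure (d : ℕ) (r : ℝ) : Measure (E d) :=
  (volume.restrict (Metric.ball (0 : E d) r) univ)⁻¹ • volume.restrict (Metric.ball (0 : E d) r)

lemma isProbabilityMeasure_ballMeasure {r : ℝ} (hr : 0 < r) :
    IsProbabilityMeasure (ballMeasure d r) := by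
  have : IsFiniteMeasure (volume.restrict (Metric.ball (0 : E d) r)) :=
    ⟨by simpa using measure_ball_lt_top⟩
  have : NeZero (volume.restrict (Metric.ball (0 : E d) r)) :=
    ⟨by simpa using (Metric.measure_ball_pos volume (0 : E d) hr).ne'⟩
  exact inferInstanceAs (IsProbabilityMeasure ((volume.restrict (Metric.ball (0 : E d) r) univ)⁻¹ •
    volume.restrict (Metric.ball (0 : E d) r)))

lemma ballAvg_eq (r : ℝ) (w : E d → ℝ) (x : E d) :
    ballAvg r w x = ∫ y, w (x + y) ∂(ballMeasure d r) := by
  have h1 : volume (Metric.ball x r) = volume (Metric.ball (0 : E d) r) :=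
    Measure.addHaar_ball_center volume x r
  have h2 : ∫ y in Metric.ball x r, w y = ∫ y in Metric.ball (0 : E d) r, w (x + y) := by
    rw [← integral_indicator Metric.isOpen_ball.measurableSet,
      ← integral_indicator Metric.isOpen_ball.measurableSet,
      ← integral_add_left_eq_self (fun y => (Metric.ball x r).indicator w y) x]
    congr 1 with y
    by_cases hy : y ∈ Metric.ball (0 : E d) r
    · rw [indicator_of_mem hy, indicator_of_mem]
      simpa [dist_eq_norm] using hy
    · rw [indicator_of_notMem hy, indicator_of_notMem]
      simpa [dist_eq_norm] using hy
  rw [ballAvg, ballMeasure, setAverage_eq, integral_smul_measure, h2, measureReal_def, h1,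
    Measure.restrict_apply_univ, ENNReal.toReal_inv]

lemma ballAvg_sub (r : ℝ) {w w' : E d → ℝ} (hw : LocallyIntegrable w)
    (hw' : LocallyIntegrable w') : ballAvg r (w - w') = ballAvg r w - ballAvg r w' := by
  funext x
  simp only [ballAvg, Pi.sub_apply, setAverage_eq, ← smul_sub]
  congr 1
  exact integral_sub
    ((hw.integrableOn_isCompact (isCompact_closedBall x r)).mono_set Metric.ball_subset_closedBall)
    ((hw'.integrableOn_isCompact (isCompact_closedBall x r)).mono_set Metric.ball_subset_closedBall)

lemma stronglyMeasurable_ballAvg {r : ℝ} (hr : 0 < r) {w : E d → ℝ} (hw : Continuous w) :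
    StronglyMeasurable (ballAvg r w) := by
  have := isProbabilityMeasure_ballMeasure (d := d) hr
  rw [show ballAvg r w = fun x => ∫ y, w (x + y) ∂(ballMeasure d r) from funext (ballAvg_eq r w)]
  exact StronglyMeasurable.integral_prod_right' (f := fun q : E d × E d => w (q.1 + q.2))
    (hw.comp (by fun_prop)).stronglyMeasurable

lemma enorm_ballAvg_le {r : ℝ} (hr : 0 < r) (w : E d → ℝ) (x : E d) :
    ‖ballAvg r w x‖ₑ ^ 2 ≤ (volume (Metric.ball (0 : E d) r))⁻¹ * eLpNorm w 2 volume ^ 2 := by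
  have := isProbabilityMeasure_ballMeasure (d := d) hr
  rw [ballAvg_eq]
  refine (enorm_integral_sq_le _ _).trans ?_
  rw [ballMeasure, lintegral_smul_measure, Measure.restrict_apply_univ, smul_eq_mul,
    eLpNorm_two_sq]
  rw [← lintegral_add_left_eq_self (fun y => ‖w y‖ₑ ^ 2) x]
  gcongr
  exact Measure.restrict_le_self

lemma tendsto_ballAvg {r : ℝ} (hr : 0 < r) {φ : ℕ → E d → ℝ} {w : E d → ℝ}
    (hφ : ∀ n, LocallyIntegrable (φ n)) (hw : LocallyIntegrable w)
    (h : Tendsto (fun n => eLpNorm (φ n - w) 2 volume) atTop (𝓝 0)) (x : E d) :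
    Tendsto (fun n => ballAvg r (φ n) x) atTop (𝓝 (ballAvg r w x)) := by
  rw [tendsto_iff_edist_tendsto_0]
  have h1 : Tendsto (fun n => (volume (Metric.ball (0 : E d) r))⁻¹ *
      eLpNorm (φ n - w) 2 volume ^ 2) atTop (𝓝 0) := by
    have h2 := ENNReal.Tendsto.const_mul (a := (volume (Metric.ball (0 : E d) r))⁻¹)
      (ENNReal.Tendsto.pow (n := 2) h)
      (Or.inr (ENNReal.inv_ne_top.2 (Metric.measure_ball_pos volume (0 : E d) hr).ne'))
    simpa using h2
  have h3 : Tendsto (fun n => edist (ballAvg r (φ n) x) (ballAvg r w x) ^ 2) atTop (𝓝 0) := by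
    refine tendsto_of_tendsto_of_tendsto_of_le_of_le tendsto_const_nhds h1
      (fun _ => zero_le) fun n => ?_
    refine le_trans (le_of_eq ?_) (enorm_ballAvg_le hr (φ n - w) x)
    rw [ballAvg_sub r (hφ n) hw, Pi.sub_apply, edist_eq_enorm_sub]
  have h4 := (ENNReal.continuous_rpow_const (y := 1 / 2)).tendsto 0 |>.comp h3
  rw [ENNReal.zero_rpow_of_pos (by norm_num)] at h4
  refine h4.congr fun n => ?_
  simp only [Function.comp_apply]
  rw [← ENNReal.rpow_natCast, ← ENNReal.rpow_mul]
  norm_num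

/-- A bound for the traces of `C¹` functions, uniform under translations. -/
def TraceBound (μ : Measure (E d)) (C : ℝ≥0∞) : Prop :=
  ∀ φ : E d → ℝ, ContDiff ℝ 1 φ → ∀ y, eLpNorm (fun x => φ (x + y)) 2 μ
    ≤ C * (eLpNorm φ 2 volume + eLpNorm (gradient φ) 2 volume)

lemma TraceBound.eLpNorm_ballAvg_le {μ : Measure (E d)} [IsFiniteMeasure μ] {C : ℝ≥0∞}
    (hC : TraceBound μ C) {φ : E d → ℝ} (hφ : ContDiff ℝ 1 φ) {r : ℝ} (hr : 0 < r) :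
    eLpNorm (ballAvg r φ) 2 μ
      ≤ C * (eLpNorm φ 2 volume + eLpNorm (gradient φ) 2 volume) := by
  have := isProbabilityMeasure_ballMeasure (d := d) hr
  rw [← ENNReal.pow_le_pow_left_iff two_ne_zero, eLpNorm_two_sq]
  have hm : Measurable fun q : E d × E d => ‖φ (q.1 + q.2)‖ₑ ^ 2 :=
    (hφ.continuous.measurable.comp (measurable_fst.add measurable_snd)).enorm.pow_const 2
  calc ∫⁻ x, ‖ballAvg r φ x‖ₑ ^ 2 ∂μ
      ≤ ∫⁻ x, ∫⁻ y, ‖φ (x + y)‖ₑ ^ 2 ∂(ballMeasure d r) ∂μ := by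
        refine lintegral_mono fun x => ?_
        rw [ballAvg_eq]
        exact enorm_integral_sq_le _ _
    _ = ∫⁻ y, ∫⁻ x, ‖φ (x + y)‖ₑ ^ 2 ∂μ ∂(ballMeasure d r) :=
        lintegral_lintegral_swap (f := fun x y => ‖φ (x + y)‖ₑ ^ 2) hm.aemeasurable
    _ ≤ ∫⁻ y, (C * (eLpNorm φ 2 volume + eLpNorm (gradient φ) 2 volume)) ^ 2
          ∂(ballMeasure d r) := by
        refine lintegral_mono fun y => ?_
        rw [← eLpNorm_two_sq (fun x => φ (x + y))]
        gcongr
        exact hC φ hφ y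
    _ = _ := by simp

lemma memLp_restrict_of_continuous {μ : Measure (E d)} {K : Set (E d)} (hK : IsCompact K)
    (hμ : μ K ≠ ⊤) {φ : E d → ℝ} (hφ : Continuous φ) : MemLp φ 2 (μ.restrict K) := by
  obtain ⟨M, hM⟩ := hK.exists_bound_of_continuousOn hφ.continuousOn
  have : IsFiniteMeasure (μ.restrict K) := ⟨by simpa using hμ.lt_top⟩
  exact MemLp.of_bound hφ.aestronglyMeasurable M
    ((ae_restrict_iff' hK.isClosed.measurableSet).2 (Eventually.of_forall hM))

lemma tendsto_eLpNorm_ballAvg_sub {μ : Measure (E d)} {K : Set (E d)} (hK : IsCompact K)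
    (hμ : μ K ≠ ⊤) {φ : E d → ℝ} (hφ : Continuous φ) :
    Tendsto (fun r => eLpNorm (ballAvg r φ - φ) 2 (μ.restrict K)) (𝓝[>] 0) (𝓝 0) := by
  refine tendsto_eLpNorm_of_uniform hK.isClosed.measurableSet hμ fun ε hε => ?_
  have hK' : IsCompact (Metric.cthickening 1 K) := hK.cthickening
  obtain ⟨δ, hδ, h⟩ := Metric.uniformContinuousOn_iff.1
    (hK'.uniformContinuousOn_of_continuous hφ.continuousOn) ε hε
  have hm : 0 < min δ 1 := lt_min hδ one_pos
  filter_upwards [Ioo_mem_nhdsGT hm] with r hr x hx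
  have := isProbabilityMeasure_ballMeasure (d := d) hr.1
  have hae : ∀ᵐ y ∂(ballMeasure d r), y ∈ Metric.ball (0 : E d) r :=
    Measure.ae_smul_measure (ae_restrict_mem Metric.isOpen_ball.measurableSet) _
  have hclose : ∀ y ∈ Metric.ball (0 : E d) r, ‖φ (x + y) - φ x‖ ≤ ε := by
    intro y hy
    rw [← dist_eq_norm]
    have h1 : dist (x + y) x < min δ 1 := by
      rw [dist_eq_norm, add_sub_cancel_left]
      exact (mem_ball_zero_iff.1 hy).trans hr.2
    refine (h _ (Metric.mem_cthickening_of_dist_le _ x 1 _ hx ?_) _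
      (Metric.self_subset_cthickening _ hx) (h1.trans_le (min_le_left _ _))).le
    exact (h1.trans_le (min_le_right _ _)).le
  have hint : Integrable (fun y => φ (x + y)) (ballMeasure d r) := by
    refine Integrable.of_bound (C := ‖φ x‖ + ε) (by fun_prop) ?_
    filter_upwards [hae] with y hy
    calc ‖φ (x + y)‖ = ‖φ x + (φ (x + y) - φ x)‖ := by congr 1; ring
      _ ≤ _ := (norm_add_le _ _).trans (by gcongr; exact hclose y hy)
  have h2 : (ballAvg r φ - φ) x = ∫ y, (φ (x + y) - φ x) ∂(ballMeasure d r) := by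
    rw [integral_sub hint (integrable_const _), integral_const, probReal_univ, one_smul,
      Pi.sub_apply, ballAvg_eq]
  rw [h2]
  refine (norm_integral_le_of_norm_le_const (hae.mono hclose)).trans ?_
  simp

/-- Functions in `H¹(ℝ^d)` have traces, and the traces of the mollifications converge. -/
theorem exists_trace {K : Set (E d)} (hK : IsCompact K) (hKs : surf d K ≠ ⊤) {C : ℝ≥0∞}
    (hC : TraceBound ((surf d).restrict K) C) (hCt : C ≠ ⊤) {w : E d → ℝ} {G : E d → E d}
    (h : IsGlobalH1 w G) :
    ∃ g, IsFaceTrace K w g ∧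
      Tendsto (fun n => eLpNorm (moll n w - g) 2 ((surf d).restrict K)) atTop (𝓝 0) := by
  let μ := (surf d).restrict K
  have : IsFiniteMeasure μ := ⟨by simpa [μ] using hKs.lt_top⟩
  let b : ℕ → ℝ≥0∞ := fun n => C * (eLpNorm (moll n w - w) 2 volume +
    eLpNorm (gradient (moll n w) - G) 2 volume)
  have hb : Tendsto b atTop (𝓝 0) := by
    have := ENNReal.Tendsto.const_mul (a := C)
      ((tendsto_eLpNorm_moll h.memLp).add h.tendsto_gradient_moll) (Or.inr hCt)
    simpa [b] using this
  have hloc : ∀ n, LocallyIntegrable (moll n w) := fun n =>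
    (h.contDiff_moll n).continuous.locallyIntegrable
  have hwloc : LocallyIntegrable w := h.memLp.locallyIntegrable (by norm_num)
  have hH1 : ∀ n m, C * (eLpNorm (moll n w - moll m w) 2 volume +
      eLpNorm (gradient (moll n w - moll m w)) 2 volume) ≤ b n + b m := by
    intro n m
    have h1 : eLpNorm (moll n w - moll m w) 2 volume
        ≤ eLpNorm (moll n w - w) 2 volume + eLpNorm (moll m w - w) 2 volume := by
      rw [eLpNorm_sub_comm (moll m w) w]
      refine le_trans (le_of_eq ?_) (eLpNorm_add_le
        ((memLp_moll n h.memLp).1.sub h.memLp.1) (h.memLp.1.sub (memLp_moll m h.memLp).1)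
        (by norm_num))
      rw [sub_add_sub_cancel]
    have h2 : eLpNorm (gradient (moll n w - moll m w)) 2 volume
        ≤ eLpNorm (gradient (moll n w) - G) 2 volume
          + eLpNorm (gradient (moll m w) - G) 2 volume := by
      rw [gradient_sub (h.contDiff_moll n) (h.contDiff_moll m),
        eLpNorm_sub_comm (gradient (moll m w)) G]
      refine le_trans (le_of_eq ?_) (eLpNorm_add_le
        ((continuous_gradient (h.contDiff_moll n)).aestronglyMeasurable.sub h.memLp_grad.1)
        (h.memLp_grad.1.sub (continuous_gradient (h.contDiff_moll m)).aestronglyMeasurable)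
        (by norm_num))
      rw [sub_add_sub_cancel]
    calc _ ≤ C * ((eLpNorm (moll n w - w) 2 volume + eLpNorm (moll m w - w) 2 volume) +
          (eLpNorm (gradient (moll n w) - G) 2 volume
            + eLpNorm (gradient (moll m w) - G) 2 volume)) := by gcongr
      _ = b n + b m := by simp only [b]; ring
  have hsm : ∀ n m, ContDiff ℝ 1 (moll n w - moll m w) := fun n m =>
    (h.contDiff_moll n).sub (h.contDiff_moll m)
  obtain ⟨g, hg, hlim⟩ := exists_limit_eLpNorm (μ := μ) (f := fun n => moll n w)
    (fun n => memLp_restrict_of_continuous hK hKs (h.contDiff_moll n).continuous) hb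
    fun n m => by
      refine le_trans ?_ (hH1 n m)
      have h0 := hC _ (hsm n m) 0
      simp only [add_zero] at h0
      exact h0
  refine ⟨g, ⟨hg, ?_⟩, hlim⟩
  have hball : ∀ r > 0, ∀ n, eLpNorm (ballAvg r (w - moll n w)) 2 μ ≤ b n := by
    intro r hr n
    have h1 : ∀ x, Tendsto (fun m => ballAvg r (moll m w - moll n w) x) atTop
        (𝓝 (ballAvg r (w - moll n w) x)) := by
      intro x
      refine tendsto_ballAvg hr (fun m => (hloc m).sub (hloc n)) (hwloc.sub (hloc n)) ?_ x
      simpa only [sub_sub_sub_cancel_right] using tendsto_eLpNorm_moll h.memLp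
    refine (Lp.eLpNorm_lim_le_liminf_eLpNorm (fun m => (stronglyMeasurable_ballAvg hr
      (hsm m n).continuous).aestronglyMeasurable) _ (Eventually.of_forall h1)).trans ?_
    have h2 : Tendsto (fun m => b m + b n) atTop (𝓝 (b n)) := by
      simpa using hb.add_const (b n)
    rw [← h2.liminf_eq]
    exact liminf_le_liminf (Eventually.of_forall fun m =>
      (hC.eLpNorm_ballAvg_le (hsm m n) hr).trans (hH1 m n))
  rw [ENNReal.tendsto_nhds_zero]
  intro ε hε
  have hε3 : 0 < ε / 3 := by simpa using hε.ne'
  obtain ⟨n, hn1, hn2⟩ := ((hb.eventually_le_const hε3).and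
    (hlim.eventually_le_const hε3)).exists
  filter_upwards [(tendsto_eLpNorm_ballAvg_sub hK hKs
    (h.contDiff_moll n).continuous).eventually_le_const hε3, self_mem_nhdsWithin] with r hr hr0
  have hm1 : AEStronglyMeasurable (ballAvg r (moll n w)) μ :=
    (stronglyMeasurable_ballAvg hr0 (h.contDiff_moll n).continuous).aestronglyMeasurable
  have hm2 : AEStronglyMeasurable (ballAvg r w) μ :=
    aestronglyMeasurable_of_tendsto_ae atTop
      (fun m => (stronglyMeasurable_ballAvg hr0 (h.contDiff_moll m).continuous).aestronglyMeasurable)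
      (Eventually.of_forall (tendsto_ballAvg hr0 hloc hwloc (tendsto_eLpNorm_moll h.memLp)))
  have hm3 : AEStronglyMeasurable (moll n w) μ :=
    (h.contDiff_moll n).continuous.aestronglyMeasurable
  have hsplit : (fun x => (⨍ y in Metric.ball x r, w y) - g x)
      = ballAvg r (w - moll n w) + ((ballAvg r (moll n w) - moll n w) + (moll n w - g)) := by
    rw [ballAvg_sub r hwloc (hloc n)]
    funext x
    simp [ballAvg]
  rw [hsplit]
  calc _ ≤ eLpNorm (ballAvg r (w - moll n w)) 2 μ +
        (eLpNorm (ballAvg r (moll n w) - moll n w) 2 μ + eLpNorm (moll n w - g) 2 μ) := by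
        refine (eLpNorm_add_le ?_ ((hm1.sub hm3).add (hm3.sub hg.1)) (by norm_num)).trans ?_
        · rw [ballAvg_sub r hwloc (hloc n)]
          exact hm2.sub hm1
        · gcongr
          exact eLpNorm_add_le (hm1.sub hm3) (hm3.sub hg.1) (by norm_num)
    _ ≤ ε / 3 + (ε / 3 + ε / 3) := by
        gcongr
        exact (hball r hr0 n).trans hn1
    _ = ε := by rw [← add_assoc]; exact ENNReal.add_thirds ε

/-! ### Limits in `L²` -/

section Limits

variable {α F : Type*} [MeasurableSpace α] {μ : Measure α} [NormedAddCommGroup F]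

lemma tendsto_lintegral_enorm_sq {f : ℕ → α → F} {g : α → F}
    (hf : ∀ n, AEStronglyMeasurable (f n) μ) (hg : MemLp g 2 μ)
    (h : Tendsto (fun n => eLpNorm (f n - g) 2 μ) atTop (𝓝 0)) :
    Tendsto (fun n => ∫⁻ x, ‖f n x‖ₑ ^ 2 ∂μ) atTop (𝓝 (∫⁻ x, ‖g x‖ₑ ^ 2 ∂μ)) := by
  simp only [← eLpNorm_two_sq]
  refine ENNReal.Tendsto.pow ?_
  have h1 : Tendsto (fun n => eLpNorm g 2 μ - eLpNorm (f n - g) 2 μ) atTop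
      (𝓝 (eLpNorm g 2 μ)) := by
    simpa using ENNReal.Tendsto.sub (tendsto_const_nhds (x := eLpNorm g 2 μ)) h
      (Or.inl hg.2.ne)
  have h2 : Tendsto (fun n => eLpNorm g 2 μ + eLpNorm (f n - g) 2 μ) atTop
      (𝓝 (eLpNorm g 2 μ)) := by
    simpa using (tendsto_const_nhds (x := eLpNorm g 2 μ)).add h
  refine tendsto_of_tendsto_of_tendsto_of_le_of_le h1 h2 (fun n => ?_) fun n => ?_
  · refine tsub_le_iff_right.2 ?_
    rw [eLpNorm_sub_comm]
    refine le_trans (le_of_eq ?_) (eLpNorm_add_le (hf n) (hg.1.sub (hf n)) (by norm_num))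
    rw [add_sub_cancel]
  · refine le_trans (le_of_eq ?_) (eLpNorm_add_le hg.1 ((hf n).sub hg.1) (by norm_num))
    rw [add_sub_cancel]

lemma tendsto_integral_of_tendsto_eLpNorm [NormedSpace ℝ F] [IsFiniteMeasure μ]
    {f : ℕ → α → F} {g : α → F} (hf : ∀ n, MemLp (f n) 2 μ) (hg : MemLp g 2 μ)
    (h : Tendsto (fun n => eLpNorm (f n - g) 2 μ) atTop (𝓝 0)) :
    Tendsto (fun n => ∫ x, f n x ∂μ) atTop (𝓝 (∫ x, g x ∂μ)) := by
  refine tendsto_integral_of_L1' g hg.1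
    (Eventually.of_forall fun n => (hf n).integrable (by norm_num)) ?_
  have hc : μ univ ^ (1 / (1 : ℝ≥0∞).toReal - 1 / (2 : ℝ≥0∞).toReal) ≠ ⊤ :=
    ENNReal.rpow_ne_top_of_nonneg (by norm_num) (measure_ne_top μ univ)
  have h1 := ENNReal.Tendsto.mul_const h (Or.inr hc)
  rw [zero_mul] at h1
  exact tendsto_of_tendsto_of_tendsto_of_le_of_le tendsto_const_nhds h1 (fun _ => zero_le)
    fun n => eLpNorm_le_eLpNorm_mul_rpow_measure_univ (by norm_num) ((hf n).1.sub hg.1)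

lemma tendsto_eLpNorm_sub_const [IsFiniteMeasure μ] {f : ℕ → α → F} {g : α → F} {a : ℕ → F}
    {b : F} (hf : ∀ n, AEStronglyMeasurable (f n) μ) (hg : AEStronglyMeasurable g μ)
    (h : Tendsto (fun n => eLpNorm (f n - g) 2 μ) atTop (𝓝 0)) (ha : Tendsto a atTop (𝓝 b)) :
    Tendsto (fun n => eLpNorm ((fun x => f n x - a n) - fun x => g x - b) 2 μ) atTop (𝓝 0) := by
  have hc : μ univ ^ (1 / (2 : ℝ≥0∞).toReal) ≠ ⊤ :=
    ENNReal.rpow_ne_top_of_nonneg (by norm_num) (measure_ne_top μ univ)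
  have h0 : Tendsto (fun n => ‖b - a n‖ₑ) atTop (𝓝 0) := by
    have := (continuous_enorm.tendsto _).comp ((tendsto_const_nhds (x := b)).sub ha)
    simpa [Function.comp_def] using this
  have h1 := h.add (ENNReal.Tendsto.mul_const h0 (Or.inr hc))
  rw [zero_mul, add_zero] at h1
  refine tendsto_of_tendsto_of_tendsto_of_le_of_le tendsto_const_nhds h1 (fun _ => zero_le)
    fun n => ?_
  have h2 : ((fun x => f n x - a n) - fun x => g x - b) = (f n - g) + fun _ => b - a n := by
    funext x; simp only [Pi.sub_apply, Pi.add_apply]; abel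
  rw [h2]
  refine (eLpNorm_add_le ((hf n).sub hg) aestronglyMeasurable_const (by norm_num)).trans ?_
  gcongr
  rcases eq_or_ne μ 0 with rfl | hμ
  · simp
  · rw [eLpNorm_const _ (by norm_num) hμ]

end Limits

namespace Triangulation

variable {Ω : Set (E d)} (T : Triangulation Ω)

lemma ofReal_setIntegral_sq {μ : Measure (E d)} {K : Set (E d)} {φ : E d → ℝ}
    (h : IntegrableOn (fun x => φ x ^ 2) K μ) :
    ENNReal.ofReal (∫ x in K, φ x ^ 2 ∂μ) = ∫⁻ x in K, ‖φ x‖ₑ ^ 2 ∂μ := by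
  rw [ofReal_integral_eq_lintegral_ofReal h (Eventually.of_forall fun x => sq_nonneg _)]
  simp only [enorm_sq_eq_ofReal]

/-- The scaled trace inequality on a Voronoi cell, for lower integrals. -/
lemma sum_lintegral_face_sq_le {i : E d} (hi : i ∈ T.verts) {h : ℝ}
    (hb : T.box i ⊆ Metric.closedBall i h) {φ : E d → ℝ} (hφ : ContDiff ℝ 1 φ) :
    ∑ j ∈ T.others i, ENNReal.ofReal (dist i j / 2) * ∫⁻ x in T.face i j, ‖φ x‖ₑ ^ 2 ∂(surf d)
      ≤ (d + 1) * (∫⁻ x in T.box i, ‖φ x‖ₑ ^ 2)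
        + ENNReal.ofReal h ^ 2 * ∫⁻ x in T.box i, ‖fderiv ℝ φ x‖ₑ ^ 2 := by
  have hbd : Bornology.IsBounded (T.box i) := Metric.isBounded_closedBall.subset hb
  by_cases hne : 0 ≤ h
  · have h1 := ENNReal.ofReal_le_ofReal (T.sum_integral_face_sq_le hi hb hφ)
    have hc := hφ.continuous
    have hc' := hφ.continuous_fderiv (by simp)
    rw [ENNReal.ofReal_sum_of_nonneg (fun j _ => mul_nonneg (by positivity)
      (integral_nonneg fun x => sq_nonneg _)), ENNReal.ofReal_add
      (mul_nonneg (by positivity) (integral_nonneg fun x => sq_nonneg _))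
      (mul_nonneg (by positivity) (integral_nonneg fun x => sq_nonneg _)),
      ENNReal.ofReal_mul (by positivity), ENNReal.ofReal_mul (by positivity),
      ofReal_setIntegral_sq (T.integrableOn_box hbd (hc.pow 2)),
      ofReal_setIntegral_sq (φ := fun x => ‖fderiv ℝ φ x‖)
        (T.integrableOn_box hbd (hc'.norm.pow 2)),
      ENNReal.ofReal_pow hne, ENNReal.ofReal_add (by positivity) zero_le_one,
      ENNReal.ofReal_natCast, ENNReal.ofReal_one] at h1
    simp only [enorm_norm] at h1
    refine le_trans (le_of_eq ?_) h1
    refine Finset.sum_congr rfl fun j hj => ?_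
    rw [ENNReal.ofReal_mul (by positivity),
      ofReal_setIntegral_sq (T.integrableOn_face hi hj hbd (hc.pow 2))]
  · have he : T.box i = ∅ := by
      rw [Metric.closedBall_eq_empty.2 (not_le.1 hne)] at hb
      exact subset_eq_empty hb rfl
    simp [he, face]

/-- The trace inequality combined with the Poincaré inequality, for `C¹` functions. -/
lemma sum_lintegral_face_sub_average_sq_le {i : E d} (hi : i ∈ T.verts) {h : ℝ}
    (hb : T.box i ⊆ Metric.closedBall i h) (hB0 : volume (T.box i) ≠ 0) {φ : E d → ℝ}
    (hφ : ContDiff ℝ 1 φ) :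
    ∑ j ∈ T.others i, ENNReal.ofReal (dist i j / 2) *
        ∫⁻ x in T.face i j, ‖φ x - ⨍ y in T.box i, φ y‖ₑ ^ 2 ∂(surf d)
      ≤ ((d + 1) * 2 ^ (d + 2) + 1) * (ENNReal.ofReal h ^ 2 *
          ∫⁻ x in T.box i, ‖fderiv ℝ φ x‖ₑ ^ 2) := by
  have hbd : Bornology.IsBounded (T.box i) := Metric.isBounded_closedBall.subset hb
  set a := ⨍ y in T.box i, φ y
  have h1 := T.sum_lintegral_face_sq_le hi hb (hφ.sub (contDiff_const (c := a)))
  have h2 := lintegral_sub_average_sq_le (T.convex_box i) (T.isClosed_box i).measurableSet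
    hbd.measure_lt_top.ne hB0 (D := 2 * h) (fun x hx y hy => by
      rw [← dist_eq_norm]
      have h3 := dist_triangle_right y x i
      have h4 : dist x i ≤ h := hb hx
      have h5 : dist y i ≤ h := hb hy
      linarith) hφ (T.integrableOn_box hbd hφ.continuous)
  simp only [fderiv_sub_const] at h1
  refine h1.trans ?_
  rw [ENNReal.ofReal_mul zero_le_two, ENNReal.ofReal_ofNat] at h2
  calc _ ≤ (d + 1) * ((2 * ENNReal.ofReal h) ^ 2 *
          (2 ^ d * ∫⁻ x in T.box i, ‖fderiv ℝ φ x‖ₑ ^ 2))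
        + ENNReal.ofReal h ^ 2 * ∫⁻ x in T.box i, ‖fderiv ℝ φ x‖ₑ ^ 2 := by gcongr
    _ = _ := by ring

lemma exists_traceBound_face {i j : E d} (hi : i ∈ T.verts) (hj : j ∈ T.others i)
    (hbd : Bornology.IsBounded (T.box i)) :
    ∃ C : ℝ≥0∞, C ≠ ⊤ ∧ TraceBound ((surf d).restrict (T.face i j)) C := by
  obtain ⟨h, hb⟩ := hbd.subset_closedBall i
  have hc : 0 < dist i j / 2 := half_pos (dist_pos.2 (T.mem_others.1 hj).1)
  let c := ENNReal.ofReal (dist i j / 2)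
  have hc0 : c ≠ 0 := by simpa [c] using (T.mem_others.1 hj).1
  have hct : c ≠ ⊤ := ENNReal.ofReal_ne_top
  let M : ℝ≥0∞ := c⁻¹ * ((d + 1) + ENNReal.ofReal h ^ 2)
  have hM : M ≠ ⊤ := by
    refine ENNReal.mul_ne_top (ENNReal.inv_ne_top.2 hc0) ?_
    simp
  refine ⟨M + 1, by simp [hM], fun φ hφ y => ?_⟩
  have hψ : ContDiff ℝ 1 fun x => φ (x + y) := hφ.comp (by fun_prop)
  have h1 := T.sum_lintegral_face_sq_le hi hb hψ
  have h2 := (Finset.single_le_sum (f := fun j => ENNReal.ofReal (dist i j / 2) *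
    ∫⁻ x in T.face i j, ‖φ (x + y)‖ₑ ^ 2 ∂(surf d)) (fun _ _ => zero_le) hj).trans h1
  have h3 : ∫⁻ x in T.box i, ‖φ (x + y)‖ₑ ^ 2 ≤ eLpNorm φ 2 volume ^ 2 := by
    rw [eLpNorm_two_sq, ← lintegral_add_right_eq_self (fun x => ‖φ x‖ₑ ^ 2) y]
    exact lintegral_mono' Measure.restrict_le_self le_rfl
  have h4 : ∫⁻ x in T.box i, ‖fderiv ℝ (fun x => φ (x + y)) x‖ₑ ^ 2
      ≤ eLpNorm (gradient φ) 2 volume ^ 2 := by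
    rw [eLpNorm_two_sq, ← lintegral_add_right_eq_self (fun x => ‖gradient φ x‖ₑ ^ 2) y]
    simp only [enorm_gradient, fderiv_comp_add_right]
    exact lintegral_mono' Measure.restrict_le_self le_rfl
  rw [← ENNReal.pow_le_pow_left_iff two_ne_zero, eLpNorm_two_sq]
  set a := eLpNorm φ 2 volume
  set b := eLpNorm (gradient φ) 2 volume
  calc ∫⁻ x in T.face i j, ‖φ (x + y)‖ₑ ^ 2 ∂(surf d)
      = c⁻¹ * (c * ∫⁻ x in T.face i j, ‖φ (x + y)‖ₑ ^ 2 ∂(surf d)) := by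
        rw [← mul_assoc, ENNReal.inv_mul_cancel hc0 hct, one_mul]
    _ ≤ c⁻¹ * ((d + 1) * a ^ 2 + ENNReal.ofReal h ^ 2 * b ^ 2) := by
        gcongr
        exact h2.trans (by gcongr)
    _ ≤ c⁻¹ * ((d + 1) * (a + b) ^ 2 + ENNReal.ofReal h ^ 2 * (a + b) ^ 2) := by
        gcongr
        · exact le_self_add
        · exact le_add_self
    _ = M * (a + b) ^ 2 := by simp only [M]; ring
    _ ≤ (M + 1) ^ 2 * (a + b) ^ 2 := by
        gcongr
        calc M ≤ M + 1 := le_self_add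
          _ ≤ (M + 1) ^ 2 := le_self_pow₀ le_add_self two_ne_zero
    _ = _ := by rw [mul_pow]

/-- Traces of `H¹(ℝ^d)` functions on the faces of a Voronoi cell: existence, the Gauss formula,
and the trace inequality. -/
theorem exists_trace_box {i : E d} (hi : i ∈ T.verts) {h : ℝ}
    (hb : T.box i ⊆ Metric.closedBall i h) {w : E d → ℝ} {G : E d → E d}
    (hw : IsGlobalH1 w G) :
    ∃ g : E d → E d → ℝ, (∀ j ∈ T.others i, IsFaceTrace (T.face i j) w (g j)) ∧
      (∀ v, ∫ x in T.box i, inner ℝ (G x) v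
        = ∑ j ∈ T.others i, inner ℝ (normal i j) v * ∫ x in T.face i j, g j x ∂(surf d)) ∧
      (volume (T.box i) ≠ 0 → ∑ j ∈ T.others i, ENNReal.ofReal (dist i j / 2) *
        ∫⁻ x in T.face i j, ‖g j x - ⨍ y in T.box i, w y‖ₑ ^ 2 ∂(surf d)
      ≤ ((d + 1) * 2 ^ (d + 2) + 1) * (ENNReal.ofReal h ^ 2 *
          ∫⁻ x in T.box i, ‖G x‖ₑ ^ 2)) := by
  have hbd : Bornology.IsBounded (T.box i) := Metric.isBounded_closedBall.subset hb
  have hex : ∀ j, ∃ g, j ∈ T.others i → IsFaceTrace (T.face i j) w g ∧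
      Tendsto (fun n => eLpNorm (moll n w - g) 2 ((surf d).restrict (T.face i j))) atTop (𝓝 0) := by
    intro j
    by_cases hj : j ∈ T.others i
    · obtain ⟨C, hC, hT⟩ := T.exists_traceBound_face hi hj hbd
      obtain ⟨g, hg⟩ := exists_trace (T.isCompact_face j hbd) (T.surf_face_lt_top hi hj hbd).ne hT hC hw
      exact ⟨g, fun _ => hg⟩
    · exact ⟨0, fun h => absurd h hj⟩
  choose g hg using hex
  have hfin : IsFiniteMeasure ((volume : Measure (E d)).restrict (T.box i)) :=
    ⟨by simpa using hbd.measure_lt_top⟩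
  have hfinF : ∀ j ∈ T.others i, IsFiniteMeasure ((surf d).restrict (T.face i j)) := fun j hj =>
    ⟨by simpa using T.surf_face_lt_top hi hj hbd⟩
  have hφ := hw.contDiff_moll
  have hres : ∀ {F : Type} [NormedAddCommGroup F] {f : ℕ → E d → F},
      Tendsto (fun n => eLpNorm (f n) 2 volume) atTop (𝓝 0) →
      Tendsto (fun n => eLpNorm (f n) 2 (volume.restrict (T.box i))) atTop (𝓝 0) :=
    fun hf => tendsto_of_tendsto_of_tendsto_of_le_of_le tendsto_const_nhds hf
      (fun _ => zero_le) fun n => eLpNorm_restrict_le _ _ _ _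
  have hgB := hres hw.tendsto_gradient_moll
  have hwB := hres (tendsto_eLpNorm_moll hw.memLp)
  have hgm : ∀ n, MemLp (gradient (moll n w)) 2 volume := fun n => by
    rw [hw.gradient_moll]; exact memLp_moll n hw.memLp_grad
  have hFm : ∀ j ∈ T.others i, ∀ n, MemLp (moll n w) 2 ((surf d).restrict (T.face i j)) :=
    fun j hj n => memLp_restrict_of_continuous (T.isCompact_face j hbd)
      (T.surf_face_lt_top hi hj hbd).ne (hφ n).continuous
  refine ⟨g, fun j hj => (hg j hj).1, fun v => ?_, fun hB0 => ?_⟩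
  · have h1 : Tendsto (fun n => ∫ x in T.box i, fderiv ℝ (moll n w) x v) atTop
        (𝓝 (∫ x in T.box i, inner ℝ (G x) v)) := by
      have h2 := tendsto_integral_of_tendsto_eLpNorm (fun n => (hgm n).restrict (T.box i))
        (hw.memLp_grad.restrict (T.box i)) hgB
      have h3 : ∀ {f : E d → E d}, MemLp f 2 volume →
          ∫ x in T.box i, inner ℝ (f x) v = inner ℝ (∫ x in T.box i, f x) v := by
        intro f hf
        rw [real_inner_comm, ← integral_inner ((hf.restrict (T.box i)).integrable (by norm_num))]
        simp only [real_inner_comm v]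
      simp only [← inner_gradient_left]
      rw [h3 hw.memLp_grad]
      simp only [h3 (hgm _)]
      exact h2.inner tendsto_const_nhds
    refine tendsto_nhds_unique h1 ?_
    simp only [fun n => T.integral_box_fderiv hi hbd (hφ n) v]
    refine tendsto_finsetSum _ fun j hj => Tendsto.const_mul _ ?_
    have := hfinF j hj
    exact tendsto_integral_of_tendsto_eLpNorm (hFm j hj) (hg j hj).1.1 (hg j hj).2
  · have hav : Tendsto (fun n => ⨍ y in T.box i, moll n w y) atTop (𝓝 (⨍ y in T.box i, w y)) := by
      simp only [setAverage_eq]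
      exact (tendsto_integral_of_tendsto_eLpNorm
        (fun n => (memLp_moll n hw.memLp).restrict (T.box i))
        (hw.memLp.restrict (T.box i)) hwB).const_smul _
    have hL : Tendsto (fun n => ∑ j ∈ T.others i, ENNReal.ofReal (dist i j / 2) *
        ∫⁻ x in T.face i j, ‖moll n w x - ⨍ y in T.box i, moll n w y‖ₑ ^ 2 ∂(surf d)) atTop
        (𝓝 (∑ j ∈ T.others i, ENNReal.ofReal (dist i j / 2) *
        ∫⁻ x in T.face i j, ‖g j x - ⨍ y in T.box i, w y‖ₑ ^ 2 ∂(surf d))) := by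
      refine tendsto_finsetSum _ fun j hj =>
        ENNReal.Tendsto.const_mul ?_ (Or.inr ENNReal.ofReal_ne_top)
      have := hfinF j hj
      exact tendsto_lintegral_enorm_sq (fun n => (hFm j hj n).1.sub aestronglyMeasurable_const)
        ((hg j hj).1.1.sub (memLp_const _))
        (tendsto_eLpNorm_sub_const (fun n => (hFm j hj n).1) (hg j hj).1.1.1 (hg j hj).2 hav)
    have hR : Tendsto (fun n => ((d + 1) * 2 ^ (d + 2) + 1) * (ENNReal.ofReal h ^ 2 *
          ∫⁻ x in T.box i, ‖fderiv ℝ (moll n w) x‖ₑ ^ 2)) atTop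
        (𝓝 (((d + 1) * 2 ^ (d + 2) + 1) * (ENNReal.ofReal h ^ 2 *
          ∫⁻ x in T.box i, ‖G x‖ₑ ^ 2))) := by
      refine ENNReal.Tendsto.const_mul (ENNReal.Tendsto.const_mul ?_ (Or.inr (by simp)))
        (Or.inr (by finiteness))
      simp only [← enorm_gradient]
      exact tendsto_lintegral_enorm_sq (fun n => ((hgm n).restrict _).1)
        (hw.memLp_grad.restrict _) hgB
    exact le_of_tendsto_of_tendsto' hL hR fun n =>
      T.sum_lintegral_face_sub_average_sq_le hi hb hB0 (hφ n)

end Triangulation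

/-! ### Localization -/

lemma exists_cutoff {B Ω : Set (E d)} (hB : IsCompact B) (hΩ : IsOpen Ω) (h : B ⊆ Ω) :
    ∃ χ : E d → ℝ, ContDiff ℝ ∞ χ ∧ HasCompactSupport χ ∧ tsupport χ ⊆ Ω ∧
      ∀ᶠ x in 𝓝ˢ B, χ x = 1 := by
  obtain ⟨K, hK, hBK, hKΩ⟩ := exists_compact_between hB hΩ h
  obtain ⟨f, h1, h0, -⟩ := exists_contMDiffMap_one_nhds_of_subset_interior
    (modelWithCornersSelf ℝ (E d)) (n := (⊤ : ℕ∞)) hB.isClosed hBK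
  have hsupp : tsupport f ⊆ K := closure_minimal
    (fun x hx => by by_contra hxK; exact hx (h0 x hxK)) hK.isClosed
  exact ⟨f, f.contMDiff.contDiff, hK.of_isClosed_subset (isClosed_tsupport _) hsupp,
    hsupp.trans hKΩ, h1⟩

/-- `w ∈ H¹_loc(Ω)` with weak gradient `G`. -/
structure IsLocalH1 (Ω : Set (E d)) (w : E d → ℝ) (G : E d → E d) : Prop where
  weakGrad : IsWeakGrad Ω w G
  memL2 : MemL2loc Ω w
  memL2_grad : MemL2loc Ω G

lemma isWeakGrad_weakGrad {Ω : Set (E d)} {w : E d → ℝ} (h : ∃ G, IsWeakGrad Ω w G) :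
    IsWeakGrad Ω w (weakGrad Ω w) := by
  rw [BoxMethod.weakGrad, dif_pos h]; exact h.choose_spec

lemma MemH1loc.isLocalH1 {Ω : Set (E d)} {w : E d → ℝ} (h : MemH1loc Ω w) :
    IsLocalH1 Ω w (weakGrad Ω w) :=
  ⟨isWeakGrad_weakGrad h.2.1, h.1, h.2.2⟩

lemma MemL2.memL2loc {F : Type*} [NormedAddCommGroup F] {Ω : Set (E d)} {w : E d → F}
    (h : MemL2 Ω w) : MemL2loc Ω w :=
  fun _ _ hK => h.mono_measure (Measure.restrict_mono hK le_rfl)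

lemma MemH1.isLocalH1 {Ω : Set (E d)} {w : E d → ℝ} (h : MemH1 Ω w) :
    IsLocalH1 Ω w (weakGrad Ω w) :=
  ⟨isWeakGrad_weakGrad h.2.1, h.1.memL2loc, h.2.2.memL2loc⟩

lemma MemL2loc.integrableOn {F : Type*} [NormedAddCommGroup F] {Ω K : Set (E d)} {w : E d → F}
    (h : MemL2loc Ω w) (hK : IsCompact K) (hKΩ : K ⊆ Ω) : IntegrableOn w K := by
  have : IsFiniteMeasure ((volume : Measure (E d)).restrict K) :=
    ⟨by simpa using hK.measure_lt_top⟩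
  exact (h K hK hKΩ).integrable (by norm_num)

section Mul

variable {F : Type*} [NormedAddCommGroup F] [NormedSpace ℝ F]

lemma integrable_smul_of_support {K : Set (E d)} (hK : IsCompact K) {ψ : E d → ℝ}
    (hψ : Continuous ψ) (hs : Function.support ψ ⊆ K) {w : E d → F} (hw : IntegrableOn w K) :
    Integrable fun x => ψ x • w x := by
  have h1 : IntegrableOn (fun x => ψ x • w x) K := hw.continuousOn_smul hψ.continuousOn hK
  refine (integrableOn_iff_integrable_of_support_subset ?_).1 h1
  intro x hx
  refine hs fun h => hx ?_
  simp [h]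

lemma memLp_smul_of_support {K : Set (E d)} (hK : IsCompact K) {ψ : E d → ℝ}
    (hψ : Continuous ψ) (hs : Function.support ψ ⊆ K) {w : E d → F}
    (hw : MemLp w 2 (volume.restrict K)) : MemLp (fun x => ψ x • w x) 2 volume := by
  have h0 : (fun x => ψ x • w x) = K.indicator fun x => ψ x • w x := by
    symm
    rw [indicator_eq_self]
    intro x hx
    refine hs fun h => hx ?_
    simp [h]
  rw [h0, memLp_indicator_iff_restrict hK.isClosed.measurableSet]
  obtain ⟨M, hM⟩ := hK.exists_bound_of_continuousOn hψ.continuousOn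
  refine hw.of_le_mul (c := M) (hψ.aestronglyMeasurable.smul hw.1) ?_
  refine (ae_restrict_iff' hK.isClosed.measurableSet).2 (Eventually.of_forall fun x hx => ?_)
  rw [norm_smul]
  gcongr
  exact hM x hx

end Mul

/-- Cutting off a function of class `H¹_loc`. -/
lemma IsLocalH1.cutoff {Ω : Set (E d)} {w : E d → ℝ} {G : E d → E d} (h : IsLocalH1 Ω w G)
    {χ : E d → ℝ} (hχ : ContDiff ℝ ∞ χ) (hχc : HasCompactSupport χ) (hχΩ : tsupport χ ⊆ Ω) :
    IsGlobalH1 (fun x => χ x * w x) (fun x => χ x • G x + w x • gradient χ x) := by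
  have hχ1 : ContDiff ℝ 1 χ := hχ.of_le (by simp)
  have hK : IsCompact (tsupport χ) := hχc
  have hgs : ∀ x ∉ tsupport χ, gradient χ x = 0 := by
    intro x hx
    rw [gradient, fderiv_of_notMem_tsupport ℝ hx, map_zero]
  have hfs : ∀ v : E d, Function.support (fun x => fderiv ℝ χ x v) ⊆ tsupport χ := by
    intro v x hx
    by_contra hxs
    exact hx (by simp [fderiv_of_notMem_tsupport ℝ hxs])
  have hfc : ∀ v : E d, Continuous fun x => fderiv ℝ χ x v := fun v =>
    (hχ1.continuous_fderiv (by simp)).clm_apply continuous_const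
  have hwK := h.memL2 _ hK hχΩ
  have hGK := h.memL2_grad _ hK hχΩ
  have hwI := h.memL2.integrableOn hK hχΩ
  have hGI := h.memL2_grad.integrableOn hK hχΩ
  have hGkI : ∀ k, IntegrableOn (fun x => G x k) (tsupport χ) := fun k =>
    (EuclideanSpace.proj (𝕜 := ℝ) k : E d →L[ℝ] ℝ).integrable_comp hGI
  refine ⟨memLp_smul_of_support hK hχ.continuous (subset_tsupport χ) hwK, ?_, fun k φ hφ hφc => ?_⟩
  · refine (memLp_smul_of_support hK hχ.continuous (subset_tsupport χ) hGK).add ?_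
    have h0 : (fun x => w x • gradient χ x)
        = (tsupport χ).indicator fun x => w x • gradient χ x := by
      symm
      rw [indicator_eq_self]
      intro x hx
      by_contra hxs
      exact hx (by simp [hgs x hxs])
    rw [h0, memLp_indicator_iff_restrict hK.isClosed.measurableSet]
    have hgc := continuous_gradient hχ1
    obtain ⟨M, hM⟩ := hK.exists_bound_of_continuousOn hgc.continuousOn
    refine hwK.of_le_mul (c := M) (hwK.1.smul hgc.aestronglyMeasurable) ?_
    refine (ae_restrict_iff' hK.isClosed.measurableSet).2 (Eventually.of_forall fun x hx => ?_)
    rw [norm_smul, mul_comm]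
    gcongr
    exact hM x hx
  · set v : E d := EuclideanSpace.single k 1
    have hφ1 : ContDiff ℝ 1 φ := hφ.of_le (by simp)
    have hφ' : Continuous fun x => fderiv ℝ φ x v :=
      (hφ1.continuous_fderiv (by simp)).clm_apply continuous_const
    have hts : tsupport (fun x => χ x * φ x) ⊆ Ω :=
      (closure_mono (Function.support_mul_subset_left χ φ)).trans hχΩ
    have hweak : ∫ x in Ω, w x * fderiv ℝ (fun x => χ x * φ x) x v
        = - ∫ x in Ω, G x k * (χ x * φ x) := h.weakGrad.2.2 (fun x => χ x * φ x) (hχ.mul hφ) hχc.mul_right hts k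
    have hfd : ∀ x, fderiv ℝ (fun x => χ x * φ x) x v
        = χ x * fderiv ℝ φ x v + fderiv ℝ χ x v * φ x := by
      intro x
      have := ((hχ1.differentiable (by simp)) x).hasFDerivAt.mul
        ((hφ1.differentiable (by simp)) x).hasFDerivAt
      refine (congrArg (fun L : E d →L[ℝ] ℝ => L v) this.fderiv).trans ?_
      simp [mul_comm]
    rw [setIntegral_eq_integral_of_forall_compl_eq_zero,
      setIntegral_eq_integral_of_forall_compl_eq_zero] at hweak
    · simp only [hfd] at hweak
      have i1 : Integrable fun x => χ x * w x * fderiv ℝ φ x v := by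
        have := integrable_smul_of_support hK (hχ.continuous.mul hφ')
          ((Function.support_mul_subset_left _ _).trans (subset_tsupport χ)) hwI
        refine this.congr (Eventually.of_forall fun x => ?_)
        simp only [smul_eq_mul, Pi.mul_apply]; ring
      have i2 : Integrable fun x => w x * fderiv ℝ χ x v * φ x := by
        have := integrable_smul_of_support hK ((hfc v).mul hφ.continuous)
          ((Function.support_mul_subset_left _ _).trans (hfs v)) hwI
        refine this.congr (Eventually.of_forall fun x => ?_)
        simp only [smul_eq_mul, Pi.mul_apply]; ring
      have i3 : Integrable fun x => G x k * (χ x * φ x) := by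
        have := integrable_smul_of_support hK (hχ.continuous.mul hφ.continuous)
          ((Function.support_mul_subset_left _ _).trans (subset_tsupport χ)) (hGkI k)
        refine this.congr (Eventually.of_forall fun x => ?_)
        simp only [smul_eq_mul, Pi.mul_apply]; ring
      have e1 : ∫ x, w x * (χ x * fderiv ℝ φ x v + fderiv ℝ χ x v * φ x)
          = (∫ x, χ x * w x * fderiv ℝ φ x v) + ∫ x, w x * fderiv ℝ χ x v * φ x := by
        rw [← integral_add i1 i2]
        congr 1 with x
        ring
      have e2 : ∫ x, (χ x • G x + w x • gradient χ x) k * φ x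
          = (∫ x, G x k * (χ x * φ x)) + ∫ x, w x * fderiv ℝ χ x v * φ x := by
        rw [← integral_add i3 i2]
        congr 1 with x
        simp only [PiLp.add_apply, PiLp.smul_apply, smul_eq_mul, gradient_apply]
        ring
      rw [e2]
      linarith
    · intro x hx
      rw [image_eq_zero_of_notMem_tsupport (fun hxs => hx (hχΩ hxs)), zero_mul, mul_zero]
    · intro x hx
      rw [fderiv_of_notMem_tsupport ℝ (fun hxs => hx (hts hxs))]
      simp

/-! ### The trace on a face -/

lemma stronglyMeasurable_ballAvg_of_aestronglyMeasurable {r : ℝ} (hr : 0 < r) {w : E d → ℝ}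
    (hw : AEStronglyMeasurable w) : StronglyMeasurable (ballAvg r w) := by
  have := isProbabilityMeasure_ballMeasure (d := d) hr
  have h1 : ballAvg r w = ballAvg r (hw.mk w) := by
    funext x
    simp only [ballAvg, setAverage_eq]
    congr 1
    exact integral_congr_ae (ae_restrict_of_ae hw.ae_eq_mk)
  rw [h1, show ballAvg r (hw.mk w) = fun x => ∫ y, hw.mk w (x + y) ∂(ballMeasure d r) from
    funext (ballAvg_eq r _)]
  exact StronglyMeasurable.integral_prod_right' (f := fun q : E d × E d => hw.mk w (q.1 + q.2))
    (hw.stronglyMeasurable_mk.comp_measurable (by fun_prop))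

/-- `g` is the trace on `F` of `w`, and the mean values of `w` over small balls are regular. -/
structure HasTrace (F : Set (E d)) (w g : E d → ℝ) : Prop where
  isFaceTrace : IsFaceTrace F w g
  meas : ∀ᶠ r in 𝓝[>] (0 : ℝ), AEStronglyMeasurable (ballAvg r w) ((surf d).restrict F)
  integrableOn : ∀ᶠ r in 𝓝[>] (0 : ℝ), ∀ x ∈ F, IntegrableOn w (Metric.ball x r)

lemma HasTrace.ae_eq {F : Set (E d)} {w g g' : E d → ℝ} (h : HasTrace F w g)
    (h' : IsFaceTrace F w g') : g' =ᵐ[(surf d).restrict F] g := by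
  have h0 : eLpNorm (g' - g) 2 ((surf d).restrict F) = 0 := by
    have h1 := h.isFaceTrace.2.add h'.2
    rw [add_zero] at h1
    refine le_antisymm (ge_of_tendsto h1 ?_) zero_le
    filter_upwards [h.meas] with r hr
    change _ ≤ eLpNorm (ballAvg r w - g) 2 _ + eLpNorm (ballAvg r w - g') 2 _
    rw [eLpNorm_sub_comm (ballAvg r w) g', add_comm]
    refine le_trans (le_of_eq ?_) (eLpNorm_add_le (h'.1.1.sub hr) (hr.sub h.isFaceTrace.1.1)
      (by norm_num))
    rw [sub_add_sub_cancel]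
  rw [eLpNorm_eq_zero_iff (h'.1.1.sub h.isFaceTrace.1.1) (by norm_num)] at h0
  filter_upwards [h0] with x hx
  simpa [sub_eq_zero] using hx

lemma HasTrace.faceTrace_ae_eq {F : Set (E d)} {w g : E d → ℝ} (h : HasTrace F w g) :
    faceTrace F w =ᵐ[(surf d).restrict F] g := by
  have hex : ∃ g, IsFaceTrace F w g := ⟨g, h.isFaceTrace⟩
  rw [faceTrace, dif_pos hex]
  exact h.ae_eq hex.choose_spec

lemma HasTrace.zero (F : Set (E d)) : HasTrace F (fun _ => 0) (fun _ => 0) := by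
  refine ⟨⟨MemLp.zero, ?_⟩, ?_, ?_⟩
  · simp
  · refine Eventually.of_forall fun r => ?_
    have : ballAvg r (fun _ : E d => (0 : ℝ)) = fun _ => 0 := by funext x; simp [ballAvg]
    rw [this]; exact aestronglyMeasurable_const
  · exact Eventually.of_forall fun r x _ => integrableOn_zero

lemma HasTrace.const_mul {F : Set (E d)} {w g : E d → ℝ} (h : HasTrace F w g) (c : ℝ) :
    HasTrace F (fun x => c * w x) (fun x => c * g x) := by
  have h0 : ∀ r, ballAvg r (fun x => c * w x) = fun x => c * ballAvg r w x := by
    intro r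
    funext x
    simp only [ballAvg, setAverage_eq, integral_const_mul, smul_eq_mul]
    ring
  refine ⟨⟨h.isFaceTrace.1.const_mul c, ?_⟩, ?_, ?_⟩
  · have h1 := ENNReal.Tendsto.const_mul h.isFaceTrace.2 (Or.inr (enorm_ne_top (x := c)))
    rw [mul_zero] at h1
    refine h1.congr fun r => ?_
    rw [← eLpNorm_const_smul]
    congr 1
    funext x
    have := congrFun (h0 r) x
    simp only [ballAvg] at this
    simp only [Pi.smul_apply, smul_eq_mul, this]
    ring
  · filter_upwards [h.meas] with r hr
    rw [h0]; exact hr.const_mul c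
  · filter_upwards [h.integrableOn] with r hr x hx
    exact (hr x hx).const_mul c

lemma HasTrace.add {F : Set (E d)} (hF : MeasurableSet F) {w g w' g' : E d → ℝ}
    (h : HasTrace F w g) (h' : HasTrace F w' g') :
    HasTrace F (fun x => w x + w' x) (fun x => g x + g' x) := by
  have h0 : ∀ᶠ r in 𝓝[>] (0 : ℝ), ∀ x ∈ F,
      ballAvg r (fun x => w x + w' x) x = ballAvg r w x + ballAvg r w' x := by
    filter_upwards [h.integrableOn, h'.integrableOn] with r hr hr' x hx
    simp only [ballAvg, setAverage_eq]
    rw [integral_add (hr x hx) (hr' x hx), smul_add]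
  refine ⟨⟨h.isFaceTrace.1.add h'.isFaceTrace.1, ?_⟩, ?_, ?_⟩
  · have h1 := h.isFaceTrace.2.add h'.isFaceTrace.2
    rw [add_zero] at h1
    refine tendsto_of_tendsto_of_tendsto_of_le_of_le' tendsto_const_nhds h1
      (Eventually.of_forall fun _ => zero_le) ?_
    filter_upwards [h0, h.meas, h'.meas] with r hr hm hm'
    refine le_trans (le_of_eq ?_) (eLpNorm_add_le (hm.sub h.isFaceTrace.1.1)
      (hm'.sub h'.isFaceTrace.1.1) (by norm_num))
    refine eLpNorm_congr_ae ((ae_restrict_iff' hF).2 (Eventually.of_forall fun x hx => ?_))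
    have := hr x hx
    simp only [Pi.add_apply, ballAvg] at this ⊢
    rw [this]; ring
  · filter_upwards [h0, h.meas, h'.meas] with r hr hm hm'
    refine (hm.add hm').congr ((ae_restrict_iff' hF).2 (Eventually.of_forall fun x hx => ?_))
    exact (hr x hx).symm
  · filter_upwards [h.integrableOn, h'.integrableOn] with r hr hr' x hx
    exact (hr x hx).add (hr' x hx)

lemma HasTrace.sum {F : Set (E d)} (hF : MeasurableSet F) {ι : Type*} (s : Finset ι)
    {w g : ι → E d → ℝ} (h : ∀ k ∈ s, HasTrace F (w k) (g k)) :
    HasTrace F (fun x => ∑ k ∈ s, w k x) (fun x => ∑ k ∈ s, g k x) := by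
  classical
  induction s using Finset.induction_on with
  | empty => simpa using HasTrace.zero F
  | insert a s ha ih =>
    simp only [Finset.sum_insert ha]
    exact (h a (Finset.mem_insert_self a s)).add hF
      (ih fun k hk => h k (Finset.mem_insert_of_mem hk))

/-- The trace depends only on the values near the face. -/
lemma IsFaceTrace.hasTrace_of_eventuallyEq {F : Set (E d)} (hF : IsCompact F) {w W g : E d → ℝ}
    (h : IsFaceTrace F W g) (hW : LocallyIntegrable W) (heq : ∀ᶠ x in 𝓝ˢ F, W x = w x) :
    HasTrace F w g := by
  obtain ⟨U, hU, hFU, hUeq⟩ := eventually_nhdsSet_iff_exists.1 heq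
  obtain ⟨δ, hδ, hδU⟩ := hF.exists_thickening_subset_open hU hFU
  have hball : ∀ r ∈ Ioo 0 δ, ∀ x ∈ F, ∀ y ∈ Metric.ball x r, W y = w y := by
    intro r hr x hx y hy
    exact hUeq y (hδU (Metric.mem_thickening_iff.2 ⟨x, hx, hy.trans hr.2⟩))
  have hsmall : ∀ᶠ r in 𝓝[>] (0 : ℝ), r ∈ Ioo 0 δ := Ioo_mem_nhdsGT hδ
  have havg : ∀ r ∈ Ioo 0 δ, ∀ x ∈ F, ballAvg r W x = ballAvg r w x := by
    intro r hr x hx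
    simp only [ballAvg, setAverage_eq]
    rw [setIntegral_congr_fun Metric.isOpen_ball.measurableSet (hball r hr x hx)]
  have hFm := hF.isClosed.measurableSet
  refine ⟨⟨h.1, ?_⟩, ?_, ?_⟩
  · refine h.2.congr' ?_
    filter_upwards [hsmall] with r hr
    refine eLpNorm_congr_ae ((ae_restrict_iff' hFm).2 (Eventually.of_forall fun x hx => ?_))
    have := havg r hr x hx
    simp only [ballAvg] at this
    simp only [this]
  · filter_upwards [hsmall] with r hr
    refine (stronglyMeasurable_ballAvg_of_aestronglyMeasurable hr.1
      hW.aestronglyMeasurable).aestronglyMeasurable.congr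
      ((ae_restrict_iff' hFm).2 (Eventually.of_forall fun x hx => havg r hr x hx))
  · filter_upwards [hsmall] with r hr x hx
    exact ((hW.integrableOn_isCompact (isCompact_closedBall x r)).mono_set
      Metric.ball_subset_closedBall).congr_fun (hball r hr x hx) Metric.isOpen_ball.measurableSet

namespace Triangulation

variable {Ω : Set (E d)} (T : Triangulation Ω)

/-- Traces of functions of class `H¹_loc` on the faces of a Voronoi cell: existence, the Gauss
formula, and the trace inequality. -/
theorem exists_hasTrace_box {U : Set (E d)} (hU : IsOpen U) {i : E d} (hi : i ∈ T.verts)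
    (hBU : T.box i ⊆ U) {h : ℝ} (hb : T.box i ⊆ Metric.closedBall i h) {w : E d → ℝ}
    {G : E d → E d} (hw : IsLocalH1 U w G) :
    ∃ g : E d → E d → ℝ, (∀ j ∈ T.others i, HasTrace (T.face i j) w (g j)) ∧
      (∀ v, ∫ x in T.box i, inner ℝ (G x) v
        = ∑ j ∈ T.others i, inner ℝ (normal i j) v * ∫ x in T.face i j, g j x ∂(surf d)) ∧
      (volume (T.box i) ≠ 0 → ∑ j ∈ T.others i, ENNReal.ofReal (dist i j / 2) *
        ∫⁻ x in T.face i j, ‖g j x - ⨍ y in T.box i, w y‖ₑ ^ 2 ∂(surf d)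
      ≤ ((d + 1) * 2 ^ (d + 2) + 1) * (ENNReal.ofReal h ^ 2 *
          ∫⁻ x in T.box i, ‖G x‖ₑ ^ 2)) := by
  have hbd : Bornology.IsBounded (T.box i) := Metric.isBounded_closedBall.subset hb
  obtain ⟨χ, hχ, hχc, hχU, hχ1⟩ := exists_cutoff (T.isCompact_box hbd) hU hBU
  have hW := hw.cutoff hχ hχc hχU
  obtain ⟨g, hg1, hg2, hg3⟩ := T.exists_trace_box hi hb hW
  have hm := (T.isClosed_box i).measurableSet
  have hweq : ∀ᶠ x in 𝓝ˢ (T.box i), χ x * w x = w x := by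
    filter_upwards [hχ1] with x hx
    rw [hx, one_mul]
  have hGeq : ∀ x ∈ T.box i, χ x • G x + w x • gradient χ x = G x := by
    intro x hx
    have h1 : χ =ᶠ[𝓝 x] fun _ => 1 := (eventually_nhdsSet_iff_forall.1 hχ1) x hx
    rw [h1.gradient_eq, h1.self_of_nhds]
    simp
  refine ⟨g, fun j hj => (hg1 j hj).hasTrace_of_eventuallyEq (T.isCompact_face j hbd)
    (hW.memLp.locallyIntegrable (by norm_num))
    (hweq.filter_mono (nhdsSet_mono inter_subset_left)), fun v => ?_, fun hB0 => ?_⟩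
  · rw [← hg2 v]
    exact setIntegral_congr_fun hm fun x hx => by simp only [hGeq x hx]
  · have h3 := hg3 hB0
    have e1 : ⨍ y in T.box i, χ y * w y = ⨍ y in T.box i, w y := by
      simp only [setAverage_eq]
      rw [setIntegral_congr_fun hm fun x hx => hweq.self_of_nhdsSet x hx]
    have e2 : ∫⁻ x in T.box i, ‖χ x • G x + w x • gradient χ x‖ₑ ^ 2
        = ∫⁻ x in T.box i, ‖G x‖ₑ ^ 2 :=
      setLIntegral_congr_fun hm fun x hx => by simp only [hGeq x hx]
    rwa [e1, e2] at h3

end Triangulation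

/-! ### Interior regularity for the Laplacian -/

/-- The partial derivative in the `k`-th coordinate direction. -/
def pderiv (k : Fin d) (φ : E d → ℝ) : E d → ℝ :=
  fun x => fderiv ℝ φ x (EuclideanSpace.single k 1)

/-- Test functions on `ℝ^d`. -/
def IsTest (φ : E d → ℝ) : Prop := ContDiff ℝ ∞ φ ∧ HasCompactSupport φ

lemma IsTest.pderiv {φ : E d → ℝ} (h : IsTest φ) (k : Fin d) : IsTest (pderiv k φ) := by
  constructor
  · exact (h.1.fderiv_right (m := ∞) (by simp)).clm_apply contDiff_const
  · exact (h.2.fderiv (𝕜 := ℝ)).comp_left (g := fun L : E d →L[ℝ] ℝ => L _) rfl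

lemma IsTest.integrable_mul {φ ψ : E d → ℝ} (h : IsTest φ) (h' : IsTest ψ) :
    Integrable fun x => φ x * ψ x :=
  (h.1.continuous.mul h'.1.continuous).integrable_of_hasCompactSupport h.2.mul_right

lemma IsTest.sub {φ ψ : E d → ℝ} (h : IsTest φ) (h' : IsTest ψ) : IsTest (φ - ψ) :=
  ⟨h.1.sub h'.1, by
    have := h.2.add (h'.2.comp_left (g := fun t : ℝ => -t) neg_zero)
    convert! this using 1⟩

lemma integral_mul_pderiv {φ ψ : E d → ℝ} (h : IsTest φ) (h' : IsTest ψ) (k : Fin d) :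
    ∫ x, φ x * pderiv k ψ x = - ∫ x, pderiv k φ x * ψ x :=
  integral_mul_fderiv_eq_neg_fderiv_mul_of_integrable ((h.pderiv k).integrable_mul h')
    (h.integrable_mul (h'.pderiv k)) (h.integrable_mul h')
    (fun x _ => h.1.differentiable (by simp) x) (fun x _ => h'.1.differentiable (by simp) x)

lemma pderiv_comm {φ : E d → ℝ} (h : IsTest φ) (k l : Fin d) :
    pderiv k (pderiv l φ) = pderiv l (pderiv k φ) := by
  funext x
  have hd : DifferentiableAt ℝ (fderiv ℝ φ) x :=
    (h.1.fderiv_right (m := ∞) (by simp)).differentiable (by simp) x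
  have h1 : ∀ v w : E d, fderiv ℝ (fun y => fderiv ℝ φ y w) x v = fderiv ℝ (fderiv ℝ φ) x v w := by
    intro v w
    have := (hd.hasFDerivAt).clm_apply (hasFDerivAt_const w x)
    refine (congrArg (fun L : E d →L[ℝ] ℝ => L v) this.fderiv).trans ?_
    simp
  change fderiv ℝ (fun y => fderiv ℝ φ y (EuclideanSpace.single l 1)) x (EuclideanSpace.single k 1)
    = fderiv ℝ (fun y => fderiv ℝ φ y (EuclideanSpace.single k 1)) x (EuclideanSpace.single l 1)
  rw [h1, h1]
  exact (h.1.contDiffAt.isSymmSndFDerivAt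
    (by rw [minSmoothness_of_isRCLikeNormedField]; exact WithTop.coe_le_coe.2 le_top)).eq _ _

lemma integral_pderiv_pderiv_sq {ψ : E d → ℝ} (h : IsTest ψ) (k l : Fin d) :
    ∫ x, pderiv l (pderiv k ψ) x * pderiv l (pderiv k ψ) x
      = ∫ x, pderiv k (pderiv k ψ) x * pderiv l (pderiv l ψ) x := by
  have hk := h.pderiv k
  have hl := h.pderiv l
  have e : pderiv l (pderiv l (pderiv k ψ)) = pderiv k (pderiv l (pderiv l ψ)) := by
    rw [pderiv_comm h l k, pderiv_comm hl l k]
  rw [integral_mul_pderiv (hk.pderiv l) hk l, e]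
  have := integral_mul_pderiv hk (hl.pderiv l) k
  simp only [mul_comm (BoxMethod.pderiv k (BoxMethod.pderiv l (BoxMethod.pderiv l ψ)) _)]
  rw [this, neg_neg]

/-- The Laplacian. -/
def lap (ψ : E d → ℝ) : E d → ℝ := fun x => ∑ k, pderiv k (pderiv k ψ) x

lemma sum_integral_gradient_pderiv_sq {ψ : E d → ℝ} (h : IsTest ψ) :
    ∑ k, ∫ x, ‖gradient (pderiv k ψ) x‖ ^ 2 = ∫ x, lap ψ x ^ 2 := by
  have h1 : ∀ k, ∫ x, ‖gradient (pderiv k ψ) x‖ ^ 2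
      = ∑ l, ∫ x, pderiv k (pderiv k ψ) x * pderiv l (pderiv l ψ) x := by
    intro k
    simp only [← integral_pderiv_pderiv_sq h k]
    rw [← integral_finsetSum _ fun l _ =>
      ((h.pderiv k).pderiv l).integrable_mul ((h.pderiv k).pderiv l)]
    congr 1 with x
    rw [EuclideanSpace.norm_sq_eq]
    refine Finset.sum_congr rfl fun l _ => ?_
    rw [gradient_apply, Real.norm_eq_abs, sq_abs, sq]
    rfl
  simp only [h1]
  have h2 : ∀ x, lap ψ x ^ 2
      = ∑ k, ∑ l, pderiv k (pderiv k ψ) x * pderiv l (pderiv l ψ) x := by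
    intro x
    rw [lap, sq, Finset.sum_mul_sum]
  simp only [h2]
  have hint : ∀ k l, Integrable fun x => pderiv k (pderiv k ψ) x * pderiv l (pderiv l ψ) x :=
    fun k l => ((h.pderiv k).pderiv k).integrable_mul ((h.pderiv l).pderiv l)
  rw [integral_finsetSum _ fun k _ => integrable_finsetSum _ fun l _ => hint k l]
  exact Finset.sum_congr rfl fun k _ => (integral_finsetSum _ fun l _ => hint k l).symm

lemma IsTest.lap {ψ : E d → ℝ} (h : IsTest ψ) :
    Continuous (lap ψ) ∧ HasCompactSupport (lap ψ) := by
  constructor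
  · exact continuous_finsetSum _ fun k _ => ((h.pderiv k).pderiv k).1.continuous
  · refine h.2.mono' fun x hx => ?_
    by_contra hxs
    have : ψ =ᶠ[𝓝 x] fun _ => 0 := notMem_tsupport_iff_eventuallyEq.1 hxs
    refine hx ?_
    simp only [BoxMethod.lap]
    refine Finset.sum_eq_zero fun k _ => ?_
    have h1 : BoxMethod.pderiv k ψ =ᶠ[𝓝 x] fun _ => 0 := by
      filter_upwards [this.fderiv (𝕜 := ℝ)] with y hy
      simp [BoxMethod.pderiv, hy]
    simp [BoxMethod.pderiv, h1.fderiv_eq]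

lemma eLpNorm_gradient_pderiv_le {ψ : E d → ℝ} (h : IsTest ψ) (k : Fin d) :
    eLpNorm (gradient (pderiv k ψ)) 2 volume ≤ eLpNorm (lap ψ) 2 volume := by
  rw [← ENNReal.pow_le_pow_left_iff two_ne_zero, eLpNorm_two_sq, eLpNorm_two_sq]
  have hk := h.pderiv k
  have hk1 : ContDiff ℝ 1 (pderiv k ψ) := hk.1.of_le (by simp)
  have hgc := continuous_gradient hk1
  have hgs : HasCompactSupport (gradient (pderiv k ψ)) :=
    (hk.2.fderiv (𝕜 := ℝ)).comp_left (g := (InnerProductSpace.toDual ℝ (E d)).symm) (map_zero _)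
  have hgs2 : HasCompactSupport fun x => ‖gradient (pderiv k ψ) x‖ ^ 2 :=
    hgs.comp_left (g := fun t : E d => ‖t‖ ^ 2) (by simp)
  have hls2 : HasCompactSupport fun x => lap ψ x ^ 2 :=
    h.lap.2.comp_left (g := fun t : ℝ => t ^ 2) (by simp)
  have e1 : ∫⁻ x, ‖gradient (pderiv k ψ) x‖ₑ ^ 2
      = ENNReal.ofReal (∫ x, ‖gradient (pderiv k ψ) x‖ ^ 2) := by
    have hi : Integrable fun x => ‖gradient (pderiv k ψ) x‖ ^ 2 :=
      (hgc.norm.pow 2).integrable_of_hasCompactSupport hgs2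
    rw [ofReal_integral_eq_lintegral_ofReal hi (Eventually.of_forall fun x => sq_nonneg _)]
    simp only [← enorm_sq_eq_ofReal, enorm_norm]
  have e2 : ∫⁻ x, ‖lap ψ x‖ₑ ^ 2 = ENNReal.ofReal (∫ x, lap ψ x ^ 2) := by
    have hi : Integrable fun x => lap ψ x ^ 2 :=
      (h.lap.1.pow 2).integrable_of_hasCompactSupport hls2
    rw [ofReal_integral_eq_lintegral_ofReal hi (Eventually.of_forall fun x => sq_nonneg _)]
    simp only [← enorm_sq_eq_ofReal]
  rw [e1, e2, ← sum_integral_gradient_pderiv_sq h]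
  exact ENNReal.ofReal_le_ofReal (Finset.single_le_sum
    (f := fun k => ∫ x, ‖gradient (pderiv k ψ) x‖ ^ 2)
    (fun _ _ => integral_nonneg fun x => sq_nonneg _) (Finset.mem_univ k))

lemma tendsto_integral_mul_of_tendsto_eLpNorm {α : Type*} [MeasurableSpace α] {μ : Measure α}
    {f : ℕ → α → ℝ} {g φ : α → ℝ} (hf : ∀ n, MemLp (f n) 2 μ) (hg : MemLp g 2 μ)
    (hφ : MemLp φ 2 μ) (h : Tendsto (fun n => eLpNorm (f n - g) 2 μ) atTop (𝓝 0)) :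
    Tendsto (fun n => ∫ x, f n x * φ x ∂μ) atTop (𝓝 (∫ x, g x * φ x ∂μ)) := by
  refine tendsto_integral_of_L1' _ (hg.1.mul hφ.1)
    (Eventually.of_forall fun n => (hf n).integrable_mul hφ) ?_
  have h1 := ENNReal.Tendsto.mul_const h (Or.inr hφ.2.ne)
  rw [zero_mul] at h1
  refine tendsto_of_tendsto_of_tendsto_of_le_of_le tendsto_const_nhds h1 (fun _ => zero_le)
    fun n => ?_
  refine le_trans (le_of_eq ?_) (eLpNorm_smul_le_mul_eLpNorm (p := 2) (q := 2) (r := 1) hφ.1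
    ((hf n).1.sub hg.1))
  congr 1
  funext x
  simp [sub_mul]

/-- `f` is the weak Laplacian on `ℝ^d` of a function with weak gradient `G`. -/
def IsWeakLap (G : E d → E d) (f : E d → ℝ) : Prop :=
  ∀ φ : E d → ℝ, IsTest φ → ∑ k, ∫ x, G x k * pderiv k φ x = - ∫ x, f x * φ x

lemma lap_moll {w : E d → ℝ} {G : E d → E d} (hw : IsGlobalH1 w G) {f : E d → ℝ}
    (hf : IsWeakLap G f) (n : ℕ) : lap (moll n w) = moll n f := by
  have hwl := hw.memLp.locallyIntegrable (by norm_num)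
  have hGl := hw.memLp_grad.locallyIntegrable (by norm_num)
  have hGk : ∀ k, LocallyIntegrable fun x => G x k := fun k x => by
    obtain ⟨U, hU, h⟩ := hGl x
    exact ⟨U, hU, (EuclideanSpace.proj (𝕜 := ℝ) k : E d →L[ℝ] ℝ).integrable_comp h⟩
  have h1 : ∀ k, pderiv k (moll n w) = moll n fun x => G x k := fun k =>
    funext fun x => fderiv_moll_of_isWeakDeriv hwl (hw.weakDeriv k) n x
  funext x
  simp only [lap, h1, pderiv]
  rw [Finset.sum_congr rfl fun k _ => fderiv_moll (hGk k) n x (EuclideanSpace.single k 1),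
    moll_apply_swap]
  have hk : IsTest fun y => kern d n (x - y) :=
    ⟨(contDiff_kern n).comp (contDiff_const.sub contDiff_id),
      (hasCompactSupport_kern n).comp_homeomorph (Homeomorph.subLeft x)⟩
  have hd : ∀ k y, pderiv k (fun y => kern d n (x - y)) y
      = - fderiv ℝ (kern d n) (x - y) (EuclideanSpace.single k 1) := by
    intro k y
    have h1 : HasFDerivAt (fun y => x - y) (-ContinuousLinearMap.id ℝ (E d)) y :=
      (hasFDerivAt_id y).const_sub x
    have h2 := ((contDiff_kern n).differentiable (by simp) (x - y)).hasFDerivAt.comp y h1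
    refine (congrArg (fun L : E d →L[ℝ] ℝ => L _) h2.fderiv).trans ?_
    simp
  have h2 := hf _ hk
  simp only [hd, mul_neg, integral_neg, Finset.sum_neg_distrib, neg_inj] at h2
  rw [h2]
  congr 1 with y
  simp [mul_comm]

lemma memLp_coord {p : ℝ≥0∞} {μ : Measure (E d)} {G : E d → E d} (h : MemLp G p μ) (k : Fin d) :
    MemLp (fun x => G x k) p μ :=
  (EuclideanSpace.proj (𝕜 := ℝ) k : E d →L[ℝ] ℝ).comp_memLp' h

/-- A compactly supported `H¹` function with Laplacian in `L²` is in `H²`. -/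
lemma IsGlobalH1.exists_hessian {w : E d → ℝ} {G : E d → E d} (hw : IsGlobalH1 w G)
    (hwc : HasCompactSupport w) {f : E d → ℝ} (hf2 : MemLp f 2 volume) (hf : IsWeakLap G f) :
    ∃ H : Fin d → E d → E d, (∀ k, IsGlobalH1 (fun x => G x k) (H k)) ∧
      ∀ᵐ x, ∑ k, H k x k = f x := by
  have hwl := hw.memLp.locallyIntegrable (by norm_num)
  have hfl := hf2.locallyIntegrable (by norm_num)
  have hGk := memLp_coord hw.memLp_grad
  have htest : ∀ n, IsTest (moll n w) := fun n =>
    ⟨BoxMethod.contDiff_moll n hwl, hasCompactSupport_moll n hwc⟩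
  have h1 : ∀ n k, pderiv k (moll n w) = moll n fun x => G x k := fun n k =>
    funext fun x => fderiv_moll_of_isWeakDeriv hwl (hw.weakDeriv k) n x
  have hsubp : ∀ n m k, pderiv k (moll n w - moll m w)
      = pderiv k (moll n w) - pderiv k (moll m w) := by
    intro n m k
    funext x
    simp only [pderiv, Pi.sub_apply]
    rw [fderiv_sub ((htest n).1.differentiable (by simp) x)
      ((htest m).1.differentiable (by simp) x)]
    simp
  have hlap : ∀ n m, lap (moll n w - moll m w) = moll n f - moll m f := by
    intro n m
    rw [← lap_moll hw hf n, ← lap_moll hw hf m]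
    funext x
    simp only [lap, hsubp, Pi.sub_apply, ← Finset.sum_sub_distrib]
    refine Finset.sum_congr rfl fun k _ => ?_
    simp only [pderiv]
    rw [fderiv_sub (((htest n).pderiv k).1.differentiable (by simp) x)
      (((htest m).pderiv k).1.differentiable (by simp) x)]
    rfl
  have hc1 : ∀ n k, ContDiff ℝ 1 (pderiv k (moll n w)) := fun n k =>
    ((htest n).pderiv k).1.of_le (by simp)
  have hgm : ∀ k n, MemLp (gradient (pderiv k (moll n w))) 2 volume := fun k n =>
    (continuous_gradient (hc1 n k)).memLp_of_hasCompactSupport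
      ((((htest n).pderiv k).2.fderiv (𝕜 := ℝ)).comp_left
        (g := (InnerProductSpace.toDual ℝ (E d)).symm) (map_zero _))
  have hex : ∀ k, ∃ H, MemLp H 2 volume ∧
      Tendsto (fun n => eLpNorm (gradient (pderiv k (moll n w)) - H) 2 volume) atTop (𝓝 0) := by
    intro k
    refine exists_limit_eLpNorm (hgm k) (tendsto_eLpNorm_moll hf2) fun n m => ?_
    rw [← gradient_sub (hc1 n k) (hc1 m k), ← hsubp]
    refine (eLpNorm_gradient_pderiv_le ((htest n).sub (htest m)) k).trans ?_
    rw [hlap, eLpNorm_sub_comm (moll m f) f]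
    refine le_trans (le_of_eq ?_) (eLpNorm_add_le
        ((memLp_moll n hf2).1.sub hf2.1) (hf2.1.sub (memLp_moll m hf2).1) (by norm_num))
    rw [sub_add_sub_cancel]
  choose H hH hHlim using hex
  have hglob : ∀ k, IsGlobalH1 (fun x => G x k) (H k) := by
    refine fun k => ⟨hGk k, hH k, fun l φ hφ hφc => ?_⟩
    have hφt : IsTest φ := ⟨hφ, hφc⟩
    have hφ2 : MemLp φ 2 volume := hφ.continuous.memLp_of_hasCompactSupport hφc
    have hφl : MemLp (pderiv l φ) 2 volume :=
      (hφt.pderiv l).1.continuous.memLp_of_hasCompactSupport (hφt.pderiv l).2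
    have t1 := tendsto_integral_mul_of_tendsto_eLpNorm (fun n => memLp_moll n (hGk k)) (hGk k)
      hφl (tendsto_eLpNorm_moll (hGk k))
    have hl : Tendsto (fun n => eLpNorm ((fun x => gradient (pderiv k (moll n w)) x l)
        - fun x => H k x l) 2 volume) atTop (𝓝 0) := by
      refine tendsto_of_tendsto_of_tendsto_of_le_of_le tendsto_const_nhds (hHlim k)
        (fun _ => zero_le) fun n => eLpNorm_mono fun x => ?_
      simpa using PiLp.norm_apply_le (gradient (pderiv k (moll n w)) x - H k x) l
    have t2 := tendsto_integral_mul_of_tendsto_eLpNorm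
      (fun n => memLp_coord (hgm k n) l) (memLp_coord (hH k) l) hφ2 hl
    refine tendsto_nhds_unique t1 (t2.neg.congr fun n => ?_)
    rw [← h1 n k, integral_mul_pderiv ((htest n).pderiv k) hφt l]
    simp only [gradient_apply]
    rfl
  refine ⟨H, hglob, ?_⟩
  have hHl : ∀ k, MemLp (fun x => H k x k) 2 volume := fun k => memLp_coord (hH k) k
  have hsum : MemLp (fun x => ∑ k, H k x k) 2 volume := memLp_finsetSum _ fun k _ => hHl k
  refine ae_eq_of_integral_contDiff_smul_eq (hsum.locallyIntegrable (by norm_num)) hfl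
    fun φ hφ hφc => ?_
  have hφ2 : MemLp φ 2 volume := hφ.continuous.memLp_of_hasCompactSupport hφc
  have h2 := hf φ ⟨hφ, hφc⟩
  have h3 : ∀ k, ∫ x, G x k * pderiv k φ x = - ∫ x, H k x k * φ x := fun k =>
    (hglob k).weakDeriv k φ hφ hφc
  rw [Finset.sum_congr rfl fun k _ => h3 k, Finset.sum_neg_distrib,
    neg_inj, ← integral_finsetSum (f := fun k x => H k x k * φ x) _
      fun k _ => (hHl k).integrable_mul hφ2] at h2
  simp only [smul_eq_mul, mul_comm (φ _), Finset.sum_mul, h2]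

lemma IsGlobalH1.isLocalH1 {U : Set (E d)} (hU : IsOpen U) {w w' : E d → ℝ} {G : E d → E d}
    (h : IsGlobalH1 w G) (heq : EqOn w w' U) : IsLocalH1 U w' G := by
  have hm := hU.measurableSet
  have h2 : MemL2 U w' := by
    refine (memLp_congr_ae ?_).1 (h.memLp.restrict U)
    exact (ae_restrict_iff' hm).2 (Eventually.of_forall heq)
  have hloc : LocallyIntegrableOn w' U := by
    intro x hx
    obtain ⟨V, hV, hVi⟩ := h.memLp.locallyIntegrable (by norm_num) x
    refine ⟨V ∩ U, inter_mem (mem_nhdsWithin_of_mem_nhds hV) self_mem_nhdsWithin, ?_⟩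
    refine IntegrableOn.congr_fun_ae (hVi.mono_set inter_subset_left) ?_
    have : ∀ᵐ x ∂(volume.restrict U), w x = w' x :=
      (ae_restrict_iff' hm).2 (Eventually.of_forall heq)
    exact ae_mono (Measure.restrict_mono inter_subset_right le_rfl) this
  refine ⟨⟨hloc, (h.memLp_grad.locallyIntegrable (by norm_num)).locallyIntegrableOn U,
    fun φ hφ hφc hφU k => ?_⟩, h2.memL2loc, MemL2.memL2loc (h.memLp_grad.restrict U)⟩
  have h3 := h.weakDeriv k φ hφ hφc
  rw [setIntegral_congr_fun hm fun x hx => by rw [← heq hx],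
    setIntegral_eq_integral_of_forall_compl_eq_zero,
    setIntegral_eq_integral_of_forall_compl_eq_zero, h3]
  · intro x hx
    rw [image_eq_zero_of_notMem_tsupport (fun hxs => hx (hφU hxs)), mul_zero]
  · intro x hx
    rw [fderiv_of_notMem_tsupport ℝ (fun hxs => hx (hφU hxs))]
    simp

lemma tsupport_pderiv_subset (φ : E d → ℝ) (k : Fin d) : tsupport (pderiv k φ) ⊆ tsupport φ :=
  tsupport_fderiv_apply_subset ℝ _

lemma pderiv_mul {φ ψ : E d → ℝ} (h : IsTest φ) (h' : IsTest ψ) (k : Fin d) (x : E d) :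
    pderiv k (fun x => φ x * ψ x) x = φ x * pderiv k ψ x + pderiv k φ x * ψ x := by
  have := (h.1.differentiable (by simp) x).hasFDerivAt.mul
    (h'.1.differentiable (by simp) x).hasFDerivAt
  refine (congrArg (fun L : E d →L[ℝ] ℝ => L _) this.fderiv).trans ?_
  simp [pderiv, mul_comm]

/-- Interior regularity: a function of class `H¹_loc` with Laplacian in `L²_loc` is in `H²`
near every compact set. -/
lemma IsLocalH1.exists_hessian {Ω : Set (E d)} {u : E d → ℝ} {G : E d → E d}
    (hu : IsLocalH1 Ω u G) {f : E d → ℝ} (hf : MemL2loc Ω f)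
    (hlap : ∀ φ : E d → ℝ, IsTest φ → tsupport φ ⊆ Ω →
      ∑ k, ∫ x in Ω, G x k * pderiv k φ x = - ∫ x in Ω, f x * φ x)
    (hΩ : IsOpen Ω) {B : Set (E d)} (hB : IsCompact B) (hBΩ : B ⊆ Ω) :
    ∃ U, IsOpen U ∧ B ⊆ U ∧ U ⊆ Ω ∧ ∃ H : Fin d → E d → E d,
      (∀ k, IsLocalH1 U (fun x => G x k) (H k)) ∧
      ∀ᵐ x ∂(volume.restrict U), ∑ k, H k x k = f x := by
  obtain ⟨χ, hχ, hχc, hχΩ, hχ1⟩ := exists_cutoff hB hΩ hBΩ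
  obtain ⟨U, hU, hBU, hU1⟩ := eventually_nhdsSet_iff_exists.1 hχ1
  have hχt : IsTest χ := ⟨hχ, hχc⟩
  have hK : IsCompact (tsupport χ) := hχc
  have hUΩ : U ⊆ Ω := fun x hx => hχΩ (subset_tsupport χ (by simp [hU1 x hx]))
  have hpts : ∀ k, tsupport (pderiv k χ) ⊆ Ω := fun k => (tsupport_pderiv_subset χ k).trans hχΩ
  set Z : Fin d → E d → E d := fun k x =>
    pderiv k χ x • G x + u x • gradient (pderiv k χ) x with hZ
  have hcut : ∀ k, IsGlobalH1 (fun x => pderiv k χ x * u x) (Z k) := fun k =>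
    hu.cutoff (hχt.pderiv k).1 (hχt.pderiv k).2 (hpts k)
  have hW := hu.cutoff hχ hχc hχΩ
  have hGK := memLp_coord (hu.memL2_grad _ hK hχΩ)
  have m1 : MemLp (fun x => χ x * f x) 2 volume :=
    memLp_smul_of_support hK hχ.continuous (subset_tsupport χ) (hf _ hK hχΩ)
  have m2 : ∀ k, MemLp (fun x => pderiv k χ x * G x k) 2 volume := fun k =>
    memLp_smul_of_support hK (hχt.pderiv k).1.continuous
      ((subset_tsupport _).trans (tsupport_pderiv_subset χ k)) (hGK k)
  have m3 : ∀ k, MemLp (fun x => Z k x k) 2 volume := fun k => memLp_coord (hcut k).memLp_grad k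
  have m4 : ∀ k, MemLp (fun x => χ x * G x k) 2 volume := fun k =>
    memLp_smul_of_support hK hχ.continuous (subset_tsupport χ) (hGK k)
  have mF : MemLp (fun x => χ x * f x + ∑ k, (pderiv k χ x * G x k + Z k x k)) 2 volume :=
    m1.add (memLp_finsetSum _ fun k _ => (m2 k).add (m3 k))
  have hF : IsWeakLap (fun x => χ x • G x + u x • gradient χ x)
      fun x => χ x * f x + ∑ k, (pderiv k χ x * G x k + Z k x k) := by
    intro φ hφ
    have hφ2 : MemLp φ 2 volume := hφ.1.continuous.memLp_of_hasCompactSupport hφ.2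
    have hφk : ∀ k, MemLp (pderiv k φ) 2 volume := fun k =>
      (hφ.pderiv k).1.continuous.memLp_of_hasCompactSupport (hφ.pderiv k).2
    have hprod : IsTest fun x => χ x * φ x := ⟨hχ.mul hφ.1, hχc.mul_right⟩
    have hts : tsupport (fun x => χ x * φ x) ⊆ Ω :=
      (closure_mono (Function.support_mul_subset_left χ φ)).trans hχΩ
    have e1 := hlap _ hprod hts
    have i0 : ∀ k, Integrable fun x => χ x * G x k * pderiv k φ x := fun k =>
      (m4 k).integrable_mul (hφk k)
    have i1 : ∀ k, Integrable fun x => pderiv k χ x * G x k * φ x := fun k =>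
      (m2 k).integrable_mul hφ2
    have i2 : ∀ k, Integrable fun x => Z k x k * φ x := fun k => (m3 k).integrable_mul hφ2
    have i3 : ∀ k, Integrable fun x => pderiv k χ x * u x * pderiv k φ x := fun k =>
      (hcut k).memLp.integrable_mul (hφk k)
    have i4 : Integrable fun x => χ x * f x * φ x := m1.integrable_mul hφ2
    have e2 : ∀ k, ∫ x in Ω, G x k * pderiv k (fun x => χ x * φ x) x
        = (∫ x, χ x * G x k * pderiv k φ x) + ∫ x, pderiv k χ x * G x k * φ x := by
      intro k
      rw [setIntegral_eq_integral_of_forall_compl_eq_zero, ← integral_add (i0 k) (i1 k)]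
      · congr 1 with x
        rw [pderiv_mul hχt hφ]
        ring
      · intro x hx
        rw [image_eq_zero_of_notMem_tsupport
          (fun hxs => hx (hts (tsupport_pderiv_subset _ k hxs))), mul_zero]
    have e3 : ∫ x in Ω, f x * (χ x * φ x) = ∫ x, χ x * f x * φ x := by
      rw [setIntegral_eq_integral_of_forall_compl_eq_zero]
      · congr 1 with x
        ring
      · intro x hx
        rw [image_eq_zero_of_notMem_tsupport (fun hxs => hx (hχΩ hxs)), zero_mul, mul_zero]
    have e4 : ∀ k, ∫ x, pderiv k χ x * u x * pderiv k φ x = - ∫ x, Z k x k * φ x := fun k =>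
      (hcut k).weakDeriv k φ hφ.1 hφ.2
    have e5 : ∀ k, ∫ x, (χ x • G x + u x • gradient χ x) k * pderiv k φ x
        = (∫ x, χ x * G x k * pderiv k φ x) + ∫ x, pderiv k χ x * u x * pderiv k φ x := by
      intro k
      rw [← integral_add (i0 k) (i3 k)]
      congr 1 with x
      simp only [PiLp.add_apply, PiLp.smul_apply, smul_eq_mul, gradient_apply, pderiv]
      ring
    have e6 : ∫ x, (χ x * f x + ∑ k, (pderiv k χ x * G x k + Z k x k)) * φ x
        = (∫ x, χ x * f x * φ x)
          + ∑ k, ((∫ x, pderiv k χ x * G x k * φ x) + ∫ x, Z k x k * φ x) := by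
      have : ∀ x, (χ x * f x + ∑ k, (pderiv k χ x * G x k + Z k x k)) * φ x
          = χ x * f x * φ x + ∑ k, (pderiv k χ x * G x k * φ x + Z k x k * φ x) := by
        intro x
        rw [add_mul, Finset.sum_mul]
        simp only [add_mul]
      simp only [this]
      have i5 : ∀ k, Integrable fun x => pderiv k χ x * G x k * φ x + Z k x k * φ x :=
        fun k => (i1 k).add (i2 k)
      rw [integral_add i4 (integrable_finsetSum _ fun k _ => i5 k),
        integral_finsetSum _ fun k _ => i5 k]
      congr 1
      exact Finset.sum_congr rfl fun k _ => integral_add (i1 k) (i2 k)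
    simp only [e2, e3, Finset.sum_add_distrib] at e1
    rw [e6]
    simp only [e5, e4, Finset.sum_add_distrib, Finset.sum_neg_distrib]
    linarith
  obtain ⟨H, hH, hHF⟩ := hW.exists_hessian hχc.mul_right mF hF
  have hχU : ∀ x ∈ U, χ =ᶠ[𝓝 x] fun _ => 1 := fun x hx =>
    Filter.eventually_of_mem (hU.mem_nhds hx) hU1
  have hpU : ∀ x ∈ U, ∀ k, pderiv k χ x = 0 := by
    intro x hx k
    simp [pderiv, (hχU x hx).fderiv_eq]
  refine ⟨U, hU, hBU, hUΩ, H, fun k => (hH k).isLocalH1 hU fun x hx => ?_, ?_⟩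
  · have : gradient χ x = 0 := by rw [(hχU x hx).gradient_eq]; simp
    simp [hU1 x hx, this]
  · refine (ae_restrict_iff' hU.measurableSet).2 ?_
    filter_upwards [hHF] with x hx hxU
    rw [hx, hU1 x hxU, one_mul]
    have : ∀ k, Z k x k = 0 := by
      intro k
      have h0 : pderiv k χ =ᶠ[𝓝 x] fun _ => 0 :=
        Filter.eventually_of_mem (hU.mem_nhds hxU) fun y hy => hpU y hy k
      simp [hZ, hpU x hxU, h0.gradient_eq]
    simp [hpU x hxU, this]

/-! ### Weak gradients of test functions and the momentum equation -/

lemma IsWeakGrad.ae_eq {Ω : Set (E d)} (hΩ : IsOpen Ω) {w : E d → ℝ} {G G' : E d → E d}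
    (h : IsWeakGrad Ω w G) (h' : IsWeakGrad Ω w G') : G =ᵐ[volume.restrict Ω] G' := by
  have hco : ∀ {G : E d → E d}, LocallyIntegrableOn G Ω → ∀ k,
      LocallyIntegrableOn (fun x => G x k) Ω := by
    intro G hG k x hx
    obtain ⟨V, hV, hVi⟩ := hG x hx
    exact ⟨V, hV, (EuclideanSpace.proj (𝕜 := ℝ) k : E d →L[ℝ] ℝ).integrable_comp hVi⟩
  have hk : ∀ k, ∀ᵐ x, x ∈ Ω → G x k - G' x k = 0 := by
    intro k
    refine hΩ.ae_eq_zero_of_integral_contDiff_smul_eq_zero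
      ((hco h.2.1 k).sub (hco h'.2.1 k)) fun φ hφ hφc hφΩ => ?_
    have e := (h.2.2 φ hφ hφc hφΩ k).symm.trans (h'.2.2 φ hφ hφc hφΩ k)
    rw [neg_inj] at e
    have hint : ∀ {G : E d → E d}, LocallyIntegrableOn G Ω → Integrable fun x => φ x * G x k :=
      fun hG => integrable_smul_of_support hφc hφ.continuous (subset_tsupport φ)
        ((hco hG k).integrableOn_compact_subset hφΩ hφc)
    have hset : ∀ G : E d → E d, ∫ x in Ω, G x k * φ x = ∫ x, φ x * G x k := by
      intro G
      rw [setIntegral_eq_integral_of_forall_compl_eq_zero]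
      · simp only [mul_comm]
      · intro x hx
        rw [image_eq_zero_of_notMem_tsupport (fun hxs => hx (hφΩ hxs)), mul_zero]
    rw [hset, hset] at e
    simp only [smul_eq_mul, mul_sub]
    rw [integral_sub (hint h.2.1) (hint h'.2.1), e, sub_self]
  refine (ae_restrict_iff' hΩ.measurableSet).2 ?_
  filter_upwards [ae_all_iff.2 hk] with x hx hxΩ
  ext k
  exact sub_eq_zero.1 (hx k hxΩ)

lemma IsTest.isWeakGrad {φ : E d → ℝ} (h : IsTest φ) (Ω : Set (E d)) :
    IsWeakGrad Ω φ (gradient φ) := by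
  have hc := continuous_gradient (φ := φ) (h.1.of_le (by simp))
  refine ⟨h.1.continuous.locallyIntegrable.locallyIntegrableOn Ω,
    hc.locallyIntegrable.locallyIntegrableOn Ω, fun ψ hψ hψc hψΩ k => ?_⟩
  have e : ∫ x, φ x * BoxMethod.pderiv k ψ x = - ∫ x, BoxMethod.pderiv k φ x * ψ x :=
    integral_mul_pderiv h ⟨hψ, hψc⟩ k
  rw [setIntegral_eq_integral_of_forall_compl_eq_zero,
    setIntegral_eq_integral_of_forall_compl_eq_zero]
  · simp only [gradient_apply]
    exact e
  · intro x hx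
    rw [image_eq_zero_of_notMem_tsupport (fun hxs => hx (hψΩ hxs)), mul_zero]
  · intro x hx
    rw [fderiv_of_notMem_tsupport ℝ (fun hxs => hx (hψΩ hxs))]
    simp

lemma IsTest.weakGrad_ae_eq {φ : E d → ℝ} (h : IsTest φ) {Ω : Set (E d)} (hΩ : IsOpen Ω) :
    weakGrad Ω φ =ᵐ[volume.restrict Ω] gradient φ :=
  (isWeakGrad_weakGrad ⟨_, h.isWeakGrad Ω⟩).ae_eq hΩ (h.isWeakGrad Ω)

lemma IsTest.memH10 {φ : E d → ℝ} (h : IsTest φ) {Ω : Set (E d)} (hΩ : IsOpen Ω)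
    (hs : tsupport φ ⊆ Ω) : MemH10 Ω φ := by
  have hc := continuous_gradient (φ := φ) (h.1.of_le (by simp))
  have hgs : HasCompactSupport (gradient φ) :=
    (h.2.fderiv (𝕜 := ℝ)).comp_left (g := (InnerProductSpace.toDual ℝ (E d)).symm) (map_zero _)
  have hg : MemLp (gradient φ) 2 (volume.restrict Ω) :=
    (hc.memLp_of_hasCompactSupport hgs).restrict Ω
  refine ⟨⟨(h.1.continuous.memLp_of_hasCompactSupport h.2).restrict Ω, ⟨_, h.isWeakGrad Ω⟩,
    (memLp_congr_ae (h.weakGrad_ae_eq hΩ)).2 hg⟩, fun _ => φ, fun _ => ⟨h.1, h.2, hs⟩, ?_, ?_⟩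
  · simp
  · have : eLpNorm (fun x => gradient φ x - weakGrad Ω φ x) 2 (volume.restrict Ω) = 0 := by
      rw [← eLpNorm_zero (ε := E d) (p := 2) (μ := volume.restrict Ω)]
      refine eLpNorm_congr_ae ?_
      filter_upwards [h.weakGrad_ae_eq hΩ] with x hx
      simp [hx]
    simp only [this, tendsto_const_nhds]

/-- The components of the velocity solve a weak Poisson equation. -/
lemma IsStokesSolution.weak_poisson {ν : ℝ} {Ω : Set (E d)} (hΩ : IsOpen Ω)
    {f g u : E d → E d} {p : E d → ℝ} (hf : MemL2 Ω f) (hp : MemH1loc Ω p)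
    (hs : IsStokesSolution ν Ω f g u p) (k : Fin d) {φ : E d → ℝ} (hφ : IsTest φ)
    (hφΩ : tsupport φ ⊆ Ω) :
    ν * ∑ m, ∫ x in Ω, weakGrad Ω (comp u k) x m * pderiv m φ x
      = - ∫ x in Ω, (weakGrad Ω p x k - f x k) * φ x := by
  set v : E d → E d := fun x => EuclideanSpace.single k (φ x) with hv
  have hvk : comp v k = φ := by funext x; simp [comp, hv]
  have hvl : ∀ l, l ≠ k → comp v l = fun _ => 0 := by
    intro l hl; funext x; simp [comp, hv, hl]
  have h0 : IsTest (fun _ : E d => (0 : ℝ)) := ⟨contDiff_const, HasCompactSupport.zero⟩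
  have hvt : ∀ l, IsTest (comp v l) ∧ tsupport (comp v l) ⊆ Ω := by
    intro l
    by_cases hl : l = k
    · subst hl; rw [hvk]; exact ⟨hφ, hφΩ⟩
    · rw [hvl l hl]; exact ⟨h0, by simp [tsupport]⟩
  have hmom := hs.momentum v fun l => (hvt l).1.memH10 hΩ (hvt l).2
  have hgr : ∀ᵐ x ∂(volume.restrict Ω), ∀ l, weakGrad Ω (comp v l) x = gradient (comp v l) x :=
    ae_all_iff.2 fun l => (hvt l).1.weakGrad_ae_eq hΩ
  have hgr0 : ∀ l, l ≠ k → ∀ x, gradient (comp v l) x = 0 := by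
    intro l hl x
    rw [hvl l hl]; simp [gradient]
  have hφ2 : MemLp φ 2 (volume.restrict Ω) :=
    (hφ.1.continuous.memLp_of_hasCompactSupport hφ.2).restrict Ω
  have hφm : ∀ m, MemLp (pderiv m φ) 2 (volume.restrict Ω) := fun m =>
    ((hφ.pderiv m).1.continuous.memLp_of_hasCompactSupport (hφ.pderiv m).2).restrict Ω
  have ea : aForm ν Ω u v = ν * ∑ m, ∫ x in Ω, weakGrad Ω (comp u k) x m * pderiv m φ x := by
    rw [← integral_finsetSum (f := fun m x => weakGrad Ω (comp u k) x m * pderiv m φ x) _ fun m _ =>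
      (memLp_coord (hs.memH1 k).2.2 m).integrable_mul (hφm m), ← integral_const_mul, aForm]
    refine integral_congr_ae ?_
    filter_upwards [hgr] with x hx
    rw [Finset.sum_eq_single k (fun l _ hl => by rw [hx l, hgr0 l hl, inner_zero_right])
      (by simp), hx k, hvk, PiLp.inner_apply]
    simp [gradient_apply, pderiv, mul_comm]
  have eb : bForm Ω v p = - ∫ x in Ω, p x * pderiv k φ x := by
    rw [bForm]
    congr 1
    refine integral_congr_ae ?_
    filter_upwards [hgr] with x hx
    rw [Finset.sum_eq_single k (fun l _ hl => by rw [hx l, hgr0 l hl]; rfl)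
      (by simp), hx k, hvk, gradient_apply, mul_comm]
    rfl
  have ef : l2Inner Ω f v = ∫ x in Ω, f x k * φ x := by
    rw [l2Inner]
    congr 1 with x
    simp [hv, EuclideanSpace.inner_single_right, mul_comm]
  have ep : ∫ x in Ω, p x * pderiv k φ x = - ∫ x in Ω, weakGrad Ω p x k * φ x :=
    hp.isLocalH1.weakGrad.2.2 φ hφ.1 hφ.2 hφΩ k
  have i1 : IntegrableOn (fun x => weakGrad Ω p x k * φ x) Ω := by
    have hpk : IntegrableOn (fun x => weakGrad Ω p x k) (tsupport φ) :=
      (EuclideanSpace.proj (𝕜 := ℝ) k : E d →L[ℝ] ℝ).integrable_comp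
        (MemL2loc.integrableOn hp.2.2 hφ.2 hφΩ)
    have := integrable_smul_of_support hφ.2 hφ.1.continuous (subset_tsupport φ) hpk
    simp only [smul_eq_mul, mul_comm (φ _)] at this
    exact this.integrableOn
  have i2 : IntegrableOn (fun x => f x k * φ x) Ω := (memLp_coord hf k).integrable_mul hφ2
  simp only [sub_mul]
  rw [integral_sub i1 i2]
  rw [ea, eb, ef, ep] at hmom
  linarith

/-! ### The consistency identities on the boxes -/

lemma HasTrace.integrableOn_trace {F : Set (E d)} {w g : E d → ℝ} (h : HasTrace F w g)
    (hF : surf d F < ⊤) : IntegrableOn g F (surf d) := by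
  have : IsFiniteMeasure ((surf d).restrict F) := ⟨by simpa using hF⟩
  exact h.isFaceTrace.1.integrable (by norm_num)

lemma HasTrace.inner_const {F : Set (E d)} (hF : MeasurableSet F) {G : E d → E d}
    {g : Fin d → E d → ℝ} (h : ∀ m, HasTrace F (fun x => G x m) (g m)) (n : E d) :
    HasTrace F (fun x => inner ℝ (G x) n) (fun x => ∑ m, n m * g m x) := by
  have := HasTrace.sum hF Finset.univ (w := fun m x => n m * G x m)
    (g := fun m x => n m * g m x) fun m _ => (h m).const_mul (n m)
  convert! this using 2 with x

namespace Triangulation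

variable {Ω : Set (E d)} (T : Triangulation Ω)

lemma mem_verts_of_mem_intVerts {i : E d} (hi : i ∈ T.intVerts) : i ∈ T.verts := by
  classical
  exact (Finset.mem_filter.1 hi).1

lemma lump_apply_self {F : Type*} [AddCommMonoid F] (v : E d → F) {i : E d}
    (hi : i ∈ T.intVerts) : T.lump v i = v i := by
  classical
  rw [lump, Finset.sum_eq_single i]
  · exact indicator_of_mem (fun j _ => by simp) _
  · intro j _ hji
    refine indicator_of_notMem (fun h => hji ?_) _
    have := h i (T.mem_verts_of_mem_intVerts hi)
    rw [dist_self] at this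
    exact (dist_le_zero.1 this).symm
  · exact fun h => absurd hi h

/-- The flux of the gradient of a function of class `H²` near a box through its boundary. -/
lemma sum_integral_normalDeriv {i : E d} (hi : i ∈ T.verts)
    (hb : Bornology.IsBounded (T.box i)) {U : Set (E d)} (hU : IsOpen U) (hBU : T.box i ⊆ U)
    {q : E d → ℝ} {H : Fin d → E d → E d}
    (hH : ∀ m, IsLocalH1 U (fun x => weakGrad Ω q x m) (H m)) :
    (∀ j ∈ T.others i, IntegrableOn (T.normalDeriv q i j) (T.face i j) (surf d)) ∧
    ∑ j ∈ T.others i, ∫ x in T.face i j, T.normalDeriv q i j x ∂(surf d)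
      = ∫ x in T.box i, ∑ m, H m x m := by
  obtain ⟨h, hh⟩ := hb.subset_closedBall i
  choose g hg1 hg2 _ using fun m => T.exists_hasTrace_box hU hi hBU hh (hH m)
  have hae : ∀ j ∈ T.others i, T.normalDeriv q i j
      =ᵐ[(surf d).restrict (T.face i j)] fun x => ∑ m, normal i j m * g m j x := fun j hj =>
    (HasTrace.inner_const (T.isClosed_face i j).measurableSet (fun m => hg1 m j hj)
      (normal i j)).faceTrace_ae_eq
  have hgi : ∀ m, ∀ j ∈ T.others i, IntegrableOn (g m j) (T.face i j) (surf d) := fun m j hj =>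
    (hg1 m j hj).integrableOn_trace (T.surf_face_lt_top hi hj hb)
  refine ⟨fun j hj => ?_, ?_⟩
  · have : IntegrableOn (fun x => ∑ m, normal i j m * g m j x) (T.face i j) (surf d) :=
      integrable_finsetSum _ fun m _ => (hgi m j hj).const_mul _
    exact this.congr (hae j hj).symm
  · have e1 : ∀ j ∈ T.others i, ∫ x in T.face i j, T.normalDeriv q i j x ∂(surf d)
        = ∑ m, normal i j m * ∫ x in T.face i j, g m j x ∂(surf d) := by
      intro j hj
      rw [integral_congr_ae (hae j hj),
        integral_finsetSum _ fun m _ => (hgi m j hj).const_mul _]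
      simp only [integral_const_mul]
    have hHi : ∀ m, IntegrableOn (fun x => H m x m) (T.box i) := fun m =>
      (EuclideanSpace.proj (𝕜 := ℝ) m : E d →L[ℝ] ℝ).integrable_comp
        ((hH m).memL2_grad.integrableOn (T.isCompact_box hb) hBU)
    rw [Finset.sum_congr rfl e1, Finset.sum_comm, integral_finsetSum _ fun m _ => hHi m]
    refine Finset.sum_congr rfl fun m _ => ?_
    have := hg2 m (EuclideanSpace.single m 1)
    simpa [EuclideanSpace.inner_single_right] using this.symm

/-- The Gauss formula for the trace on the boundary of a box. -/
lemma sum_integral_faceTrace (hΩ : IsOpen Ω) {i : E d} (hi : i ∈ T.verts)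
    (hb : Bornology.IsBounded (T.box i)) (hBΩ : T.box i ⊆ Ω) {q : E d → ℝ} {G : E d → E d}
    (hq : IsLocalH1 Ω q G) :
    (∀ j ∈ T.others i, IntegrableOn (faceTrace (T.face i j) q) (T.face i j) (surf d)) ∧
    ∀ c : E d, ∑ j ∈ T.others i, inner ℝ (normal i j) c *
        ∫ x in T.face i j, faceTrace (T.face i j) q x ∂(surf d)
      = ∫ x in T.box i, inner ℝ (G x) c := by
  obtain ⟨h, hh⟩ := hb.subset_closedBall i
  obtain ⟨g, hg1, hg2, -⟩ := T.exists_hasTrace_box hΩ hi hBΩ hh hq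
  refine ⟨fun j hj => ((hg1 j hj).integrableOn_trace (T.surf_face_lt_top hi hj hb)).congr
    (hg1 j hj).faceTrace_ae_eq.symm, fun c => ?_⟩
  rw [hg2 c]
  exact Finset.sum_congr rfl fun j hj => by rw [integral_congr_ae (hg1 j hj).faceTrace_ae_eq]

variable {ν : ℝ} {f g u : E d → E d} {p : E d → ℝ}

lemma sum_integral_viscous (hν : 0 < ν) (hΩ : IsOpen Ω) (hf : MemL2 Ω f) (hp : MemH1loc Ω p)
    (hs : IsStokesSolution ν Ω f g u p) {i : E d} (hi : i ∈ T.verts)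
    (hb : Bornology.IsBounded (T.box i)) (hBΩ : T.box i ⊆ Ω) (c : E d) :
    ∑ j ∈ T.others i, ∫ x in T.face i j, ν * ∑ k, T.normalDeriv (comp u k) i j x * c k ∂(surf d)
      = ∫ x in T.box i, inner ℝ (weakGrad Ω p x - f x) c := by
  have hB := T.isCompact_box hb
  have hloc : ∀ k, MemL2loc Ω fun x => ν⁻¹ * (weakGrad Ω p x k - f x k) := fun k K hK hKΩ =>
    ((memLp_coord (hp.2.2 K hK hKΩ) k).sub
      (memLp_coord (hf.memL2loc K hK hKΩ) k)).const_mul ν⁻¹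
  have hlap : ∀ k (φ : E d → ℝ), IsTest φ → tsupport φ ⊆ Ω →
      ∑ m, ∫ x in Ω, weakGrad Ω (comp u k) x m * pderiv m φ x
        = - ∫ x in Ω, ν⁻¹ * (weakGrad Ω p x k - f x k) * φ x := by
    intro k φ hφ hφΩ
    have := hs.weak_poisson hΩ hf hp k hφ hφΩ
    simp only [mul_assoc]
    rw [integral_const_mul, ← mul_neg, ← this, inv_mul_cancel_left₀ hν.ne']
  choose U hU hBU _ H hH hHf using fun k =>
    (hs.memH1 k).isLocalH1.exists_hessian (hloc k) (hlap k) hΩ hB hBΩ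
  have hnd := fun k => T.sum_integral_normalDeriv hi hb (hU k) (hBU k) (hH k)
  have e1 : ∀ j ∈ T.others i,
      ∫ x in T.face i j, ν * ∑ k, T.normalDeriv (comp u k) i j x * c k ∂(surf d)
      = ∑ k, ν * (∫ x in T.face i j, T.normalDeriv (comp u k) i j x ∂(surf d)) * c k := by
    intro j hj
    rw [integral_const_mul, integral_finsetSum _ fun k _ => ((hnd k).1 j hj).mul_const _,
      Finset.mul_sum]
    simp only [integral_mul_const, mul_assoc]
  have hi1 : IntegrableOn (weakGrad Ω p) (T.box i) := hp.2.2.integrableOn hB hBΩ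
  have hi2 : IntegrableOn f (T.box i) := hf.memL2loc.integrableOn hB hBΩ
  have e2 : ∀ k, ν * (∑ j ∈ T.others i,
        ∫ x in T.face i j, T.normalDeriv (comp u k) i j x ∂(surf d))
      = ∫ x in T.box i, (weakGrad Ω p x - f x) k := by
    intro k
    rw [(hnd k).2, ← integral_const_mul]
    refine integral_congr_ae ?_
    filter_upwards [ae_restrict_of_ae_restrict_of_subset (hBU k) (hHf k)] with x hx
    rw [hx, mul_inv_cancel_left₀ hν.ne']
    rfl
  have hik : ∀ k, IntegrableOn (fun x => (weakGrad Ω p x - f x) k) (T.box i) := fun k =>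
    (EuclideanSpace.proj (𝕜 := ℝ) k : E d →L[ℝ] ℝ).integrable_comp (hi1.sub hi2)
  rw [Finset.sum_congr rfl e1, Finset.sum_comm]
  simp only [← Finset.sum_mul, ← Finset.mul_sum, e2, PiLp.inner_apply]
  rw [integral_finsetSum _ fun k _ => (hik k).inner_const (𝕜 := ℝ) (c k)]
  refine Finset.sum_congr rfl fun k _ => ?_
  rw [← integral_mul_const]
  congr 1 with x
  simp [mul_comm]

/-- The exact solution satisfies the momentum equations of the auxiliary box method. -/
lemma aB_add_bB (hν : 0 < ν) (hΩ : IsOpen Ω) (hΩb : Bornology.IsBounded Ω) (hf : MemL2 Ω f)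
    (hp : MemH1loc Ω p) (hs : IsStokesSolution ν Ω f g u p)
    (hB : ∀ i ∈ T.intVerts, T.box i ⊆ Ω) (v : E d → E d) :
    T.aB ν u (T.lump v) + T.bB (T.lump v) p = l2Inner Ω f (T.lump v) := by
  classical
  have e1 : T.aB ν u (T.lump v)
      = - ∑ i ∈ T.intVerts, ∫ x in T.box i, inner ℝ (weakGrad Ω p x - f x) (v i) := by
    rw [aB]
    congr 1
    refine Finset.sum_congr rfl fun i hi => ?_
    rw [T.lump_apply_self v hi]
    exact T.sum_integral_viscous hν hΩ hf hp hs (T.mem_verts_of_mem_intVerts hi)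
      (hΩb.subset (hB i hi)) (hB i hi) (v i)
  have e2 : T.bB (T.lump v) p
      = ∑ i ∈ T.intVerts, ∫ x in T.box i, inner ℝ (weakGrad Ω p x) (v i) := by
    rw [bB]
    refine Finset.sum_congr rfl fun i hi => ?_
    rw [T.lump_apply_self v hi, ← (T.sum_integral_faceTrace hΩ (T.mem_verts_of_mem_intVerts hi)
      (hΩb.subset (hB i hi)) (hB i hi) hp.isLocalH1).2 (v i)]
    refine Finset.sum_congr rfl fun j _ => ?_
    rw [integral_mul_const, mul_comm]
  have hfi : ∀ i ∈ T.intVerts, IntegrableOn (fun x => inner ℝ (f x) (v i)) (T.box i) :=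
    fun i hi => (hf.memL2loc.integrableOn (T.isCompact_box (hΩb.subset (hB i hi)))
      (hB i hi)).inner_const (v i)
  have e3 : l2Inner Ω f (T.lump v) = ∑ i ∈ T.intVerts, ∫ x in T.box i, inner ℝ (f x) (v i) := by
    have h1 : ∀ x, inner ℝ (f x) (T.lump v x)
        = ∑ i ∈ T.intVerts, (T.box i).indicator (fun x => inner ℝ (f x) (v i)) x := by
      intro x
      rw [lump, inner_sum]
      refine Finset.sum_congr rfl fun i _ => ?_
      by_cases hx : x ∈ T.box i <;> simp [hx]
    simp only [l2Inner, h1]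
    have hm := fun i => (T.isClosed_box i).measurableSet
    rw [integral_finsetSum _ fun i hi => (((integrable_indicator_iff (hm i)).2
      (hfi i hi)).integrableOn (s := Ω))]
    refine Finset.sum_congr rfl fun i hi => ?_
    rw [setIntegral_indicator (hm i), inter_eq_right.2 (hB i hi)]
  rw [e1, e2, e3, ← Finset.sum_neg_distrib, ← Finset.sum_add_distrib]
  refine Finset.sum_congr rfl fun i hi => ?_
  have hpi : IntegrableOn (fun x => inner ℝ (weakGrad Ω p x) (v i)) (T.box i) :=
    (hp.2.2.integrableOn (T.isCompact_box (hΩb.subset (hB i hi))) (hB i hi)).inner_const (v i)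
  simp only [inner_sub_left]
  rw [integral_sub hpi (hfi i hi)]
  ring

/-- The exact solution satisfies the mass equations of the auxiliary box method. -/
lemma cB_eq_zero (hΩ : IsOpen Ω) (hΩb : Bornology.IsBounded Ω)
    (hs : IsStokesSolution ν Ω f g u p) (hB : ∀ i ∈ T.intVerts, T.box i ⊆ Ω) (w : E d → ℝ) :
    T.cB u w = 0 := by
  classical
  rw [cB]
  refine Finset.sum_eq_zero fun i hi => ?_
  have hiv := T.mem_verts_of_mem_intVerts hi
  have hb := hΩb.subset (hB i hi)
  have hm := (T.isClosed_box i).measurableSet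
  have htr := fun k => T.sum_integral_faceTrace hΩ hiv hb (hB i hi) (hs.memH1 k).isLocalH1
  have hGi : ∀ k, IntegrableOn (fun x => weakGrad Ω (comp u k) x k) (T.box i) := fun k =>
    (EuclideanSpace.proj (𝕜 := ℝ) k : E d →L[ℝ] ℝ).integrable_comp
      ((hs.memH1 k).isLocalH1.memL2_grad.integrableOn (T.isCompact_box hb) (hB i hi))
  have h0 := hs.incompressible ((T.box i).indicator fun _ => 1)
    ((memLp_indicator_const 2 hm 1 (Or.inr (T.isCompact_box hb).measure_lt_top.ne)).restrict Ω)
  have e1 : ∫ x in T.box i, ∑ k, weakGrad Ω (comp u k) x k = 0 := by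
    rw [bForm, neg_eq_zero] at h0
    have := setIntegral_indicator (μ := volume) (s := Ω) hm
      (f := fun x => ∑ k, weakGrad Ω (comp u k) x k)
    rw [inter_eq_right.2 (hB i hi)] at this
    rw [← h0, ← this]
    congr 1 with x
    by_cases hx : x ∈ T.box i <;> simp [hx]
  have e2 : ∀ j ∈ T.others i, ∫ x in T.face i j,
      (∑ k, normal i j k * faceTrace (T.face i j) (comp u k) x) * w i ∂(surf d)
      = (∑ k, normal i j k * ∫ x in T.face i j, faceTrace (T.face i j) (comp u k) x ∂(surf d))
        * w i := by
    intro j hj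
    rw [integral_mul_const, integral_finsetSum _ fun k _ => ((htr k).1 j hj).const_mul _]
    simp only [integral_const_mul]
  rw [Finset.sum_congr rfl e2, ← Finset.sum_mul, Finset.sum_comm]
  have e3 : ∀ k, ∑ j ∈ T.others i, normal i j k *
        ∫ x in T.face i j, faceTrace (T.face i j) (comp u k) x ∂(surf d)
      = ∫ x in T.box i, weakGrad Ω (comp u k) x k := by
    intro k
    have := (htr k).2 (EuclideanSpace.single k 1)
    simpa [EuclideanSpace.inner_single_right] using this
  simp only [e3]
  rw [← integral_finsetSum _ fun k _ => hGi k, e1, zero_mul]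

/-- The consistency error reduces to the stabilization of the exact pressure. -/
theorem CB_sub_CBt (hν : 0 < ν) (hΩ : IsOpen Ω) (hΩb : Bornology.IsBounded Ω) (hf : MemL2 Ω f)
    (hp : MemH1loc Ω p) (hs : IsStokesSolution ν Ω f g u p)
    (hB : ∀ i ∈ T.intVerts, T.box i ⊆ Ω) {gh uB : E d → E d} {pB : E d → ℝ}
    (hbox : T.IsBoxSolution ν f gh uB pB) {vh : E d → E d} {qh : E d → ℝ} (hv : T.MemVhV vh)
    (hq : T.MemVh qh) :
    T.CB ν u p (T.lump vh) (T.lump qh) - T.CBt ν uB pB (T.lump vh) (T.lump qh)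
      = T.sB ν p (T.lump qh) := by
  have h1 := T.aB_add_bB hν hΩ hΩb hf hp hs hB vh
  have h2 := T.cB_eq_zero hΩ hΩb hs hB (T.lump qh)
  have h3 := hbox.momentum vh hv
  have h4 := hbox.mass qh hq
  rw [CB, CBt]
  linarith

end Triangulation

namespace Triangulation

variable {Ω : Set (E d)} (T : Triangulation Ω)

/-! ### Geometry of regular meshes -/

lemma face_comm (i j : E d) : T.face i j = T.face j i := inter_comm _ _

lemma faceArea_comm (i j : E d) : T.faceArea i j = T.faceArea j i := by
  rw [faceArea, face_comm, faceArea]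

lemma mem_nbrs {i j : E d} :
    j ∈ T.nbrs i ↔ j ∈ T.intVerts ∧ j ≠ i ∧ surf d (T.face i j) ≠ 0 := by
  classical
  simp [nbrs]

lemma mem_nbrs_comm {i j : E d} :
    i ∈ T.intVerts ∧ j ∈ T.nbrs i ↔ i ∈ T.nbrs j ∧ j ∈ T.intVerts := by
  simp only [mem_nbrs, T.face_comm i j, ne_comm (a := j)]
  tauto

lemma mem_others_of_mem_nbrs {i j : E d} (hj : j ∈ T.nbrs i) : j ∈ T.others i := by
  obtain ⟨h1, h2, -⟩ := T.mem_nbrs.1 hj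
  exact T.mem_others.2 ⟨h2.symm, T.mem_verts_of_mem_intVerts h1⟩

lemma sum_nbrs_comm (Φ : E d → E d → ℝ) :
    ∑ i ∈ T.intVerts, ∑ j ∈ T.nbrs i, Φ i j = ∑ i ∈ T.intVerts, ∑ j ∈ T.nbrs i, Φ j i :=
  Finset.sum_comm' fun _ _ => T.mem_nbrs_comm

lemma exists_elem_of_mem {x : E d} (hx : x ∈ closure Ω) : ∃ s ∈ T.elems, x ∈ cellOf s := by
  classical
  rw [← T.space_eq, Geometry.SimplicialComplex.mem_space_iff] at hx
  obtain ⟨s, hs, hxs⟩ := hx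
  obtain ⟨t, ht, hst, hc⟩ := T.pure s hs
  exact ⟨t, by simp [elems, ht, hc], convexHull_mono (by exact_mod_cast hst) hxs⟩

lemma mem_complex_of_mem_elems {s : Finset (E d)} (hs : s ∈ T.elems) : s ∈ T.complex.faces := by
  classical
  simpa using (Finset.mem_filter.1 hs).1

lemma mem_verts_of_mem_elem {s : Finset (E d)} (hs : s ∈ T.elems) {j : E d} (hj : j ∈ s) :
    j ∈ T.verts := by
  classical
  simp only [verts, Finset.mem_biUnion, Set.Finite.mem_toFinset, id]
  exact ⟨s, T.mem_complex_of_mem_elems hs, hj⟩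

lemma cellOf_subset {s : Finset (E d)} (hs : s ∈ T.elems) : cellOf s ⊆ closure Ω := by
  rw [← T.space_eq]
  exact T.complex.convexHull_subset_space (T.mem_complex_of_mem_elems hs)

lemma isBounded_cellOf (s : Finset (E d)) : Bornology.IsBounded (cellOf s) :=
  isBounded_convexHull.2 s.finite_toSet.isBounded

lemma hElem_le_h {s : Finset (E d)} (hs : s ∈ T.elems) : hElem s ≤ T.h :=
  le_csSup (T.elems.finite_toSet.image _).bddAbove (mem_image_of_mem _ hs)

lemma hElem_nonneg (s : Finset (E d)) : 0 ≤ hElem s := Metric.diam_nonneg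

lemma h_nonneg : 0 ≤ T.h :=
  Real.sSup_nonneg (by rintro _ ⟨s, -, rfl⟩; exact hElem_nonneg s)

lemma h_le_diam (hb : Bornology.IsBounded Ω) : T.h ≤ Metric.diam Ω := by
  refine Real.sSup_le ?_ Metric.diam_nonneg
  rintro _ ⟨s, hs, rfl⟩
  rw [← Metric.diam_closure]
  exact Metric.diam_mono (T.cellOf_subset hs) hb.closure

lemma box_subset_closedBall {i : E d} (hB : T.box i ⊆ Ω) :
    T.box i ⊆ Metric.closedBall i T.h := by
  intro x hx
  obtain ⟨s, hs, hxs⟩ := T.exists_elem_of_mem (subset_closure (hB hx))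
  have hne : s.Nonempty := T.complex.nonempty_of_mem_faces (T.mem_complex_of_mem_elems hs)
  obtain ⟨j, hj⟩ := hne
  refine (hx j (T.mem_verts_of_mem_elem hs hj)).trans (le_trans ?_ (T.hElem_le_h hs))
  exact Metric.dist_le_diam_of_mem (isBounded_cellOf s) hxs (subset_convexHull ℝ _ hj)

lemma nonempty_face {i j : E d} (hj : j ∈ T.nbrs i) : (T.face i j).Nonempty :=
  nonempty_of_measure_ne_zero (T.mem_nbrs.1 hj).2.2

lemma weight_nonneg (i j : E d) : 0 ≤ T.weight i j :=
  div_nonneg Metric.infDist_nonneg dist_nonneg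

lemma weight_le {i j : E d} (hi : i ∈ T.intVerts) (hB : T.box i ⊆ Ω) (hj : j ∈ T.nbrs i) :
    T.weight i j ≤ T.h / dist i j := by
  obtain ⟨x, hx⟩ := T.nonempty_face hj
  refine div_le_div_of_nonneg_right ?_ dist_nonneg
  refine (Metric.infDist_le_dist_of_mem (subset_affineSpan ℝ _ hx)).trans ?_
  rw [dist_comm]
  exact (hx.2 i (T.mem_verts_of_mem_intVerts hi)).trans (T.box_subset_closedBall hB hx.1)

lemma boxVol_nonneg (i : E d) : 0 ≤ T.boxVol i := measureReal_nonneg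

lemma faceArea_nonneg (i j : E d) : 0 ≤ T.faceArea i j := measureReal_nonneg

lemma sum_dist_mul_faceArea {i : E d} (hi : i ∈ T.verts) (hb : Bornology.IsBounded (T.box i)) :
    ∑ j ∈ T.others i, dist i j / 2 * T.faceArea i j = d * T.boxVol i := by
  have := T.sum_integral_face_eq hi hb (φ := fun _ => 1) contDiff_const
  simpa [faceArea, boxVol, mul_comm, Measure.real] using this

lemma volume_box_inter_box {i j : E d} (hi : i ∈ T.verts) (hj : j ∈ T.verts) (hij : i ≠ j) :
    volume (T.box i ∩ T.box j) = 0 := by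
  refine measure_mono_null (T.face_subset_hyperplane hi (T.mem_others.2 ⟨hij, hj⟩))
    (volume_hyperplane ?_ _ _)
  rw [← norm_ne_zero_iff, norm_normal hij]
  exact one_ne_zero

lemma pairwise_aedisjoint_box :
    Set.Pairwise (T.intVerts : Set (E d)) (Function.onFun (AEDisjoint volume) T.box) :=
  fun _ hi _ hj hij => T.volume_box_inter_box (T.mem_verts_of_mem_intVerts hi)
    (T.mem_verts_of_mem_intVerts hj) hij

lemma sum_setLIntegral_box_le (hB : ∀ i ∈ T.intVerts, T.box i ⊆ Ω) (φ : E d → ℝ≥0∞) :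
    ∑ i ∈ T.intVerts, ∫⁻ x in T.box i, φ x ≤ ∑ s ∈ T.elems, ∫⁻ x in cellOf s, φ x := by
  classical
  rw [← lintegral_biUnion_finset₀ T.pairwise_aedisjoint_box
    fun i _ => (T.isClosed_box i).measurableSet.nullMeasurableSet]
  have hsub : (⋃ i ∈ T.intVerts, T.box i) ⊆ ⋃ s : T.elems, cellOf (s : Finset (E d)) := by
    intro x hx
    simp only [mem_iUnion] at hx ⊢
    obtain ⟨i, hi, hx⟩ := hx
    obtain ⟨s, hs, hxs⟩ := T.exists_elem_of_mem (subset_closure (hB i hi hx))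
    exact ⟨⟨s, hs⟩, hxs⟩
  refine (lintegral_mono_set hsub).trans ((lintegral_iUnion_le _ _).trans_eq ?_)
  rw [tsum_fintype, Finset.sum_coe_sort T.elems fun s => ∫⁻ x in cellOf s, φ x]

lemma l2Norm_lump_sq (hΩb : Bornology.IsBounded Ω) (hB : ∀ i ∈ T.intVerts, T.box i ⊆ Ω)
    (q : E d → ℝ) :
    l2Norm Ω (T.lump q) ^ 2 = ∑ i ∈ T.intVerts, T.boxVol i * q i ^ 2 := by
  classical
  have hm := fun i => (T.isClosed_box i).measurableSet
  have hae : ∀ᵐ x, ∀ i ∈ T.intVerts, ∀ j ∈ T.intVerts, i ≠ j → ¬ (x ∈ T.box i ∩ T.box j) := by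
    refine (ae_ball_iff T.intVerts.countable_toSet).2 fun i hi => ?_
    refine (ae_ball_iff T.intVerts.countable_toSet).2 fun j hj => ?_
    by_cases hij : i = j
    · exact Eventually.of_forall fun x h => absurd hij h
    · have := T.pairwise_aedisjoint_box hi hj hij
      filter_upwards [measure_eq_zero_iff_ae_notMem.1 this] with x hx _
      exact hx
  rw [l2Norm, Real.sq_sqrt (integral_nonneg fun x => by positivity)]
  have e1 : ∫ x in Ω, ‖T.lump q x‖ ^ 2
      = ∫ x in Ω, ∑ i ∈ T.intVerts, (T.box i).indicator (fun _ => q i ^ 2) x := by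
    refine integral_congr_ae (ae_restrict_of_ae ?_)
    filter_upwards [hae] with x hx
    simp only [lump, Real.norm_eq_abs, sq_abs]
    by_cases h : ∃ i ∈ T.intVerts, x ∈ T.box i
    · obtain ⟨i, hi, hxi⟩ := h
      have h0 : ∀ j ∈ T.intVerts, j ≠ i → x ∉ T.box j := fun j hj hji hxj =>
        hx i hi j hj hji.symm ⟨hxi, hxj⟩
      rw [Finset.sum_eq_single i (fun j hj hji => indicator_of_notMem (h0 j hj hji) _)
        (fun h => absurd hi h),
        Finset.sum_eq_single i (fun j hj hji => indicator_of_notMem (h0 j hj hji) _)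
        (fun h => absurd hi h), indicator_of_mem hxi, indicator_of_mem hxi]
    · push Not at h
      rw [Finset.sum_eq_zero fun i hi => indicator_of_notMem (h i hi) _,
        Finset.sum_eq_zero fun i hi => indicator_of_notMem (h i hi) _]
      simp
  have hi1 : ∀ i ∈ T.intVerts,
      Integrable ((T.box i).indicator fun _ => q i ^ 2) (volume.restrict Ω) := fun i hi =>
    ((integrable_indicator_iff (hm i)).2 (integrableOn_const (T.isCompact_box
      (hΩb.subset (hB i hi))).measure_lt_top.ne)).restrict
  rw [e1, integral_finsetSum _ hi1]
  refine Finset.sum_congr rfl fun i hi => ?_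
  rw [setIntegral_indicator (hm i), inter_eq_right.2 (hB i hi)]
  simp [boxVol]

lemma IsRegular.h_pos {T : Triangulation Ω} {γ δ κ : ℝ} (hT : T.IsRegular γ δ κ) (hκ : 0 < κ)
    {i j : E d} (hi : i ∈ T.intVerts) (hj : j ∈ T.nbrs i) : 0 < T.h := by
  obtain ⟨s, hs, -, -, h1, -⟩ := hT.face_size i hi j hj
  have h0 : 0 < dist i j := dist_pos.2 (T.mem_nbrs.1 hj).2.1.symm
  by_contra hle
  have := mul_nonpos_of_nonneg_of_nonpos hκ.le ((T.hElem_le_h hs).trans (not_lt.1 hle))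
  linarith

lemma IsRegular.le_dist {T : Triangulation Ω} {γ δ κ : ℝ} (hT : T.IsRegular γ δ κ) (hκ : 0 < κ)
    {i j : E d} (hi : i ∈ T.intVerts) (hj : j ∈ T.nbrs i) : κ⁻¹ * (δ * T.h) ≤ dist i j := by
  obtain ⟨s, hs, -, h1, -⟩ := hT.face_size i hi j hj
  exact (mul_le_mul_of_nonneg_left (hT.quasiUniform s hs) (by positivity)).trans h1

lemma IsRegular.weight_le {T : Triangulation Ω} {γ δ κ : ℝ} (hT : T.IsRegular γ δ κ)
    (hδ : 0 < δ) (hκ : 0 < κ) {i j : E d} (hi : i ∈ T.intVerts) (hj : j ∈ T.nbrs i) :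
    T.weight i j ≤ κ / δ := by
  have hh := hT.h_pos hκ hi hj
  refine (T.weight_le hi (hT.box_subset i hi) hj).trans ?_
  refine (div_le_div_of_nonneg_left hh.le (by positivity) (hT.le_dist hκ hi hj)).trans_eq ?_
  field_simp

lemma IsRegular.boxVol_le {T : Triangulation Ω} {γ δ κ : ℝ} (hT : T.IsRegular γ δ κ)
    (hκ : 0 < κ) {i : E d} (hi : i ∈ T.intVerts) : T.boxVol i ≤ κ * T.h ^ d := by
  obtain ⟨s, hs, -, -, h1⟩ := hT.box_size i hi
  refine h1.trans (mul_le_mul_of_nonneg_left ?_ hκ.le)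
  exact pow_le_pow_left₀ (hElem_nonneg s) (T.hElem_le_h hs) d

lemma IsRegular.le_diag {T : Triangulation Ω} {γ δ κ ν : ℝ} (hT : T.IsRegular γ δ κ) (hd : 2 ≤ d)
    (hν : 0 < ν) (hδ : 0 < δ) (hκ : 0 < κ) {i j : E d} (hi : i ∈ T.intVerts)
    (hj : j ∈ T.nbrs i) : ν * (κ⁻¹ ^ 2 * (δ * T.h) ^ (d - 2)) ≤ T.diag ν i := by
  have hh := hT.h_pos hκ hi hj
  have h0 : 0 < dist i j := dist_pos.2 (T.mem_nbrs.1 hj).2.1.symm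
  obtain ⟨s, hs, -, -, h2, h3, -⟩ := hT.face_size i hi j hj
  have hq := hT.quasiUniform s hs
  have hs0 : 0 < hElem s := lt_of_lt_of_le (by positivity) hq
  have h4 : κ⁻¹ ^ 2 * (δ * T.h) ^ (d - 2) ≤ T.faceArea i j / dist i j := by
    rw [le_div_iff₀ h0]
    refine le_trans ?_ h3
    calc κ⁻¹ ^ 2 * (δ * T.h) ^ (d - 2) * dist i j
        ≤ κ⁻¹ ^ 2 * hElem s ^ (d - 2) * (κ * hElem s) := by gcongr
      _ = κ⁻¹ * hElem s ^ (d - 2 + 1) := by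
          rw [pow_succ (hElem s)]; field_simp
      _ = κ⁻¹ * hElem s ^ (d - 1) := by congr 2; omega
  refine (mul_le_mul_of_nonneg_left h4 hν.le).trans ?_
  refine Finset.single_le_sum (f := fun j => ν * (T.faceArea i j / dist i j)) (fun j _ => ?_) hj
  have := T.faceArea_nonneg i j
  positivity

end Triangulation

/-! ### The deviation of the flux from the flux of the mean gradient -/

lemma sq_setIntegral_le {α : Type*} [MeasurableSpace α] {μ : Measure α} {F : Set α}
    (hF : μ F < ⊤) {φ : α → ℝ} (h : MemLp φ 2 (μ.restrict F)) :
    (∫ x in F, φ x ∂μ) ^ 2 ≤ μ.real F * ∫ x in F, φ x ^ 2 ∂μ := by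
  have : IsFiniteMeasure (μ.restrict F) := ⟨by simpa using hF⟩
  have h1 : IntegrableOn φ F μ := h.integrable (by norm_num)
  have h2 : IntegrableOn (fun x => φ x ^ 2) F μ := h.integrable_sq
  rcases eq_or_ne (μ F) 0 with h0 | h0
  · simp [Measure.restrict_eq_zero.2 h0]
  have hA : 0 < μ.real F := ENNReal.toReal_pos h0 hF.ne
  set A := μ.real F
  set I := ∫ x in F, φ x ∂μ
  have e : ∫ x in F, (φ x - I / A) ^ 2 ∂μ = (∫ x in F, φ x ^ 2 ∂μ) - I ^ 2 / A := by
    have : ∀ x, (φ x - I / A) ^ 2 = φ x ^ 2 - 2 * (I / A) * φ x + (I / A) ^ 2 := fun x => by ring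
    simp only [this]
    have h3 : IntegrableOn (fun x => φ x ^ 2 - 2 * (I / A) * φ x) F μ := h2.sub (h1.const_mul _)
    rw [integral_add h3 (integrable_const _), integral_sub h2 (h1.const_mul _),
      integral_const_mul]
    simp only [integral_const, smul_eq_mul, measureReal_restrict_apply_univ]
    change _ - 2 * (I / A) * I + A * (I / A) ^ 2 = _
    field_simp
    ring
  have h3 : 0 ≤ ∫ x in F, (φ x - I / A) ^ 2 ∂μ := integral_nonneg fun x => sq_nonneg _
  rw [e, sub_nonneg, div_le_iff₀ hA] at h3
  linarith

namespace Triangulation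

variable {Ω : Set (E d)} (T : Triangulation Ω)

/-- On every face of a box, the flux of the gradient differs from the flux of its mean value on
the box by a quantity that the second derivatives control. -/
lemma exists_flux_deviation (hΩ : IsOpen Ω) {i : E d} (hi : i ∈ T.verts) (hBΩ : T.box i ⊆ Ω)
    {h : ℝ} (hh : 0 ≤ h) (hb : T.box i ⊆ Metric.closedBall i h) {q : E d → ℝ}
    (hq : MemH2loc Ω q) :
    ∃ η : E d → ℝ, (∀ j, 0 ≤ η j) ∧
      ∑ j ∈ T.others i, dist i j * η j ≤ 2 * ((d + 1) * 2 ^ (d + 2) + 1) * (h ^ 2 *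
          ∑ m, ∫ x in T.box i, ‖weakGrad Ω (fun y => weakGrad Ω q y m) x‖ ^ 2) ∧
      ∀ j ∈ T.others i, ∀ n : E d, ‖n‖ = 1 →
        (T.faceArea i j * inner ℝ (∫ x in T.box i, weakGrad Ω q x) n - T.boxVol i *
          ∫ x in T.face i j, faceTrace (T.face i j) (fun x => inner ℝ (weakGrad Ω q x) n) x
            ∂(surf d)) ^ 2 ≤ T.boxVol i ^ 2 * (T.faceArea i j * η j) := by
  have hbd : Bornology.IsBounded (T.box i) := Metric.isBounded_closedBall.subset hb
  have hK := T.isCompact_box hbd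
  set H : Fin d → E d → E d := fun m => weakGrad Ω fun y => weakGrad Ω q y m with hHdef
  have hH : ∀ m, IsLocalH1 Ω (fun x => weakGrad Ω q x m) (H m) := fun m => (hq.2 m).isLocalH1
  have hP0 : 0 ≤ ∑ m, ∫ x in T.box i, ‖H m x‖ ^ 2 :=
    Finset.sum_nonneg fun m _ => integral_nonneg fun x => by positivity
  by_cases hV : volume (T.box i) = 0
  · refine ⟨fun _ => 0, fun _ => le_rfl, ?_, fun j _ n _ => ?_⟩
    · simp only [mul_zero, Finset.sum_const_zero]
      positivity
    · simp [boxVol, Measure.real, hV, Measure.restrict_eq_zero.2 hV]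
  have hVt := hK.measure_lt_top (μ := volume)
  have hV0 : 0 < T.boxVol i := ENNReal.toReal_pos hV hVt.ne
  choose g hg1 _ hg3 using fun m => T.exists_hasTrace_box hΩ hi hBΩ hb (hH m)
  set a : Fin d → ℝ := fun m => ⨍ y in T.box i, weakGrad Ω q y m with ha
  have hfin : ∀ j ∈ T.others i, IsFiniteMeasure ((surf d).restrict (T.face i j)) := fun j hj =>
    ⟨by simpa using T.surf_face_lt_top hi hj hbd⟩
  have hmem : ∀ m, ∀ j ∈ T.others i,
      MemLp (fun x => g m j x - a m) 2 ((surf d).restrict (T.face i j)) := fun m j hj => by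
    have := hfin j hj
    exact (hg1 m j hj).isFaceTrace.1.sub (memLp_const _)
  have hGi : IntegrableOn (weakGrad Ω q) (T.box i) := hq.1.2.2.integrableOn hK hBΩ
  refine ⟨fun j => ∑ m, ∫ x in T.face i j, (g m j x - a m) ^ 2 ∂(surf d),
    fun j => Finset.sum_nonneg fun m _ => integral_nonneg fun x => sq_nonneg _, ?_, ?_⟩
  · have hm : ∀ m, ∑ j ∈ T.others i, dist i j / 2 *
          ∫ x in T.face i j, (g m j x - a m) ^ 2 ∂(surf d)
        ≤ ((d + 1) * 2 ^ (d + 2) + 1) * (h ^ 2 * ∫ x in T.box i, ‖H m x‖ ^ 2) := by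
      intro m
      have h3 := hg3 m hV
      have hHm : IntegrableOn (fun x => ‖H m x‖ ^ 2) (T.box i) :=
        ((hH m).memL2_grad _ hK hBΩ).norm.integrable_sq
      have e1 : ENNReal.ofReal (∫ x in T.box i, ‖H m x‖ ^ 2)
          = ∫⁻ x in T.box i, ‖H m x‖ₑ ^ 2 := by
        rw [ofReal_setIntegral_sq hHm]
        simp only [enorm_norm]
      have e2 : ∀ j ∈ T.others i, ENNReal.ofReal (dist i j / 2) *
            ∫⁻ x in T.face i j, ‖g m j x - a m‖ₑ ^ 2 ∂(surf d)
          = ENNReal.ofReal (dist i j / 2 *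
            ∫ x in T.face i j, (g m j x - a m) ^ 2 ∂(surf d)) := by
        intro j hj
        rw [ENNReal.ofReal_mul (by positivity), ofReal_setIntegral_sq (hmem m j hj).integrable_sq]
      rw [Finset.sum_congr rfl e2, ← ENNReal.ofReal_sum_of_nonneg fun j _ => mul_nonneg
        (by positivity) (integral_nonneg fun x => sq_nonneg _), ← e1,
        ← ENNReal.ofReal_pow hh, ← ENNReal.ofReal_mul (by positivity)] at h3
      have e3 : ((d + 1) * 2 ^ (d + 2) + 1 : ℝ≥0∞)
          = ENNReal.ofReal ((d + 1) * 2 ^ (d + 2) + 1) := by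
        rw [ENNReal.ofReal_add (by positivity) zero_le_one, ENNReal.ofReal_mul (by positivity),
          ENNReal.ofReal_add (by positivity) zero_le_one, ENNReal.ofReal_pow (by norm_num)]
        simp
      rw [e3, ← ENNReal.ofReal_mul (by positivity)] at h3
      refine (ENNReal.ofReal_le_ofReal_iff ?_).1 h3
      have : 0 ≤ ∫ x in T.box i, ‖H m x‖ ^ 2 := integral_nonneg fun x => sq_nonneg _
      positivity
    calc ∑ j ∈ T.others i, dist i j * ∑ m, ∫ x in T.face i j, (g m j x - a m) ^ 2 ∂(surf d)
        = 2 * ∑ m, ∑ j ∈ T.others i, dist i j / 2 *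
            ∫ x in T.face i j, (g m j x - a m) ^ 2 ∂(surf d) := by
          rw [Finset.sum_comm, Finset.mul_sum]
          refine Finset.sum_congr rfl fun j _ => ?_
          rw [Finset.mul_sum, Finset.mul_sum]
          exact Finset.sum_congr rfl fun m _ => by ring
      _ ≤ 2 * ∑ m, ((d + 1) * 2 ^ (d + 2) + 1) * (h ^ 2 * ∫ x in T.box i, ‖H m x‖ ^ 2) := by
          gcongr with m
          exact hm m
      _ = _ := by simp only [← Finset.mul_sum, mul_assoc, hHdef]
  · intro j hj n hn
    have := hfin j hj
    have hae := (HasTrace.inner_const (T.isClosed_face i j).measurableSet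
      (fun m => hg1 m j hj) n).faceTrace_ae_eq
    have hgi : ∀ m, IntegrableOn (g m j) (T.face i j) (surf d) := fun m =>
      (hg1 m j hj).integrableOn_trace (T.surf_face_lt_top hi hj hbd)
    have hP : inner ℝ (∫ x in T.box i, weakGrad Ω q x) n = T.boxVol i * ∑ m, n m * a m := by
      have h1 : ∀ m, (∫ x in T.box i, weakGrad Ω q x) m = T.boxVol i * a m := by
        intro m
        have h2 : (∫ x in T.box i, weakGrad Ω q x) m = ∫ x in T.box i, weakGrad Ω q x m :=
          ((EuclideanSpace.proj (𝕜 := ℝ) m : E d →L[ℝ] ℝ).integral_comp_comm hGi).symm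
        rw [h2, ha]
        simp only [setAverage_eq, smul_eq_mul]
        exact (mul_inv_cancel_left₀ hV0.ne' _).symm
      rw [PiLp.inner_apply, Finset.mul_sum]
      refine Finset.sum_congr rfl fun m _ => ?_
      rw [h1]
      simp
      ring
    have e1 : T.faceArea i j * inner ℝ (∫ x in T.box i, weakGrad Ω q x) n - T.boxVol i *
          ∫ x in T.face i j, faceTrace (T.face i j) (fun x => inner ℝ (weakGrad Ω q x) n) x
            ∂(surf d)
        = - T.boxVol i * ∫ x in T.face i j, ∑ m, n m * (g m j x - a m) ∂(surf d) := by
      rw [hP, integral_congr_ae hae]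
      simp only [mul_sub, Finset.sum_sub_distrib]
      rw [integral_sub (integrable_finsetSum _ fun m _ => (hgi m).const_mul _)
        (integrable_const _)]
      simp only [integral_const, smul_eq_mul, measureReal_restrict_apply_univ]
      change T.faceArea i j * _ - _ = - T.boxVol i * (_ - T.faceArea i j * _)
      ring
    rw [e1, mul_pow, neg_sq]
    refine mul_le_mul_of_nonneg_left ?_ (sq_nonneg _)
    have hL : MemLp (fun x => ∑ m, n m * (g m j x - a m)) 2
        ((surf d).restrict (T.face i j)) :=
      memLp_finsetSum _ fun m _ => (hmem m j hj).const_mul (n m)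
    refine (sq_setIntegral_le (T.surf_face_lt_top hi hj hbd) hL).trans ?_
    refine mul_le_mul_of_nonneg_left ?_ (T.faceArea_nonneg i j)
    have hsqi : ∀ m, IntegrableOn (fun x => (g m j x - a m) ^ 2) (T.face i j) (surf d) :=
      fun m => (hmem m j hj).integrable_sq
    change _ ≤ ∑ m, ∫ x in T.face i j, (g m j x - a m) ^ 2 ∂(surf d)
    rw [← integral_finsetSum _ fun m _ => hsqi m]
    refine integral_mono hL.integrable_sq (integrable_finsetSum _ fun m _ => hsqi m) fun x => ?_
    refine (Finset.sum_mul_sq_le_sq_mul_sq _ _ _).trans_eq ?_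
    have : ∑ m, n m ^ 2 = 1 := by
      rw [← one_pow (M := ℝ) 2, ← hn, EuclideanSpace.norm_sq_eq]
      simp
    rw [this, one_mul]

end Triangulation

/-! ### The stabilization of the exact pressure -/

lemma sum_sum_sqrt_mul_sqrt_le {ι : Type*} (s : Finset ι) (t : ι → Finset ι) {f g : ι → ι → ℝ}
    (hf : ∀ i j, 0 ≤ f i j) (hg : ∀ i j, 0 ≤ g i j) :
    ∑ i ∈ s, ∑ j ∈ t i, √(f i j) * √(g i j)
      ≤ √(∑ i ∈ s, ∑ j ∈ t i, f i j) * √(∑ i ∈ s, ∑ j ∈ t i, g i j) := by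
  simp only [Finset.sum_sigma']
  exact Real.sum_sqrt_mul_sqrt_le (s.sigma t) (f := fun p => f p.1 p.2)
    (g := fun p => g p.1 p.2) (fun p => hf _ _) fun p => hg _ _

namespace Triangulation

variable {Ω : Set (E d)} {T : Triangulation Ω} {γ δ κ ν : ℝ}

lemma IsRegular.boxVol_mul_inv_diag_le (hT : T.IsRegular γ δ κ) (hd : 2 ≤ d) (hν : 0 < ν)
    (hδ : 0 < δ) (hκ : 0 < κ) {i j : E d} (hi : i ∈ T.intVerts) (hj : j ∈ T.nbrs i) :
    0 < T.diag ν i ∧ T.boxVol i * (T.diag ν i)⁻¹ ≤ κ ^ 3 / (ν * δ ^ (d - 2)) * T.h ^ 2 := by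
  have hh := hT.h_pos hκ hi hj
  have h1 := hT.le_diag hd hν hδ hκ hi hj
  have h0 : 0 < ν * (κ⁻¹ ^ 2 * (δ * T.h) ^ (d - 2)) := by positivity
  refine ⟨h0.trans_le h1, ?_⟩
  rw [← div_eq_mul_inv]
  refine (div_le_div₀ (by positivity) (hT.boxVol_le hκ hi) h0 h1).trans_eq ?_
  have : T.h ^ d = T.h ^ (d - 2) * T.h ^ 2 := by rw [← pow_add]; congr 1; omega
  rw [this, mul_pow]
  field_simp

/-- The sum of the squared jumps over the faces. -/
lemma IsRegular.sum_jump_sq_le (hT : T.IsRegular γ δ κ) (hΩb : Bornology.IsBounded Ω)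
    (hδ : 0 < δ) (hκ : 0 < κ) (hh : 0 < T.h) (w : E d → ℝ) :
    ∑ i ∈ T.intVerts, ∑ j ∈ T.nbrs i, T.faceArea i j * jump w i j ^ 2 / dist i j
      ≤ 8 * d * (κ / (δ * T.h)) ^ 2 * ∑ i ∈ T.intVerts, T.boxVol i * w i ^ 2 := by
  have hA := T.faceArea_nonneg
  have h1 : ∀ i ∈ T.intVerts, ∑ j ∈ T.nbrs i, T.faceArea i j / dist i j * w i ^ 2
      ≤ 2 * d * (κ / (δ * T.h)) ^ 2 * (T.boxVol i * w i ^ 2) := by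
    intro i hi
    have h2 : ∀ j ∈ T.nbrs i, T.faceArea i j / dist i j
        ≤ 2 * (κ / (δ * T.h)) ^ 2 * (dist i j / 2 * T.faceArea i j) := by
      intro j hj
      have h0 : 0 < dist i j := dist_pos.2 (T.mem_nbrs.1 hj).2.1.symm
      have h3 : 1 ≤ κ / (δ * T.h) * dist i j := by
        have := hT.le_dist hκ hi hj
        rw [inv_mul_le_iff₀ hκ] at this
        rwa [div_mul_eq_mul_div, one_le_div (by positivity)]
      have h4 : 1 ≤ (κ / (δ * T.h) * dist i j) ^ 2 := one_le_pow₀ h3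
      rw [div_le_iff₀ h0]
      calc T.faceArea i j = T.faceArea i j * 1 := (mul_one _).symm
        _ ≤ T.faceArea i j * (κ / (δ * T.h) * dist i j) ^ 2 :=
          mul_le_mul_of_nonneg_left h4 (hA i j)
        _ = _ := by ring
    rw [← Finset.sum_mul]
    calc (∑ j ∈ T.nbrs i, T.faceArea i j / dist i j) * w i ^ 2
        ≤ (∑ j ∈ T.nbrs i, 2 * (κ / (δ * T.h)) ^ 2 * (dist i j / 2 * T.faceArea i j)) * w i ^ 2 :=
          mul_le_mul_of_nonneg_right (Finset.sum_le_sum h2) (sq_nonneg _)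
      _ ≤ (∑ j ∈ T.others i, 2 * (κ / (δ * T.h)) ^ 2 * (dist i j / 2 * T.faceArea i j))
          * w i ^ 2 := by
          refine mul_le_mul_of_nonneg_right (Finset.sum_le_sum_of_subset_of_nonneg
            (fun j hj => T.mem_others_of_mem_nbrs hj) fun j _ _ => ?_) (sq_nonneg _)
          have := hA i j
          positivity
      _ = _ := by
          rw [← Finset.mul_sum, T.sum_dist_mul_faceArea (T.mem_verts_of_mem_intVerts hi)
            (hΩb.subset (hT.box_subset i hi))]
          ring
  calc ∑ i ∈ T.intVerts, ∑ j ∈ T.nbrs i, T.faceArea i j * jump w i j ^ 2 / dist i j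
      ≤ ∑ i ∈ T.intVerts, ∑ j ∈ T.nbrs i, (2 * (T.faceArea i j / dist i j * w i ^ 2)
          + 2 * (T.faceArea j i / dist j i * w j ^ 2)) := by
        refine Finset.sum_le_sum fun i _ => Finset.sum_le_sum fun j _ => ?_
        rw [T.faceArea_comm j i, dist_comm j i, mul_div_right_comm, jump]
        have := mul_nonneg (div_nonneg (hA i j) (dist_nonneg (x := i) (y := j)))
          (sq_nonneg (w i + w j))
        linarith
    _ = 4 * ∑ i ∈ T.intVerts, ∑ j ∈ T.nbrs i, T.faceArea i j / dist i j * w i ^ 2 := by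
        simp only [Finset.sum_add_distrib, ← Finset.mul_sum]
        rw [← T.sum_nbrs_comm fun i j => T.faceArea i j / dist i j * w i ^ 2]
        ring
    _ ≤ 4 * ∑ i ∈ T.intVerts, 2 * d * (κ / (δ * T.h)) ^ 2 * (T.boxVol i * w i ^ 2) := by
        gcongr with i hi
        exact h1 i hi
    _ = _ := by rw [← Finset.mul_sum]; ring

/-- The constant in the trace inequality, summed over the components. -/
def traceConst (d : ℕ) : ℝ := 2 * ((d + 1) * 2 ^ (d + 2) + 1)

lemma traceConst_pos (d : ℕ) : 0 < traceConst d := by rw [traceConst]; positivity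

/-- The constant in the estimate of the stabilization. -/
def stabConst (d : ℕ) (ν δ κ : ℝ) : ℝ :=
  (1 + κ / δ) * (κ ^ 3 / (ν * δ ^ (d - 2))) * (√(traceConst d) * √(8 * d) * (κ / δ))

/-- The stabilization of a function of class `H²_loc`. -/
theorem IsRegular.abs_sB_le (hT : T.IsRegular γ δ κ) (hd : 2 ≤ d) (hΩ : IsOpen Ω)
    (hΩb : Bornology.IsBounded Ω) (hν : 0 < ν) (hδ : 0 < δ) (hκ : 0 < κ) {q : E d → ℝ}
    (hq : MemH2loc Ω q) (w : E d → ℝ) :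
    |T.sB ν q w| ≤ stabConst d ν δ κ * T.h ^ 2 *
      √(∑ i ∈ T.intVerts, ∑ m, ∫ x in T.box i,
        ‖weakGrad Ω (fun y => weakGrad Ω q y m) x‖ ^ 2) *
      √(∑ i ∈ T.intVerts, T.boxVol i * w i ^ 2) := by
  by_cases hN : ∃ i ∈ T.intVerts, ∃ j, j ∈ T.nbrs i
  swap
  · push Not at hN
    have h0 : ∀ Φ, T.sumFaces Φ = 0 := by
      intro Φ
      rw [sumFaces, Finset.sum_eq_zero fun i hi => ?_, mul_zero]
      rw [Finset.eq_empty_of_forall_notMem (hN i hi), Finset.sum_empty]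
    rw [sB, sB1, sB2, h0, h0, sub_zero, abs_zero, stabConst]
    have := traceConst_pos d
    positivity
  obtain ⟨i₀, hi₀, j₀, hj₀⟩ := hN
  have hh : 0 < T.h := hT.h_pos hκ hi₀ hj₀
  have hex := fun i (hi : i ∈ T.intVerts) =>
    T.exists_flux_deviation hΩ (T.mem_verts_of_mem_intVerts hi) (hT.box_subset i hi)
      T.h_nonneg (T.box_subset_closedBall (hT.box_subset i hi)) hq
  choose! η hη0 hη1 hη2 using hex
  set β : E d → ℝ := fun i => ∑ m, ∫ x in T.box i,
    ‖weakGrad Ω (fun y => weakGrad Ω q y m) x‖ ^ 2 with hβ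
  have hA := T.faceArea_nonneg
  have hV := T.boxVol_nonneg
  set c : ℝ := κ ^ 3 / (ν * δ ^ (d - 2)) with hc
  have hc0 : 0 ≤ c := by positivity
  set η' : E d → E d → ℝ := fun i j => |η i j| with hη'
  set Φ : E d → E d → ℝ := fun i j => (1 + κ / δ) * (c * T.h ^ 2) *
    (√(dist i j * η' i j) * √(T.faceArea i j * jump w i j ^ 2 / dist i j)) with hΦ
  have hflux : ∀ i ∈ T.intVerts, ∀ j ∈ T.nbrs i, ∀ n : E d, ‖n‖ = 1 →
      |(T.diag ν i)⁻¹ * (T.faceArea i j * inner ℝ (∫ x in T.box i, weakGrad Ω q x) n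
        - T.boxVol i * ∫ x in T.face i j,
          faceTrace (T.face i j) (fun x => inner ℝ (weakGrad Ω q x) n) x ∂(surf d))
        * jump w i j|
      ≤ c * T.h ^ 2 *
        (√(dist i j * η' i j) * √(T.faceArea i j * jump w i j ^ 2 / dist i j)) := by
    intro i hi j hj n hn
    have h0 : 0 < dist i j := dist_pos.2 (T.mem_nbrs.1 hj).2.1.symm
    obtain ⟨hD, hVD⟩ := hT.boxVol_mul_inv_diag_le hd hν hδ hκ hi hj
    have h1 := Real.abs_le_sqrt (hη2 i hi j (T.mem_others_of_mem_nbrs hj) n hn)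
    rw [Real.sqrt_mul (sq_nonneg _), Real.sqrt_sq (hV i)] at h1
    have h2 : √(dist i j * η' i j) * √(T.faceArea i j * jump w i j ^ 2 / dist i j)
        = √(T.faceArea i j * η i j) * |jump w i j| := by
      simp only [hη']
      rw [abs_of_nonneg (hη0 i hi j), ← Real.sqrt_mul (mul_nonneg dist_nonneg (hη0 i hi j)),
        ← Real.sqrt_sq_eq_abs, ← Real.sqrt_mul (mul_nonneg (hA i j) (hη0 i hi j))]
      congr 1
      field_simp
    rw [abs_mul, abs_mul, abs_of_pos (inv_pos.2 hD), h2]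
    calc (T.diag ν i)⁻¹ * _ * |jump w i j|
        ≤ (T.diag ν i)⁻¹ * (T.boxVol i * √(T.faceArea i j * η i j)) * |jump w i j| := by gcongr
      _ = T.boxVol i * (T.diag ν i)⁻¹ * (√(T.faceArea i j * η i j) * |jump w i j|) := by ring
      _ ≤ _ := mul_le_mul_of_nonneg_right hVD (by positivity)
  have hterm : ∀ i ∈ T.intVerts, ∀ j ∈ T.nbrs i,
      |(∫ _x in T.face i j,
        inner ℝ ((T.weight i j * (T.diag ν i)⁻¹) • (∫ y in T.box i, weakGrad Ω q y)
          + ((1 - T.weight i j) * (T.diag ν j)⁻¹) • (∫ y in T.box j, weakGrad Ω q y))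
          (normal i j) * jump w i j ∂(surf d))
        - ∫ x in T.face i j, (T.weight i j * T.boxVol i * (T.diag ν i)⁻¹
          + (1 - T.weight i j) * T.boxVol j * (T.diag ν j)⁻¹)
          * T.normalDeriv q i j x * jump w i j ∂(surf d)| ≤ Φ i j + Φ j i := by
    intro i hi j hj
    obtain ⟨hij, hjI⟩ := T.mem_nbrs_comm.1 ⟨hi, hj⟩
    have hn : ‖normal i j‖ = 1 := norm_normal (T.mem_nbrs.1 hj).2.1.symm
    have f1 := hflux i hi j hj (normal i j) hn
    have f2 := hflux j hjI i hij (normal i j) hn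
    rw [T.face_comm j i, T.faceArea_comm j i, dist_comm j i] at f2
    have hω0 := T.weight_nonneg i j
    have hω1 := hT.weight_le hδ hκ hi hj
    have hJ : jump w j i ^ 2 = jump w i j ^ 2 := by rw [jump, jump]; ring
    have hJ' : |jump w j i| = |jump w i j| := abs_sub_comm _ _
    rw [setIntegral_const, integral_mul_const, integral_const_mul]
    set N := ∫ x in T.face i j, T.normalDeriv q i j x ∂(surf d)
    set Pi := ∫ y in T.box i, weakGrad Ω q y
    set Pj := ∫ y in T.box j, weakGrad Ω q y
    have hsplit : (surf d).real (T.face i j) • (inner ℝ ((T.weight i j * (T.diag ν i)⁻¹) • Pi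
          + ((1 - T.weight i j) * (T.diag ν j)⁻¹) • Pj) (normal i j) * jump w i j)
        - (T.weight i j * T.boxVol i * (T.diag ν i)⁻¹
          + (1 - T.weight i j) * T.boxVol j * (T.diag ν j)⁻¹) * N * jump w i j
        = T.weight i j * ((T.diag ν i)⁻¹ * (T.faceArea i j * inner ℝ Pi (normal i j)
            - T.boxVol i * N) * jump w i j)
          + (1 - T.weight i j) * ((T.diag ν j)⁻¹ * (T.faceArea i j * inner ℝ Pj (normal i j)
            - T.boxVol j * N) * jump w i j) := by
      rw [inner_add_left, real_inner_smul_left, real_inner_smul_left, smul_eq_mul]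
      change T.faceArea i j * _ - _ = _
      ring
    rw [hsplit]
    refine (abs_add_le _ _).trans (add_le_add ?_ ?_)
    · simp only [hΦ]
      rw [abs_mul, mul_assoc (1 + κ / δ)]
      refine mul_le_mul ?_ f1 (abs_nonneg _) (by positivity)
      rw [abs_of_nonneg hω0]
      linarith
    · simp only [hΦ]
      rw [abs_mul, mul_assoc (1 + κ / δ)]
      refine mul_le_mul ?_ ?_ (abs_nonneg _) (by positivity)
      · rw [abs_le]
        have : 0 ≤ κ / δ := by positivity
        constructor <;> linarith
      · rw [abs_mul] at f2 ⊢
        rw [hJ'] at f2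
        rwa [T.faceArea_comm j i, dist_comm j i]
  have hsB : |T.sB ν q w| ≤ ∑ i ∈ T.intVerts, ∑ j ∈ T.nbrs i, Φ i j := by
    rw [sB, sB1, sB2, sumFaces, sumFaces, ← mul_sub, ← Finset.sum_sub_distrib, abs_mul,
      abs_of_pos (by norm_num : (0 : ℝ) < 1 / 2)]
    simp only [← Finset.sum_sub_distrib]
    have h1 : |∑ i ∈ T.intVerts, ∑ j ∈ T.nbrs i, _| ≤ ∑ i ∈ T.intVerts, ∑ j ∈ T.nbrs i,
        (Φ i j + Φ j i) :=
      (Finset.abs_sum_le_sum_abs _ _).trans (Finset.sum_le_sum fun i hi =>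
        (Finset.abs_sum_le_sum_abs _ _).trans (Finset.sum_le_sum fun j hj => hterm i hi j hj))
    simp only [Finset.sum_add_distrib] at h1
    rw [← T.sum_nbrs_comm Φ] at h1
    linarith
  have ha : ∑ i ∈ T.intVerts, ∑ j ∈ T.nbrs i, dist i j * η' i j
      ≤ traceConst d * T.h ^ 2 * ∑ i ∈ T.intVerts, β i := by
    rw [Finset.mul_sum]
    refine Finset.sum_le_sum fun i hi => ?_
    rw [mul_assoc]
    refine le_trans ?_ (hη1 i hi)
    simp only [hη', abs_of_nonneg (hη0 i hi _)]
    exact Finset.sum_le_sum_of_subset_of_nonneg (fun j hj => T.mem_others_of_mem_nbrs hj)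
      fun j _ _ => mul_nonneg dist_nonneg (hη0 i hi j)
  have hb := hT.sum_jump_sq_le hΩb hδ hκ hh w
  refine hsB.trans ?_
  simp only [hΦ, ← Finset.mul_sum]
  have hCS := sum_sum_sqrt_mul_sqrt_le T.intVerts T.nbrs (f := fun i j => dist i j * η' i j)
    (g := fun i j => T.faceArea i j * jump w i j ^ 2 / dist i j) (fun i j => by positivity)
    (fun i j => div_nonneg (mul_nonneg (hA i j) (sq_nonneg _)) dist_nonneg)
  have hK := traceConst_pos d
  have hsa : √(∑ i ∈ T.intVerts, ∑ j ∈ T.nbrs i, dist i j * η' i j)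
      ≤ √(traceConst d) * T.h * √(∑ i ∈ T.intVerts, β i) := by
    refine (Real.sqrt_le_sqrt ha).trans_eq ?_
    rw [Real.sqrt_mul (by positivity), Real.sqrt_mul hK.le, Real.sqrt_sq hh.le]
  have hsb : √(∑ i ∈ T.intVerts, ∑ j ∈ T.nbrs i, T.faceArea i j * jump w i j ^ 2 / dist i j)
      ≤ √(8 * d) * (κ / (δ * T.h)) * √(∑ i ∈ T.intVerts, T.boxVol i * w i ^ 2) := by
    refine (Real.sqrt_le_sqrt hb).trans_eq ?_
    rw [Real.sqrt_mul (by positivity), Real.sqrt_mul (by positivity),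
      Real.sqrt_sq (by positivity)]
  calc _ ≤ (1 + κ / δ) * (c * T.h ^ 2) *
        ((√(traceConst d) * T.h * √(∑ i ∈ T.intVerts, β i)) *
          (√(8 * d) * (κ / (δ * T.h)) * √(∑ i ∈ T.intVerts, T.boxVol i * w i ^ 2))) := by
        refine mul_le_mul_of_nonneg_left (hCS.trans ?_) (by positivity)
        gcongr
    _ = _ := by
        rw [stabConst, ← hc]
        field_simp

end Triangulation

namespace Triangulation

variable {Ω : Set (E d)} (T : Triangulation Ω)

lemma l2Norm_lump_le_boxNorm (v : E d → E d) (q : E d → ℝ) :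
    l2Norm Ω (T.lump q) ≤ T.boxNorm v q := by
  refine Real.le_sqrt_of_sq_le ?_
  have := sq_nonneg (h1SemiV Ω v)
  have := sq_nonneg (T.starSemi q)
  linarith

lemma ofReal_sqrt_le_brokenSemiGrad (hΩb : Bornology.IsBounded Ω)
    (hB : ∀ i ∈ T.intVerts, T.box i ⊆ Ω) {q : E d → ℝ} (hq : MemH2loc Ω q) :
    ENNReal.ofReal √(∑ i ∈ T.intVerts, ∑ m, ∫ x in T.box i,
      ‖weakGrad Ω (fun y => weakGrad Ω q y m) x‖ ^ 2) ≤ T.brokenSemiGrad q := by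
  have h0 : ∀ i m, 0 ≤ ∫ x in T.box i, ‖weakGrad Ω (fun y => weakGrad Ω q y m) x‖ ^ 2 :=
    fun i m => integral_nonneg fun x => sq_nonneg _
  have e1 : ∀ i ∈ T.intVerts, ∀ m, ENNReal.ofReal (∫ x in T.box i,
        ‖weakGrad Ω (fun y => weakGrad Ω q y m) x‖ ^ 2)
      = ∫⁻ x in T.box i, ‖weakGrad Ω (fun y => weakGrad Ω q y m) x‖ₑ ^ 2 := by
    intro i hi m
    rw [ofReal_setIntegral_sq ((hq.2 m).2.2 _ (T.isCompact_box (hΩb.subset (hB i hi)))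
      (hB i hi)).norm.integrable_sq]
    simp only [enorm_norm]
  rw [Real.sqrt_eq_rpow, ← ENNReal.ofReal_rpow_of_nonneg
    (Finset.sum_nonneg fun i _ => Finset.sum_nonneg fun m _ => h0 i m) (by norm_num),
    brokenSemiGrad]
  refine ENNReal.rpow_le_rpow ?_ (by norm_num)
  rw [Finset.sum_comm, ENNReal.ofReal_sum_of_nonneg fun m _ => Finset.sum_nonneg fun i _ => h0 i m,
    Finset.sum_comm (s := T.elems)]
  refine Finset.sum_le_sum fun m _ => ?_
  rw [ENNReal.ofReal_sum_of_nonneg fun i _ => h0 i m, Finset.sum_congr rfl fun i hi => e1 i hi m]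
  exact T.sum_setLIntegral_box_le hB _

/-- The stabilization of the exact pressure, in the norms of the error estimate. -/
theorem IsRegular.ofReal_abs_sB_le {T : Triangulation Ω} {γ δ κ ν : ℝ} (hT : T.IsRegular γ δ κ)
    (hd : 2 ≤ d) (hΩ : IsOpen Ω) (hΩb : Bornology.IsBounded Ω) (hν : 0 < ν) (hδ : 0 < δ)
    (hκ : 0 < κ) {p : E d → ℝ} (hp : MemH2loc Ω p) (v : E d → E d) (q : E d → ℝ) :
    ENNReal.ofReal |T.sB ν p (T.lump q)|
      ≤ ENNReal.ofReal (stabConst d ν δ κ * √(Metric.diam Ω)) *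
        (ENNReal.ofReal (T.h ^ (3 / 2 : ℝ)) * T.brokenSemiGrad p) *
        ENNReal.ofReal (T.boxNorm v q) := by
  have hS : 0 ≤ stabConst d ν δ κ := by
    have := traceConst_pos d
    rw [stabConst]
    positivity
  have hh := T.h_nonneg
  have hq : ∑ i ∈ T.intVerts, T.boxVol i * T.lump q i ^ 2 = l2Norm Ω (T.lump q) ^ 2 := by
    rw [T.l2Norm_lump_sq hΩb hT.box_subset]
    exact Finset.sum_congr rfl fun i hi => by rw [T.lump_apply_self q hi]
  have h1 := hT.abs_sB_le hd hΩ hΩb hν hδ hκ hp (T.lump q)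
  have hl : 0 ≤ l2Norm Ω (T.lump q) := Real.sqrt_nonneg _
  rw [hq, Real.sqrt_sq hl] at h1
  have h2 : T.h ^ 2 ≤ √(Metric.diam Ω) * T.h ^ (3 / 2 : ℝ) := by
    have e : T.h ^ 2 = √T.h * T.h ^ (3 / 2 : ℝ) := by
      rw [Real.sqrt_eq_rpow, ← Real.rpow_add_of_nonneg hh (by norm_num) (by norm_num),
        ← Real.rpow_natCast]
      norm_num
    rw [e]
    exact mul_le_mul_of_nonneg_right (Real.sqrt_le_sqrt (T.h_le_diam hΩb)) (by positivity)
  have h3 : 0 ≤ T.h ^ (3 / 2 : ℝ) := by positivity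
  refine (ENNReal.ofReal_le_ofReal (h1.trans (mul_le_mul (mul_le_mul_of_nonneg_right
    (mul_le_mul_of_nonneg_left h2 hS) (Real.sqrt_nonneg _)) (T.l2Norm_lump_le_boxNorm v q)
    (Real.sqrt_nonneg _) (by positivity)))).trans ?_
  rw [← mul_assoc (stabConst d ν δ κ), ENNReal.ofReal_mul (by positivity),
    ENNReal.ofReal_mul (by positivity), ENNReal.ofReal_mul (by positivity), ← mul_assoc]
  gcongr
  exact T.ofReal_sqrt_le_brokenSemiGrad hΩb hT.box_subset hp

end Triangulation

end BoxMethod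

end

theorem mainTheorem3 (d : ℕ) (hd : d = 2 ∨ d = 3) (Ω : Set (E d)) (hΩ : IsRegularDomain Ω)
    (ν : ℝ) (hν : 0 < ν) (γ δ κ : ℝ) (hγ : 0 < γ) (hδ : 0 < δ) (hκ : 0 < κ) :
    ∃ C : ℝ, 0 < C ∧ ∀ T : Triangulation Ω, T.IsRegular γ δ κ →
      ∀ (f g u : E d → E d) (p : E d → ℝ), MemL2 Ω f → (∀ k, MemH1 Ω (comp g k)) →
      IsStokesSolution ν Ω f g u p → MemH2loc Ω p →
      ∀ (gh uB : E d → E d) (pB : E d → ℝ), T.MemVhV gh → T.IsBoxSolution ν f gh uB pB →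
      ∀ (vh : E d → E d) (qh : E d → ℝ), T.MemVhV vh → T.MemVh qh →
        ENNReal.ofReal |T.CB ν u p (T.lump vh) (T.lump qh)
            - T.CBt ν uB pB (T.lump vh) (T.lump qh)|
          ≤ ENNReal.ofReal C
            * (ENNReal.ofReal (T.h ^ 2 * l2Norm Ω f + T.h * h1Semi Ω pB)
                + ENNReal.ofReal (T.h ^ (3 / 2 : ℝ)) * T.brokenSemiGrad p)
            * ENNReal.ofReal (T.boxNorm vh qh) := by
  refine ⟨Triangulation.stabConst d ν δ κ * √(Metric.diam Ω) + 1, ?_, ?_⟩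
  · have := Triangulation.traceConst_pos d
    rw [Triangulation.stabConst]
    positivity
  intro T hT f g u p hf _ hs hp gh uB pB _ hbox vh qh hv hq
  rw [T.CB_sub_CBt hν hΩ.isOpen hΩ.isBounded hf hp.1 hs hT.box_subset hbox hv hq]
  refine (hT.ofReal_abs_sB_le (by omega) hΩ.isOpen hΩ.isBounded hν hδ hκ hp vh qh).trans ?_
  gcongr
  · linarith
  · exact le_add_self
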